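/- Let $X\subset\mathbb{R}^2$ be a compact convex polygon with $m$ sides, given by the lines of its sides, and let $p_1,\dots,p_n$ be distinct points (sites) in the interior of $X$. The Voronoi cell of $p_k$ is $R_k=\{x\in X: |x-p_k|\le |x-p_j|\ \forall j\ne k\}$; $e_k$ denotes the number of its edges. For a unit vector $\theta$ put $T(\theta)=\sup\{t\ge 0: p_k+t\theta\in R_k\}$; the endpoint of the ray from $p_k$ in direction $\theta$ is $p_k+T(\theta)\theta$. *Shooting a ray* in direction $\theta$: start with $y$ at the intersection of the ray with the boundary of $X$; go over a list of sites; whenever a listed site $a$ satisfies $|y-a|<|y-p_k|$, replace $y$ by the intersection of the ray with the bisector of $a$ and $p_k$. The final $y$ is reported together with a line $L$ containing it: the bisector of $p_k$ and the site nearest to $p_k$ among the sites $a\neq p_k$ found with $|y-a|=|y-p_k|$, or, if there is none, the line of a side of $X$. The list may depend on $k$ and $\theta$ and may omit sites, but it must contain every site whose distance to the endpoint equals that of $p_k$ ($p_k$ itself included); the list of all sites is one possible choice. *Algorithm 1* for $p_k$ keeps a queue of pairs of unit vectors (subfaces), initially the three pairs formed from $(\pm\frac{\sqrt3}{2},-\frac12)$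 and $(0,1)$, and repeatedly takes and removes the first pair $\{\theta_1,\theta_2\}$ until the queue is empty. It shoots both rays, obtaining $T_i=T(\theta_i)\theta_i$ and lines $L_i$ with normals $N_i$, and considers the system $B\lambda=H$, $B_{ij}=\langle N_i,T_j\rangle$, $H_i=\langle N_i,T_i\rangle$. - If $\det B=0$ and $L_1=L_2$, nothing more is done. - If $\det B=0$ and $L_1\ne L_2$, the pairs $\{\theta_1,\theta_3\},\{\theta_2,\theta_3\}$ are added to the queue, where $\theta_3=\phi$ is a unit direction vector of the lines if $\phi$ lies in the cone of $\theta_1,\theta_2$, and $\theta_3=-\phi$ otherwise. - If $\det B\ne0$, let $u=p_k+\lambda_1T_1+\lambda_2T_2$. If $\lambda\ge0$ and $u\in R_k$, then $u$ is stored together with $L_1,L_2$. If $\lambda\ge0$ and $u\notin R_k$, the two pairs with $\theta_3=(u-p_k)/|u-p_k|$ are added; if $\lambda\not\ge0$, the two pairs with $\theta_3=(p_k-u)/|p_k-u|$ are added. Whether $u\in R_k$ is tested with the sides of $X$ and by comparing $u$ with the sites listed for the ray from $p_k$ through $u$. Let $r_k$ be the maximum number of distance comparisons done along one of the rays processed in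 the computation of the cell of $p_k$. Arithmetic operations on reals and vectors, comparisons, and array and queue manipulations take one unit of time each (up to a constant factor). Then, with a constant in the $O$'s that depends only on $m$: (a) For every site $p_k$ the algorithm terminates after finitely many steps, and its output contains all vertices and edges of $R_k$: every vertex of $R_k$ is stored, and for every edge of $R_k$ its line is stored with both ends of the edge. Moreover only vertices of $R_k$ are stored. (b) The time for computing the cell of $p_k$ is $O(r_ke_k)$. (c) If no list contains a site twice (each site is examined at most once along a ray), the time for the whole diagram on one processor is $O(n^2)$. (d) If $Q$ processors work independently and processor $i$ computes the cells with indices in a set $A_i$, the time is at most $\max_{1\le i\le Q}\sum_{k\in A_i}O(r_ke_k)$. -/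

import Mathlib

noncomputable section

namespace RayVoronoi

/-! ### Programs with a step count

A real-RAM cost model: every operation on real numbers or on vectors of the plane (arithmetic,
inner product, norm, comparison), together with reading its operands from an array, costs one unit
of time, and so does every manipulation of the queue or of the output. -/

/-- The result of a computation: its value, the number `time` of elementary operations performed,
the number `comps` of distance comparisons on the ray that is being processed, and the list `rays`
with the number of distance comparisons done along each ray that has been completed. -/
structure Timed (α : Type) where
  val : α
  time : ℕ
  comps : ℕ
  rays : List ℕ

instance : Monad Timed where
  pure a := ⟨a, 0, 0, []⟩
  bind x f := ⟨(f x.val).val, x.time + (f x.val).time, x.comps + (f x.val).comps,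
    x.rays ++ (f x.val).rays⟩

/-- One elementary operation with result `a`. -/
def op {α : Type} (a : α) : Timed α := ⟨a, 1, 0, []⟩

/-- One elementary test. -/
def test (P : Prop) [Decidable P] : Timed Bool := op (decide P)

/-- Marks `x` as the computation done along one ray (bookkeeping only, no operation). -/
def alongRay {α : Type} (x : Timed α) : Timed α := ⟨x.val, x.time, 0, x.comps :: x.rays⟩

/-- The largest number of distance comparisons done along a ray. -/
def Timed.maxComps {α : Type} (x : Timed α) : ℕ := x.rays.foldr max 0

/-! ### Geometry -/

/-- The Euclidean plane. -/
abbrev Plane := EuclideanSpace ℝ (Fin 2)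

/-- The intersection of the closed halfplanes `⟪ν j, x⟫ ≤ c j`. -/
def halfplanes {m : ℕ} (ν : Fin m → Plane) (c : Fin m → ℝ) : Set Plane :=
  {x | ∀ j, inner ℝ (ν j) x ≤ c j}

/-- A compact convex polygon with `m` sides, given by outer normals and offsets of the lines that
carry its sides. Each listed line carries a nondegenerate side, and each side is listed once. -/
structure ConvexPolygon (m : ℕ) where
  normal : Fin m → Plane
  offset : Fin m → ℝ
  normal_ne_zero : ∀ j, normal j ≠ 0
  compact : IsCompact (halfplanes normal offset)
  side_nontrivial : ∀ j,
    (halfplanes normal offset ∩ {x | inner ℝ (normal j) x = offset j}).Nontrivial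
  side_injective : Function.Injective fun j =>
    halfplanes normal offset ∩ {x | inner ℝ (normal j) x = offset j}

/-- The region bounded by the polygon. -/
def ConvexPolygon.carrier {m : ℕ} (W : ConvexPolygon m) : Set Plane :=
  halfplanes W.normal W.offset

variable {m n : ℕ}

/-- The Voronoi cell of the site `p k` in the world `W`. -/
def cell (W : ConvexPolygon m) (p : Fin n → Plane) (k : Fin n) : Set Plane :=
  {x | x ∈ W.carrier ∧ ∀ j, j ≠ k → dist x (p k) ≤ dist x (p j)}

/-- An edge of a convex polygon `R`: an exposed face that is a nondegenerate segment. -/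
def IsEdge (R S : Set Plane) : Prop :=
  IsExposed ℝ R S ∧ ∃ a b, a ≠ b ∧ S = segment ℝ a b

/-- The number of edges of the cell of `p k`. -/
def edgeCount (W : ConvexPolygon m) (p : Fin n → Plane) (k : Fin n) : ℕ :=
  {S | IsEdge (cell W p k) S}.ncard

/-- The endpoint of the ray emanating from `p k` in the direction `θ`. -/
def endpoint (W : ConvexPolygon m) (p : Fin n → Plane) (k : Fin n) (θ : Plane) : Plane :=
  p k + sSup {t : ℝ | 0 ≤ t ∧ p k + t • θ ∈ cell W p k} • θ

/-- Stored name of a line: the index of the site `p j` whose bisector with `p k` is meant, or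
the index of a side of the world. -/
inductive LineLabel (n m : ℕ)
  | bisector (j : Fin n)
  | boundary (i : Fin m)

/-- The line named by a label, for the cell of `p k`. -/
def lineSet (W : ConvexPolygon m) (p : Fin n → Plane) (k : Fin n) : LineLabel n m → Set Plane
  | .bisector j => {x | dist x (p k) = dist x (p j)}
  | .boundary i => {x | inner ℝ (W.normal i) x = W.offset i}

/-! ### Which sites are compared along a ray -/

/-- For each cell `k` and each direction `θ`, the list of the sites that are successively
compared with `p k` along the ray. -/
abbrev Scan (n : ℕ) := Fin n → Plane → List (Fin n)

/-- The plain strategy: go once over the array of sites. -/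
def fullScan (n : ℕ) : Scan n := fun _ _ => List.finRange n

/-- A comparison strategy is admissible if the only sites it ever omits along a ray are sites that
are not equidistant with `p k` from the endpoint of that ray. (The trivial comparison with
`p k` itself is part of the list.) -/
def Scan.Admissible (scan : Scan n) (W : ConvexPolygon m) (p : Fin n → Plane) : Prop :=
  ∀ k θ, ‖θ‖ = 1 → ∀ j,
    dist (endpoint W p k θ) (p j) = dist (endpoint W p k θ) (p k) → j ∈ scan k θ

theorem fullScan_admissible (W : ConvexPolygon m) (p : Fin n → Plane) :
    (fullScan n).Admissible W p :=
  fun _ _ _ j _ => List.mem_finRange j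

theorem fullScan_nodup (k : Fin n) (θ : Plane) : (fullScan n k θ).Nodup :=
  List.nodup_finRange n

/-! ### Finding the endpoint of a ray -/

/-- One distance comparison: compares `d(y, a)` to `d(y, b)` (two distances and one comparison). -/
def compareDist (y a b : Plane) : Timed Ordering := ⟨cmp (dist y a) (dist y b), 3, 1, []⟩

/-- The first intersection of the ray from `q` in the direction `θ` with the listed sides of the
world, as a parameter along the ray and the index of the side; `best` is the best
intersection found so far. -/
def boundaryHit (W : ConvexPolygon m) (q θ : Plane) :
    List (Fin m) → Option (ℝ × Fin m) → Timed (Option (ℝ × Fin m))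
  | [], best => pure best
  | i :: is, best => do
    let d ← op (inner ℝ (W.normal i) θ)
    if ← test (0 < d) then
      let b ← op (inner ℝ (W.normal i) q)
      let s ← op (W.offset i - b)
      let t ← op (s / d)
      match best with
      | none => boundaryHit W q θ is (some (t, i))
      | some (t₀, i₀) =>
        if ← test (t < t₀) then
          boundaryHit W q θ is (some (t, i))
        else
          boundaryHit W q θ is (some (t₀, i₀))
    else
      boundaryHit W q θ is best

/-- Among the sites equidistant with `p k` from the current point, the one nearest to `p k` is
kept: `nb` is the one kept so far and `j` is a new one. -/
def nearer (p : Fin n → Plane) (k j : Fin n) (nb : Option (Fin n)) : Timed (Option (Fin n)) := do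
  if ← test (j = k) then
    pure nb
  else
    match nb with
    | none => pure (some j)
    | some i =>
      let dj ← op (dist (p j) (p k))
      let di ← op (dist (p i) (p k))
      if ← test (dj < di) then
        pure (some j)
      else
        pure (some i)

/-- Goes over the listed sites. The current point of the ray is `y = p k + t • θ`, and `nb` is the
neighbor site found for it so far. If `y` is closer to the next site than to `p k`, then `y` is
moved to the intersection of the ray with the bisector of the two sites. -/
def shorten (p : Fin n → Plane) (k : Fin n) (θ : Plane) :
    List (Fin n) → ℝ → Option (Fin n) → Timed (ℝ × Option (Fin n))
  | [], t, nb => pure (t, nb)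
  | j :: js, t, nb => do
    let s ← op (t • θ)
    let y ← op (p k + s)
    match ← compareDist y (p j) (p k) with
    | .lt =>
      let N ← op (p j - p k)
      let a ← op (inner ℝ N N)
      let b ← op (inner ℝ N θ)
      let b₂ ← op (2 * b)
      let t' ← op (a / b₂)
      shorten p k θ js t' (some j)
    | .eq =>
      let nb' ← nearer p k j nb
      shorten p k θ js t nb'
    | .gt => shorten p k θ js t nb

/-- What is found by shooting a ray: the vector from `p k` to the endpoint, and the line on which
the endpoint is located. -/
structure Hit (n m : ℕ) where
  vec : Plane
  line : LineLabel n m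

/-- Shoots the ray from `p k` in the direction `θ`: starts at the boundary of the world and moves
towards `p k`. The line that is reported is the bisector with the neighbor site of the endpoint if
there is one, and a line of the boundary of the world otherwise. (The value `none` does not
occur for a bounded world.) -/
def shoot (W : ConvexPolygon m) (p : Fin n → Plane) (scan : Scan n) (k : Fin n) (θ : Plane) :
    Timed (Option (Hit n m)) := do
  match ← boundaryHit W (p k) θ (List.finRange m) none with
  | none => pure none
  | some (t₀, i) =>
    let (t, nb) ← shorten p k θ (scan k θ) t₀ none
    let T ← op (t • θ)
    match nb with
    | some j => pure (some ⟨T, .bisector j⟩)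
    | none => pure (some ⟨T, .boundary i⟩)

/-! ### Testing whether a point is in the cell -/

/-- Is `u` in the listed halfplanes of the world? -/
def insideWorld (W : ConvexPolygon m) (u : Plane) : List (Fin m) → Timed Bool
  | [] => pure true
  | i :: is => do
    let x ← op (inner ℝ (W.normal i) u)
    if ← test (x ≤ W.offset i) then
      insideWorld W u is
    else
      pure false

/-- Is `u` at least as close to `p k` as to each of the listed sites? -/
def closestSite (p : Fin n → Plane) (k : Fin n) (u : Plane) : List (Fin n) → Timed Bool
  | [] => pure true
  | j :: js => do
    match ← compareDist u (p j) (p k) with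
    | .lt => pure false
    | .eq => closestSite p k u js
    | .gt => closestSite p k u js

/-- Is `u` in the cell of `p k`? Here `θ` is the direction of the ray from `p k` through `u`. -/
def insideCell (W : ConvexPolygon m) (p : Fin n → Plane) (scan : Scan n) (k : Fin n)
    (u θ : Plane) : Timed Bool := do
  if ← insideWorld W u (List.finRange m) then
    closestSite p k u (scan k θ)
  else
    pure false

/-! ### The algorithm -/

/-- A stored vertex, with the two lines from which it was obtained. -/
structure Entry (n m : ℕ) where
  point : Plane
  line₁ : LineLabel n m
  line₂ : LineLabel n m

/-- A normal to the line named by a label. -/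
def lineNormal (W : ConvexPolygon m) (p : Fin n → Plane) (k : Fin n) :
    LineLabel n m → Timed Plane
  | .bisector j => op (p j - p k)
  | .boundary i => op (W.normal i)

/-- The determinant of two vectors of the plane (treated as one operation). -/
def det₂ (x y : Plane) : ℝ := x 0 * y 1 - x 1 * y 0

/-- The unit vector in the direction of `v`. -/
def unitVector (v : Plane) : Timed Plane := do
  let l ← op ‖v‖
  let i ← op l⁻¹
  op (i • v)

/-- Is `φ = α₁ • θ₁ + α₂ • θ₂` with nonnegative coefficients? -/
def insideCone (θ₁ θ₂ φ : Plane) : Timed Bool := do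
  let D ← op (det₂ θ₁ θ₂)
  let a ← op (det₂ φ θ₂)
  let b ← op (det₂ θ₁ φ)
  let α₁ ← op (a / D)
  let α₂ ← op (b / D)
  let c₁ ← test (0 ≤ α₁)
  let c₂ ← test (0 ≤ α₂)
  pure (c₁ && c₂)

/-- What happens to a subface: nothing more to do, a vertex is stored, or it is divided by a new
direction. -/
inductive Action (n m : ℕ)
  | done
  | store (e : Entry n m)
  | split (θ₃ : Plane)

/-- The treatment of the subface `{θ₁, θ₂}`. -/
def treat (W : ConvexPolygon m) (p : Fin n → Plane) (scan : Scan n) (k : Fin n)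
    (θ₁ θ₂ : Plane) : Timed (Action n m) := do
  match ← alongRay (shoot W p scan k θ₁), ← alongRay (shoot W p scan k θ₂) with
  | some ⟨T₁, L₁⟩, some ⟨T₂, L₂⟩ =>
    let N₁ ← lineNormal W p k L₁
    let N₂ ← lineNormal W p k L₂
    let B₁₁ ← op (inner ℝ N₁ T₁)
    let B₁₂ ← op (inner ℝ N₁ T₂)
    let B₂₁ ← op (inner ℝ N₂ T₁)
    let B₂₂ ← op (inner ℝ N₂ T₂)
    -- the right-hand side of the system `B λ = H` is `H = (B₁₁, B₂₂)`
    let x ← op (B₁₁ * B₂₂)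
    let y ← op (B₁₂ * B₂₁)
    let D ← op (x - y)
    if ← test (D = 0) then
      -- the parallel lines coincide iff the second endpoint is on the first line
      if ← test (B₁₂ = B₁₁) then
        pure .done
      else
        let w ← op (!₂[-(N₁ 1), N₁ 0] : Plane)
        let φ ← unitVector w
        if ← insideCone θ₁ θ₂ φ then
          pure (.split φ)
        else
          let ψ ← op (-φ)
          pure (.split ψ)
    else
      let z₁ ← op (B₁₂ * B₂₂)
      let z₂ ← op (B₂₁ * B₁₁)
      let d₁ ← op (x - z₁)
      let d₂ ← op (x - z₂)
      let l₁ ← op (d₁ / D)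
      let l₂ ← op (d₂ / D)
      let v₁ ← op (l₁ • T₁)
      let v₂ ← op (l₂ • T₂)
      let v ← op (v₁ + v₂)
      let u ← op (p k + v)
      let c₁ ← test (0 ≤ l₁)
      let c₂ ← test (0 ≤ l₂)
      if c₁ && c₂ then
        let w ← op (u - p k)
        let θ₃ ← unitVector w
        if ← alongRay (insideCell W p scan k u θ₃) then
          pure (.store ⟨u, L₁, L₂⟩)
        else
          pure (.split θ₃)
      else
        let w ← op (p k - u)
        let θ₃ ← unitVector w
        pure (.split θ₃)
  | _, _ => pure .done

/-- The queue of subfaces and the list of stored vertices. -/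
structure State (n m : ℕ) where
  queue : List (Plane × Plane)
  output : List (Entry n m)

/-- One pass of the main loop: the first subface is treated and removed from the queue. -/
def step (W : ConvexPolygon m) (p : Fin n → Plane) (scan : Scan n) (k : Fin n)
    (s : State n m) : Timed (State n m) :=
  match s.queue with
  | [] => pure s
  | (θ₁, θ₂) :: rest => do
    let a ← treat W p scan k θ₁ θ₂
    let q ← op rest -- removes the treated subface
    match a with
    | .done => op ⟨q, s.output⟩
    | .store e =>
      let out ← op (e :: s.output)
      op ⟨q, out⟩
    | .split θ₃ =>
      let q₁ ← op (q ++ [(θ₁, θ₃)])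
      let q₂ ← op (q₁ ++ [(θ₂, θ₃)])
      op ⟨q₂, s.output⟩

/-- Creates the three unit vectors and the three faces of the initial simplex. -/
def initial (n m : ℕ) : Timed (State n m) := do
  let ψ₁ ← op (!₂[√3 / 2, -(1 / 2)] : Plane)
  let ψ₂ ← op (!₂[0, 1] : Plane)
  let ψ₃ ← op (!₂[-(√3 / 2), -(1 / 2)] : Plane)
  let q₁ ← op [(ψ₁, ψ₂)]
  let q₂ ← op (q₁ ++ [(ψ₂, ψ₃)])
  let q₃ ← op (q₂ ++ [(ψ₁, ψ₃)])
  op ⟨q₃, []⟩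

/-- The computation of the cell of `p k`, after `N` passes of the main loop. -/
def run (W : ConvexPolygon m) (p : Fin n → Plane) (scan : Scan n) (k : Fin n) :
    ℕ → Timed (State n m)
  | 0 => initial n m
  | N + 1 => do
    let s ← run W p scan k N
    step W p scan k s

/-- The computation of the cell of `p k` stops, with the queue empty, and `r` is its result (with
its cost). -/
def HaltsWith (W : ConvexPolygon m) (p : Fin n → Plane) (scan : Scan n) (k : Fin n)
    (r : Timed (State n m)) : Prop :=
  ∃ N, run W p scan k N = r ∧ r.val.queue = []

/-- The time a processor needs for the cells in `A`: it computes them one after the other, and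
stores the result of each in an array. -/
def cellsTime (result : Fin n → Timed (State n m)) (A : Finset (Fin n)) : ℕ :=
  ∑ k ∈ A, ((result k).time + 1)

/-- The output includes the vertex `v`. -/
def VertexStored (output : List (Entry n m)) (v : Plane) : Prop :=
  ∃ E ∈ output, E.point = v

/-- The output includes the edge `[a, b]` of the cell of `p k`: the line of that edge is
stored, both with `a` and with `b`. -/
def EdgeStored (W : ConvexPolygon m) (p : Fin n → Plane) (k : Fin n)
    (output : List (Entry n m)) (a b : Plane) : Prop :=
  ∃ L : LineLabel n m, segment ℝ a b = cell W p k ∩ lineSet W p k L ∧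
    (∃ E ∈ output, E.point = a ∧ (E.line₁ = L ∨ E.line₂ = L)) ∧
    (∃ E ∈ output, E.point = b ∧ (E.line₁ = L ∨ E.line₂ = L))

end RayVoronoi

end

/-! ### Plane geometry in coordinates -/

namespace RayVoronoi

/-! In coordinates centred at `p k` the cell is a compact polyhedron `{x | ∀ L, ⟪N L, x⟫ ≤ c L}`
with finitely many labels `L`, all `c L > 0`, and two different labels never share a nondegenerate
piece of boundary (`isPolygonSystem`). The positivity makes every ray from the origin leave the cell
at exactly one point `T θ`. The tie rule of the ray shooting, to keep a nearest equidistant site,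
guarantees that the reported line carries a nondegenerate edge (`bisector_mem_edgeLabels`,
`exists_shoot_val`). Omitting sites is harmless, because an admissible list contains every site
whose bisector passes through the endpoint.

Termination. For a subface `{θ₁, θ₂}` let `between` be the set of edges that enter its open angle,
other than the two edges already found. In each splitting case of the algorithm the new ray lies
strictly inside the angle and ends on neither of the two known edges (`treat_parallel`,
`treat_crossing`). So it finds an edge of `between`, and each remaining edge goes to at most one of
the two halves: an edge on both sides of the new ray would be the edge which that ray reports. Hence
the cardinalities satisfy `b₁ + b₂ + 1 ≤ b` (`ncard_between_split`), and the sum of `2 * b + 1` over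
the queue drops with each treated subface. It starts at no more than `6 * e + 3`, which bounds the
number of passes.

Completeness. Each vertex not yet stored is assigned to a queued subface (`Pending`): the one whose
open angle contains it, or, if it lies on a bounding ray, one whose angle the edge reported by this
ray does not enter. A split passes this assignment on (`pending_split`). A subface that is discarded
has no pending vertex, and one that stores `u` can have none but `u`. A stored point lies on two
distinct edges and so is a vertex. Since at most two edges pass through a point (`not_three_faces`),
the two stored lines are all edge lines through it, which gives the edges.

Cost. A pass takes `O(m)` operations besides the comparisons and processes at most three rays; a
comparison pays for a bounded amount of work around it. Since `r ≥ 1` and `e ≥ 1`, the additive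
terms are absorbed and the time is `O(r * e)`.

Whole diagram. If no list repeats a site, then `r ≤ n`, and it remains to show that the edge counts
sum to `O(n)`. Instead of Euler's formula a generic direction `q` is used. Each cell has at most one
highest and one lowest point with respect to `q`. At a vertex interior to the world at least three
cells meet, and all but at most two of them have it as highest or lowest point: any other cell
contains a piece of the line through the vertex parallel to `q`, and on each side of the vertex only
one cell can do so. Summing gives at most `6 * n` incidences of cells with such vertices, while the
boundary of the world adds `O(m)` per cell. -/

theorem inner_coords (x y : Plane) : inner ℝ x y = x 0 * y 0 + x 1 * y 1 := by
  simp [PiLp.inner_apply, Fin.sum_univ_two, mul_comm]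

theorem plane_ext {x y : Plane} (h₀ : x 0 = y 0) (h₁ : x 1 = y 1) : x = y := by
  ext i
  fin_cases i
  · exact h₀
  · exact h₁

theorem det₂_add_right (x y z : Plane) : det₂ x (y + z) = det₂ x y + det₂ x z := by
  simp [det₂]; ring

theorem det₂_smul_right (x y : Plane) (a : ℝ) : det₂ x (a • y) = a * det₂ x y := by
  simp [det₂]; ring

theorem det₂_smul_left (x y : Plane) (a : ℝ) : det₂ (a • x) y = a * det₂ x y := by
  simp [det₂]; ring

theorem det₂_sub_right (x y z : Plane) : det₂ x (y - z) = det₂ x y - det₂ x z := by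
  simp [det₂]; ring

theorem det₂_self (x : Plane) : det₂ x x = 0 := by
  simp [det₂]; ring

theorem det₂_comm (x y : Plane) : det₂ x y = -det₂ y x := by
  simp [det₂]; ring

/-- The vector `x` turned by a right angle. -/
def rot (x : Plane) : Plane := !₂[-(x 1), x 0]

@[simp] theorem rot_zero_coord (x : Plane) : rot x 0 = -(x 1) := by simp [rot]

@[simp] theorem rot_one_coord (x : Plane) : rot x 1 = x 0 := by simp [rot]

theorem inner_rot_self (x : Plane) : inner ℝ x (rot x) = 0 := by
  simp [inner_coords]; ring

theorem coords_ne_zero {x : Plane} (h : x ≠ 0) : 0 < x 0 * x 0 + x 1 * x 1 := by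
  rw [← inner_coords]
  exact real_inner_self_pos.2 h

theorem rot_ne_zero {x : Plane} (h : x ≠ 0) : rot x ≠ 0 := by
  intro h'
  apply h
  have h₀ := congrArg (fun z : Plane => z 0) h'
  have h₁ := congrArg (fun z : Plane => z 1) h'
  simp at h₀ h₁
  exact plane_ext (by simpa using h₁) (by simpa using h₀)

/-- A vector is determined by its inner product and determinant with a nonzero vector. -/
theorem eq_of_inner_det₂ {z x y : Plane} (hz : z ≠ 0) (h : inner ℝ z x = inner ℝ z y)
    (h' : det₂ z x = det₂ z y) : x = y := by
  have hp := coords_ne_zero hz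
  rw [inner_coords, inner_coords] at h
  unfold det₂ at h'
  apply plane_ext
  · apply mul_left_cancel₀ hp.ne'
    linear_combination z 0 * h - z 1 * h'
  · apply mul_left_cancel₀ hp.ne'
    linear_combination z 1 * h + z 0 * h'

theorem exists_smul_of_det₂_eq_zero {z x : Plane} (hz : z ≠ 0) (h : det₂ z x = 0) :
    ∃ r : ℝ, x = r • z := by
  have hp := coords_ne_zero hz
  rw [← inner_coords] at hp
  refine ⟨inner ℝ z x / inner ℝ z z, eq_of_inner_det₂ hz ?_ ?_⟩
  · rw [inner_smul_right, div_mul_cancel₀ _ hp.ne']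
  · rw [h, det₂_smul_right, det₂_self, mul_zero]

/-- The product of two determinants is a determinant of inner products. -/
theorem det₂_mul_det₂ (a b x y : Plane) :
    det₂ a b * det₂ x y
      = inner ℝ a x * inner ℝ b y - inner ℝ a y * inner ℝ b x := by
  simp only [inner_coords, det₂]; ring

/-- Two linearly independent functionals separate points. -/
theorem eq_of_inner_inner {a b x y : Plane} (hab : det₂ a b ≠ 0)
    (h₁ : inner ℝ a x = inner ℝ a y) (h₂ : inner ℝ b x = inner ℝ b y) : x = y := by
  simp only [inner_coords] at h₁ h₂
  apply plane_ext
  · apply mul_left_cancel₀ hab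
    unfold det₂
    linear_combination b 1 * h₁ - a 1 * h₂
  · apply mul_left_cancel₀ hab
    unfold det₂
    linear_combination a 0 * h₂ - b 0 * h₁

/-- Of three distinct reals one is strictly between the others; here for points of a line. -/
theorem exists_mem_openSegment_of_line {z a b c : Plane} (hz : z ≠ 0)
    (hab : inner ℝ z a = inner ℝ z b) (hbc : inner ℝ z b = inner ℝ z c)
    (h₁ : a ≠ b) (h₂ : a ≠ c) (h₃ : b ≠ c) :
    a ∈ openSegment ℝ b c ∨ b ∈ openSegment ℝ a c ∨ c ∈ openSegment ℝ a b := by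
  have key : ∀ x y w : Plane, inner ℝ z x = inner ℝ z y → inner ℝ z y = inner ℝ z w →
      det₂ z x < det₂ z y → det₂ z y < det₂ z w → y ∈ openSegment ℝ x w := by
    intro x y w hxy hyw hlt hlt'
    have hd : 0 < det₂ z w - det₂ z x := by linarith
    refine ⟨(det₂ z w - det₂ z y) / (det₂ z w - det₂ z x),
      (det₂ z y - det₂ z x) / (det₂ z w - det₂ z x), div_pos (by linarith) hd,
      div_pos (by linarith) hd, by field_simp; ring, ?_⟩
    apply eq_of_inner_det₂ hz
    · rw [inner_add_right, inner_smul_right, inner_smul_right, hxy, ← hyw]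
      field_simp
      ring
    · rw [det₂_add_right, det₂_smul_right, det₂_smul_right]
      field_simp
      ring
  have ne : ∀ x y : Plane, inner ℝ z x = inner ℝ z y → x ≠ y → det₂ z x ≠ det₂ z y :=
    fun x y h h' h'' => h' (eq_of_inner_det₂ hz h h'')
  have n₁ := ne _ _ hab h₁
  have n₂ := ne _ _ (hab.trans hbc) h₂
  have n₃ := ne _ _ hbc h₃
  rcases lt_or_gt_of_ne n₁ with l₁ | l₁ <;> rcases lt_or_gt_of_ne n₂ with l₂ | l₂ <;>
    rcases lt_or_gt_of_ne n₃ with l₃ | l₃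
  · exact Or.inr (Or.inl (key _ _ _ hab hbc l₁ l₃))
  · exact Or.inr (Or.inr (key _ _ _ (hab.trans hbc) hbc.symm l₂ l₃))
  · linarith
  · exact Or.inl (openSegment_symm ℝ b c ▸
      key _ _ _ (hab.trans hbc).symm hab l₂ l₁)
  · exact Or.inl (key _ _ _ hab.symm (hab.trans hbc) l₁ l₂)
  · linarith
  · exact Or.inr (Or.inr (openSegment_symm ℝ a b ▸
      key _ _ _ hbc (hab.trans hbc).symm l₃ l₂))
  · exact Or.inr (Or.inl (openSegment_symm ℝ a c ▸ key _ _ _ hbc.symm hab.symm l₃ l₁))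

/-! ### Polyhedra given by finitely many inequalities -/

section Polyhedron

variable {ι : Type*} (N : ι → Plane) (c : ι → ℝ)

/-- The solutions of the inequalities `⟪N i, x⟫ ≤ c i`. -/
def polyhedron : Set Plane := {x | ∀ i, inner ℝ (N i) x ≤ c i}

/-- The solutions for which the inequality with index `i` is an equality. -/
def face (i : ι) : Set Plane := {x | x ∈ polyhedron N c ∧ inner ℝ (N i) x = c i}

/-- The system describes a compact set with the origin in its interior, and an edge is described by
only one of the inequalities. -/
structure IsPolygonSystem : Prop where
  pos : ∀ i, 0 < c i
  compact : IsCompact (polyhedron N c)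
  face_unique : ∀ i j, (face N c i ∩ face N c j).Nontrivial → i = j

variable {N c}

theorem face_subset (i : ι) : face N c i ⊆ polyhedron N c := fun _ h => h.1

theorem convex_polyhedron : Convex ℝ (polyhedron N c) := by
  intro x hx y hy a b ha hb hab i
  rw [inner_add_right, inner_smul_right, inner_smul_right]
  have h₁ := mul_le_mul_of_nonneg_left (hx i) ha
  have h₂ := mul_le_mul_of_nonneg_left (hy i) hb
  have h₃ : a * c i + b * c i = c i := by rw [← add_mul, hab, one_mul]
  linarith

theorem convex_face (i : ι) : Convex ℝ (face N c i) := by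
  intro x hx y hy a b ha hb hab
  refine ⟨convex_polyhedron hx.1 hy.1 ha hb hab, ?_⟩
  rw [inner_add_right, inner_smul_right, inner_smul_right, hx.2, hy.2, ← add_mul, hab, one_mul]

theorem openSegment_subset_face {i : ι} {x y z : Plane} (hx : x ∈ face N c i)
    (hy : y ∈ face N c i) (hz : z ∈ openSegment ℝ x y) : z ∈ face N c i :=
  (convex_face i).openSegment_subset hx hy hz

/-- An inequality that is tight at an inner point of a segment is tight at its ends. -/
theorem ends_mem_face {i : ι} {x y z : Plane} (hz : z ∈ openSegment ℝ x y)
    (hx : x ∈ polyhedron N c) (hy : y ∈ polyhedron N c) (hi : inner ℝ (N i) z = c i) :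
    x ∈ face N c i ∧ y ∈ face N c i := by
  obtain ⟨a, b, ha, hb, hab, rfl⟩ := hz
  rw [inner_add_right, inner_smul_right, inner_smul_right] at hi
  have h₁ := mul_nonneg ha.le (sub_nonneg.2 (hx i))
  have h₂ := mul_nonneg hb.le (sub_nonneg.2 (hy i))
  have h₃ : a * c i + b * c i = c i := by rw [← add_mul, hab, one_mul]
  have e₁ : a * (c i - inner ℝ (N i) x) = 0 := by linarith
  have e₂ : b * (c i - inner ℝ (N i) y) = 0 := by linarith
  refine ⟨⟨hx, ?_⟩, hy, ?_⟩
  · have := (mul_eq_zero.1 e₁).resolve_left ha.ne'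
    linarith
  · have := (mul_eq_zero.1 e₂).resolve_left hb.ne'
    linarith

theorem zero_mem_polyhedron (h : ∀ i, 0 < c i) : (0 : Plane) ∈ polyhedron N c := by
  intro i
  rw [inner_zero_right]
  exact (h i).le

theorem smul_mem_polyhedron (h : ∀ i, 0 < c i) {x : Plane} (hx : x ∈ polyhedron N c) {a : ℝ}
    (ha : 0 ≤ a) (ha' : a ≤ 1) : a • x ∈ polyhedron N c := by
  have := convex_polyhedron (zero_mem_polyhedron (N := N) h) hx (sub_nonneg.2 ha') ha (by ring)
  simpa using this

theorem isClosed_polyhedron : IsClosed (polyhedron N c) := by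
  have : polyhedron N c = ⋂ i, {x | inner ℝ (N i) x ≤ c i} := by
    ext x; simp [polyhedron]
  rw [this]
  exact isClosed_iInter fun i => isClosed_le (by fun_prop) continuous_const

theorem isClosed_face (i : ι) : IsClosed (face N c i) :=
  isClosed_polyhedron.inter (isClosed_eq (by fun_prop) continuous_const)

/-- If no tight inequality is violated by moving in the direction `d`, then one can move a little
in that direction. -/
theorem exists_add_smul_mem_polyhedron [Finite ι] {v d : Plane} (hv : v ∈ polyhedron N c)
    (h : ∀ i, inner ℝ (N i) v = c i → inner ℝ (N i) d ≤ 0) :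
    ∃ ε : ℝ, 0 < ε ∧ v + ε • d ∈ polyhedron N c := by
  have key : ∀ i, ∀ᶠ ε in nhdsWithin (0 : ℝ) (Set.Ioi 0), inner ℝ (N i) (v + ε • d) ≤ c i := by
    intro i
    rcases (hv i).lt_or_eq with hlt | heq
    · have hcont : Continuous fun ε : ℝ => inner ℝ (N i) (v + ε • d) := by fun_prop
      have : ∀ᶠ ε in nhds (0 : ℝ), inner ℝ (N i) (v + ε • d) < c i :=
        hcont.continuousAt.eventually_lt continuousAt_const (by simpa using hlt)
      exact (this.filter_mono nhdsWithin_le_nhds).mono fun _ h => h.le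
    · filter_upwards [self_mem_nhdsWithin] with ε hε
      rw [inner_add_right, inner_smul_right, heq]
      have := mul_nonpos_of_nonneg_of_nonpos (le_of_lt hε) (h i heq)
      linarith
  have h₂ : ∀ᶠ ε in nhdsWithin (0 : ℝ) (Set.Ioi 0), ∀ i, inner ℝ (N i) (v + ε • d) ≤ c i :=
    Filter.eventually_all.2 key
  obtain ⟨ε, hε, hε'⟩ := (h₂.and self_mem_nhdsWithin).exists
  exact ⟨ε, hε', hε⟩

/-- At an extreme point two different inequalities are tight. -/
theorem exists_tight_pair [Finite ι] {v : Plane}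
    (hv : v ∈ (polyhedron N c).extremePoints ℝ) :
    ∃ i j, i ≠ j ∧ v ∈ face N c i ∧ v ∈ face N c j := by
  by_contra hcon
  -- With at most one tight inequality some direction keeps all tight inequalities tight. Small
  -- moves along `d` and `-d` then exhibit `v` as an inner point of a segment.
  have hd : ∃ d : Plane, d ≠ 0 ∧ ∀ i, inner ℝ (N i) v = c i → inner ℝ (N i) d = 0 := by
    by_cases hex : ∃ i, inner ℝ (N i) v = c i ∧ N i ≠ 0
    · obtain ⟨i, hi, hi'⟩ := hex
      refine ⟨rot (N i), rot_ne_zero hi', fun j hj => ?_⟩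
      by_cases hij : i = j
      · subst hij; exact inner_rot_self _
      · exact absurd ⟨i, j, hij, ⟨hv.1, hi⟩, ⟨hv.1, hj⟩⟩ hcon
    · push Not at hex
      refine ⟨!₂[1, 0], fun h => ?_, fun i hi => ?_⟩
      · have := congrArg (fun z : Plane => z 0) h
        simp at this
      · rw [hex i hi, inner_zero_left]
  obtain ⟨d, hd, hd'⟩ := hd
  obtain ⟨ε, hε, h₁⟩ := exists_add_smul_mem_polyhedron hv.1 fun i hi => (hd' i hi).le
  obtain ⟨δ, hδ, h₂⟩ := exists_add_smul_mem_polyhedron (d := -d) hv.1 fun i hi => by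
    rw [inner_neg_right, hd' i hi, neg_zero]
  have hmem : v ∈ openSegment ℝ (v + ε • d) (v + δ • -d) := by
    have hs : 0 < ε + δ := by linarith
    refine ⟨δ / (ε + δ), ε / (ε + δ), div_pos hδ hs, div_pos hε hs, by field_simp; ring, ?_⟩
    apply plane_ext
    · simp; field_simp; ring
    · simp; field_simp; ring
  have := hv.2 h₁ h₂ hmem
  rw [add_eq_left, smul_eq_zero] at this
  exact this.elim hε.ne' hd

/-- A direction does not recede to infinity in a compact polyhedron. -/
theorem exists_inner_pos_of_isCompact (pos : ∀ i, 0 < c i) (compact : IsCompact (polyhedron N c))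
    {θ : Plane} (hθ : θ ≠ 0) : ∃ i, 0 < inner ℝ (N i) θ := by
  by_contra! hcon
  obtain ⟨M, hM⟩ := compact.isBounded.exists_norm_le
  have hmem : ((|M| + 1) / ‖θ‖) • θ ∈ polyhedron N c := by
    intro i
    rw [inner_smul_right]
    exact (mul_nonpos_of_nonneg_of_nonpos (by positivity) (hcon i)).trans (pos i).le
  have := hM _ hmem
  rw [norm_smul, Real.norm_eq_abs, abs_of_nonneg (by positivity),
    div_mul_cancel₀ _ (norm_ne_zero_iff.2 hθ)] at this
  linarith [le_abs_self M]

/-! ### Boundary structure of a compact polygon around the origin -/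

namespace IsPolygonSystem

variable (S : IsPolygonSystem N c)
include S

theorem exists_inner_pos {θ : Plane} (hθ : θ ≠ 0) : ∃ i, 0 < inner ℝ (N i) θ :=
  exists_inner_pos_of_isCompact S.pos S.compact hθ

theorem normal_ne_zero {i : ι} {v : Plane} (h : v ∈ face N c i) : N i ≠ 0 := by
  intro h'
  have := h.2
  rw [h', inner_zero_left] at this
  exact (S.pos i).ne this

theorem ne_zero_of_mem_face {i : ι} {v : Plane} (h : v ∈ face N c i) : v ≠ 0 := by
  rintro rfl
  have := h.2
  rw [inner_zero_right] at this
  exact (S.pos i).ne this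

/-- The ratio test: among the inequalities with `⟪N i, θ⟫ > 0`, one with the smallest `c i / ⟪N i,
θ⟫` becomes tight first along the ray. -/
theorem exists_smul_mem_face [Finite ι] {θ : Plane} (hθ : θ ≠ 0) :
    ∃ t : ℝ, 0 < t ∧ ∃ i, t • θ ∈ face N c i := by
  classical
  have := Fintype.ofFinite ι
  have hne : (Finset.univ.filter fun i => 0 < inner ℝ (N i) θ).Nonempty := by
    obtain ⟨i, hi⟩ := S.exists_inner_pos hθ
    exact ⟨i, by simpa using hi⟩
  obtain ⟨i, hi, hmin⟩ := Finset.exists_min_image _ (fun i => c i / inner ℝ (N i) θ) hne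
  simp only [Finset.mem_filter, Finset.mem_univ, true_and] at hi hmin
  have ht : 0 < c i / inner ℝ (N i) θ := div_pos (S.pos i) hi
  refine ⟨c i / inner ℝ (N i) θ, ht, i, fun j => ?_, ?_⟩
  · rw [inner_smul_right]
    by_cases hj : 0 < inner ℝ (N j) θ
    · exact (le_div_iff₀ hj).1 (hmin j hj)
    · exact (mul_nonpos_of_nonneg_of_nonpos ht.le (not_lt.1 hj)).trans (S.pos j).le
  · rw [inner_smul_right, div_mul_cancel₀ _ hi.ne']

theorem le_of_mem_face {i : ι} {θ : Plane} {s t : ℝ} (hi : t • θ ∈ face N c i) (ht : 0 < t)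
    (hs : s • θ ∈ polyhedron N c) : s ≤ t := by
  have h₁ := hi.2
  have h₂ := hs i
  rw [inner_smul_right] at h₁ h₂
  have hp : 0 < inner ℝ (N i) θ := by
    by_contra hcon
    have := mul_nonpos_of_nonneg_of_nonpos ht.le (not_lt.1 hcon)
    linarith [S.pos i]
  rw [← h₁] at h₂
  exact le_of_mul_le_mul_right h₂ hp

/-- A ray meets the boundary only once. -/
theorem eq_of_mem_face {i j : ι} {x y : Plane} {s : ℝ} (hx : x ∈ face N c i) (hy : y ∈ face N c j)
    (hs : 0 < s) (h : y = s • x) : y = x := by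
  have h₁ : s ≤ 1 := S.le_of_mem_face (i := i) (θ := x) (by simpa using hx) one_pos (h ▸ hy.1)
  have h₂ : 1 ≤ s := S.le_of_mem_face (i := j) (θ := x) (h ▸ hy) hs (by simpa using hx.1)
  rw [h, le_antisymm h₁ h₂, one_smul]

/-- At most two edges pass through a point. -/
theorem not_three_faces {i j l : ι} {v : Plane} (hij : i ≠ j) (hil : i ≠ l) (hjl : j ≠ l)
    (hi : v ∈ face N c i) (hj : v ∈ face N c j) (hl : v ∈ face N c l)
    (ni : (face N c i).Nontrivial) (nj : (face N c j).Nontrivial)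
    (nl : (face N c l).Nontrivial) : False := by
  -- Polarity: the scaled normals `(c a)⁻¹ • N a` of the inequalities tight at `v` are points of the
  -- line `⟪v, ·⟫ = 1`. Three of them are distinct, so one lies strictly between the others.
  have unit : ∀ {a}, v ∈ face N c a → inner ℝ v ((c a)⁻¹ • N a) = 1 := by
    intro a ha
    rw [inner_smul_right, real_inner_comm, ha.2, inv_mul_cancel₀ (S.pos a).ne']
  have iff_tight : ∀ a (x : Plane), inner ℝ ((c a)⁻¹ • N a) x = 1 ↔ inner ℝ (N a) x = c a := by
    intro a x
    rw [inner_smul_left]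
    simp only [conj_trivial]
    rw [inv_mul_eq_one₀ (S.pos a).ne', eq_comm]
  have le : ∀ a, ∀ x ∈ polyhedron N c, inner ℝ ((c a)⁻¹ • N a) x ≤ 1 := by
    intro a x hx
    rw [inner_smul_left]
    simp only [conj_trivial]
    rw [inv_mul_le_one₀ (S.pos a)]
    exact hx a
  have ne : ∀ {a b}, v ∈ face N c a → a ≠ b → (face N c a).Nontrivial →
      (c a)⁻¹ • N a ≠ (c b)⁻¹ • N b := by
    intro a b ha hab na heq
    obtain ⟨x, hx, y, hy, hxy⟩ := na
    refine hab (S.face_unique a b ⟨x, ⟨hx, hx.1, ?_⟩, y, ⟨hy, hy.1, ?_⟩, hxy⟩)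
    · rw [← iff_tight, ← heq, iff_tight, hx.2]
    · rw [← iff_tight, ← heq, iff_tight, hy.2]
  -- On the face of `b` the functional of `b` attains its bound `1`. As a proper convex combination
  -- of two functionals bounded by `1`, it forces both to equal `1` there. So the whole face of `b`
  -- lies in that of `a`.
  have mid : ∀ {a b d}, v ∈ face N c b → b ≠ a → (face N c b).Nontrivial →
      (c b)⁻¹ • N b ∈ openSegment ℝ ((c a)⁻¹ • N a) ((c d)⁻¹ • N d) → False := by
    intro a b d hb hba nb hmem
    obtain ⟨x, hx, y, hy, hxy⟩ := nb
    have tight : ∀ z ∈ face N c b, z ∈ face N c a := by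
      intro z hz
      have hzb := (iff_tight b z).2 hz.2
      obtain ⟨s, t, hs, ht, hst, heq⟩ := hmem
      rw [← heq, inner_add_left, real_inner_smul_left _ _ s, real_inner_smul_left _ _ t] at hzb
      have h₁ := mul_le_mul_of_nonneg_left (le a z hz.1) hs.le
      have h₂ := mul_le_mul_of_nonneg_left (le d z hz.1) ht.le
      have h₃ : s * inner ℝ ((c a)⁻¹ • N a) z = s * 1 := by linarith
      exact ⟨hz.1, (iff_tight a z).1 (mul_left_cancel₀ hs.ne' h₃)⟩
    exact hba (S.face_unique b a ⟨x, ⟨hx, tight x hx⟩, y, ⟨hy, tight y hy⟩, hxy⟩)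
  rcases exists_mem_openSegment_of_line (S.ne_zero_of_mem_face hi)
    ((unit hi).trans (unit hj).symm) ((unit hj).trans (unit hl).symm) (ne hi hij ni)
    (ne hi hil ni) (ne hj hjl nj) with h | h | h
  · exact mid hi hij ni h
  · exact mid hj hij.symm nj h
  · exact mid hl hil.symm nl h

/-- A face with more than one point is a segment. -/
theorem exists_face_eq_segment {i : ι} (hi : (face N c i).Nontrivial) :
    ∃ a b, a ≠ b ∧ face N c i = segment ℝ a b := by
  have hcomp : IsCompact (face N c i) := S.compact.of_isClosed_subset (isClosed_face i)
    (face_subset i)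
  -- `det₂ (N i)` is a coordinate along the line of the face; its minimum and maximum give the ends
  -- of the segment.
  have hcont : ContinuousOn (fun x : Plane => det₂ (N i) x) (face N c i) := by
    unfold det₂; fun_prop
  obtain ⟨a, ha, hmin⟩ := hcomp.exists_isMinOn hi.nonempty hcont
  obtain ⟨b, hb, hmax⟩ := hcomp.exists_isMaxOn hi.nonempty hcont
  have hN := S.normal_ne_zero ha
  have hne : a ≠ b := by
    rintro rfl
    obtain ⟨x, hx, y, hy, hxy⟩ := hi
    refine hxy (eq_of_inner_det₂ hN (hx.2.trans hy.2.symm) ?_)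
    linarith [isMinOn_iff.1 hmin x hx, isMinOn_iff.1 hmin y hy, isMaxOn_iff.1 hmax x hx,
      isMaxOn_iff.1 hmax y hy]
  refine ⟨a, b, hne, Set.Subset.antisymm (fun x hx => ?_) ((convex_face i).segment_subset ha hb)⟩
  by_cases hxa : x = a
  · rw [hxa]; exact left_mem_segment ℝ a b
  by_cases hxb : x = b
  · rw [hxb]; exact right_mem_segment ℝ a b
  have strict : ∀ y z : Plane, y ∈ face N c i → z ∈ face N c i → y ≠ z →
      det₂ (N i) y ≠ det₂ (N i) z :=
    fun y z hy hz hyz h => hyz (eq_of_inner_det₂ hN (hy.2.trans hz.2.symm) h)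
  have l₁ : det₂ (N i) a < det₂ (N i) x := lt_of_le_of_ne (hmin hx) (strict _ _ ha hx (Ne.symm hxa))
  have l₂ : det₂ (N i) x < det₂ (N i) b := lt_of_le_of_ne (hmax hx) (strict _ _ hx hb hxb)
  have hdet : ∀ y z w : Plane, w ∈ openSegment ℝ y z →
      (det₂ (N i) y < det₂ (N i) w ∧ det₂ (N i) w < det₂ (N i) z) ∨
      (det₂ (N i) z ≤ det₂ (N i) w ∧ det₂ (N i) w ≤ det₂ (N i) y) := by
    rintro y z w ⟨s, t, hs, ht, hst, rfl⟩
    rw [det₂_add_right, det₂_smul_right, det₂_smul_right]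
    obtain rfl : s = 1 - t := by linarith
    rcases lt_or_ge (det₂ (N i) y) (det₂ (N i) z) with h | h
    · left
      constructor <;> nlinarith
    · right
      constructor <;> nlinarith
  rcases exists_mem_openSegment_of_line hN (ha.2.trans hx.2.symm) (hx.2.trans hb.2.symm)
    (Ne.symm hxa) hne hxb with h | h | h
  · rcases hdet _ _ _ h with h' | h' <;> linarith
  · exact openSegment_subset_segment ℝ a b h
  · rcases hdet _ _ _ h with h' | h' <;> linarith

/-- If the point were inside a segment of the polyhedron, both inequalities would be tight along
that segment, against `face_unique`. -/
theorem mem_extremePoints_of_two_faces {i j : ι} (hij : i ≠ j) {v : Plane} (hi : v ∈ face N c i)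
    (hj : v ∈ face N c j) : v ∈ (polyhedron N c).extremePoints ℝ := by
  refine ⟨hi.1, fun x hx y hy hv => ?_⟩
  by_contra hne
  have h₁ := ends_mem_face hv hx hy hi.2
  have h₂ := ends_mem_face hv hx hy hj.2
  exact hij (S.face_unique i j ⟨x, ⟨h₁.1, h₂.1⟩, v, ⟨hi, hj⟩, hne⟩)

end IsPolygonSystem

end Polyhedron

end RayVoronoi

namespace RayVoronoi

/-! ### Subfaces -/

section Subfaces

/-- The points inside the angle spanned by two vectors. -/
def openCone (x y : Plane) : Set Plane :=
  {z | ∃ a b : ℝ, 0 < a ∧ 0 < b ∧ z = a • x + b • y}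

theorem openCone_comm (x y : Plane) : openCone x y = openCone y x := by
  have key : ∀ x y, openCone x y ⊆ openCone y x := by
    rintro x y _ ⟨a, b, ha, hb, rfl⟩
    exact ⟨b, a, hb, ha, add_comm _ _⟩
  exact Set.Subset.antisymm (key x y) (key y x)

theorem openCone_subset_left {x y z : Plane} (hz : z ∈ openCone x y) :
    openCone x z ⊆ openCone x y := by
  obtain ⟨α, β, hα, hβ, rfl⟩ := hz
  rintro _ ⟨a, b, ha, hb, rfl⟩
  exact ⟨a + b * α, b * β, by positivity, by positivity, by module⟩

theorem openCone_subset_right {x y z : Plane} (hz : z ∈ openCone x y) :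
    openCone y z ⊆ openCone x y := by
  rw [openCone_comm x y] at hz ⊢
  exact openCone_subset_left hz

theorem det₂_pos_of_mem_openCone {x y z : Plane} (h : z ∈ openCone x y) :
    ∃ b : ℝ, 0 < b ∧ det₂ x z = b * det₂ x y := by
  obtain ⟨a, b, -, hb, rfl⟩ := h
  exact ⟨b, hb, by rw [det₂_add_right, det₂_smul_right, det₂_smul_right, det₂_self]; ring⟩

/-- A vector inside an angle divides it into two angles on different sides of it. -/
theorem openCone_trichotomy {x y z v : Plane} (hz : z ∈ openCone x y) (hv : v ∈ openCone x y) :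
    v ∈ openCone x z ∨ v ∈ openCone y z ∨ ∃ r : ℝ, 0 < r ∧ v = r • z := by
  obtain ⟨α, β, hα, hβ, rfl⟩ := hz
  obtain ⟨a, b, ha, hb, rfl⟩ := hv
  have key : ∀ (x y : Plane) (α β a b : ℝ), 0 < α → 0 < β → 0 < a → 0 < b → b * α < a * β →
      a • x + b • y ∈ openCone x (α • x + β • y) := by
    intro x y α β a b hα hβ ha hb h
    refine ⟨a - b / β * α, b / β, ?_, by positivity, ?_⟩
    · rw [sub_pos, div_mul_eq_mul_div, div_lt_iff₀ hβ]
      exact h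
    · rw [smul_add, smul_smul, smul_smul, div_mul_cancel₀ _ hβ.ne']
      module
  rcases lt_trichotomy (b * α) (a * β) with h | h | h
  · exact Or.inl (key x y α β a b hα hβ ha hb h)
  · refine Or.inr (Or.inr ⟨b / β, by positivity, ?_⟩)
    rw [smul_add, smul_smul, smul_smul, div_mul_cancel₀ _ hβ.ne', div_mul_eq_mul_div, h,
      mul_div_cancel_right₀ _ hβ.ne']
  · refine Or.inr (Or.inl ?_)
    rw [add_comm (a • x), add_comm (α • x)]
    exact key y x β α b a hβ hα hb ha h

/-- Points inside the two parts of a divided angle are separated by the dividing line. -/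
theorem det₂_mul_det₂_neg {θ₁ θ₂ θ₃ x y : Plane} (hdet : det₂ θ₁ θ₂ ≠ 0)
    (h : θ₃ ∈ openCone θ₁ θ₂) (hx : x ∈ openCone θ₁ θ₃) (hy : y ∈ openCone θ₂ θ₃) :
    det₂ θ₃ x * det₂ θ₃ y < 0 := by
  obtain ⟨α, β, hα, hβ, h⟩ := h
  obtain ⟨a, b, ha, hb, rfl⟩ := hx
  obtain ⟨a', b', ha', hb', rfl⟩ := hy
  have e₁ : det₂ θ₃ (a • θ₁ + b • θ₃) = -(a * β) * det₂ θ₁ θ₂ := by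
    rw [det₂_add_right, det₂_smul_right, det₂_smul_right, det₂_self, det₂_comm θ₃ θ₁, h,
      det₂_add_right, det₂_smul_right, det₂_smul_right, det₂_self]
    ring
  have e₂ : det₂ θ₃ (a' • θ₂ + b' • θ₃) = (a' * α) * det₂ θ₁ θ₂ := by
    rw [det₂_add_right, det₂_smul_right, det₂_smul_right, det₂_self, det₂_comm θ₃ θ₂, h,
      det₂_add_right, det₂_smul_right, det₂_smul_right, det₂_self, det₂_comm θ₂ θ₁]
    ring
  rw [e₁, e₂]
  have : 0 < det₂ θ₁ θ₂ * det₂ θ₁ θ₂ := mul_self_pos.2 hdet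
  have h₄ : 0 < a * β * (a' * α) * (det₂ θ₁ θ₂ * det₂ θ₁ θ₂) := by positivity
  linarith

/-! ### Ray shooting, splits and pending vertices -/

variable {ι : Type*} {N : ι → Plane} {c : ι → ℝ} {T : Plane → Plane} {l : Plane → ι}

/-- `T θ` is the endpoint of the ray in the direction `θ`, and `l θ` is the index of an edge on
which it is located. -/
structure IsRayShooting (N : ι → Plane) (c : ι → ℝ) (T : Plane → Plane) (l : Plane → ι) : Prop
    extends IsPolygonSystem N c where
  ray : ∀ θ, ‖θ‖ = 1 → ∃ t : ℝ, 0 < t ∧ T θ = t • θ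
  mem : ∀ θ, ‖θ‖ = 1 → T θ ∈ face N c (l θ)
  nontrivial : ∀ θ, ‖θ‖ = 1 → (face N c (l θ)).Nontrivial

/-- The edges met inside the angle of `θ₁` and `θ₂`, apart from the two that were found at its
sides. -/
def between (N : ι → Plane) (c : ι → ℝ) (l : Plane → ι) (θ₁ θ₂ : Plane) : Set ι :=
  {i | (face N c i).Nontrivial ∧ i ≠ l θ₁ ∧ i ≠ l θ₂ ∧ (face N c i ∩ openCone θ₁ θ₂).Nonempty}

/-- The direction `θ₃` divides the subface of `θ₁` and `θ₂`, and its endpoint is on neither of the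
two edges found before. -/
structure IsSplit (N : ι → Plane) (c : ι → ℝ) (T : Plane → Plane) (l : Plane → ι)
    (θ₁ θ₂ θ₃ : Plane) : Prop where
  unit : ‖θ₃‖ = 1
  mem : θ₃ ∈ openCone θ₁ θ₂
  left : T θ₃ ∉ face N c (l θ₁)
  right : T θ₃ ∉ face N c (l θ₂)

/-- A vertex that is found when the subface of `θ₁` and `θ₂` is processed. -/
def Pending (N : ι → Plane) (c : ι → ℝ) (T : Plane → Plane) (l : Plane → ι)
    (θ₁ θ₂ v : Plane) : Prop :=
  v ∈ openCone θ₁ θ₂ ∨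
  (v = T θ₁ ∧ face N c (l θ₁) ∩ openCone θ₁ θ₂ = ∅) ∨
  (v = T θ₂ ∧ face N c (l θ₂) ∩ openCone θ₁ θ₂ = ∅)

theorem IsSplit.symm {θ₁ θ₂ θ₃ : Plane} (h : IsSplit N c T l θ₁ θ₂ θ₃) :
    IsSplit N c T l θ₂ θ₁ θ₃ :=
  ⟨h.unit, openCone_comm θ₁ θ₂ ▸ h.mem, h.right, h.left⟩

theorem between_comm (θ₁ θ₂ : Plane) : between N c l θ₁ θ₂ = between N c l θ₂ θ₁ := by
  unfold between
  rw [openCone_comm θ₁ θ₂]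
  ext i
  exact ⟨fun ⟨h₁, h₂, h₃, h₄⟩ => ⟨h₁, h₃, h₂, h₄⟩, fun ⟨h₁, h₂, h₃, h₄⟩ => ⟨h₁, h₃, h₂, h₄⟩⟩

theorem pending_comm {θ₁ θ₂ v : Plane} :
    Pending N c T l θ₁ θ₂ v ↔ Pending N c T l θ₂ θ₁ v := by
  unfold Pending
  rw [openCone_comm θ₁ θ₂]
  tauto

namespace IsRayShooting

variable (S : IsRayShooting N c T l)
include S

theorem eq_of_mem_face_ray {θ x : Plane} {i : ι} {r : ℝ} (hθ : ‖θ‖ = 1) (hx : x ∈ face N c i)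
    (hr : 0 < r) (h : x = r • θ) : x = T θ := by
  obtain ⟨t, ht, hT⟩ := S.ray θ hθ
  refine S.eq_of_mem_face (S.mem θ hθ) hx (div_pos hr ht) ?_
  rw [hT, smul_smul, div_mul_cancel₀ _ ht.ne', h]

/-- If an edge has points on both sides of a ray that splits an angle, the ray ends on that
edge. -/
theorem crossing {θ₁ θ₂ θ₃ x y : Plane} {i : ι} (h₃ : ‖θ₃‖ = 1) (hθ : θ₃ ∈ openCone θ₁ θ₂)
    (hx : x ∈ face N c i) (hy : y ∈ face N c i)
    (hx' : ∃ a b : ℝ, 0 < a ∧ 0 ≤ b ∧ x = a • θ₁ + b • θ₃)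
    (hy' : ∃ a b : ℝ, 0 < a ∧ 0 ≤ b ∧ y = a • θ₂ + b • θ₃) :
    T θ₃ ∈ openSegment ℝ x y := by
  obtain ⟨α, β, hα, hβ, hαβ⟩ := hθ
  obtain ⟨a, b, ha, hb, hx'⟩ := hx'
  obtain ⟨a', b', ha', hb', hy'⟩ := hy'
  -- The weights `α / a` and `β / a'` turn the `θ₁` and `θ₂` parts of `x` and `y` into `α • θ₁ + β •
  -- θ₂ = θ₃`, so the combination is a positive multiple of `θ₃`.
  have hs : 0 < α / a + β / a' := by positivity
  have hmem : (α / a / (α / a + β / a')) • x + (β / a' / (α / a + β / a')) • y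
      ∈ openSegment ℝ x y :=
    ⟨_, _, by positivity, by positivity, by field_simp, rfl⟩
  have heq : (α / a / (α / a + β / a')) • x + (β / a' / (α / a + β / a')) • y
      = (1 / (α / a + β / a') + α / a / (α / a + β / a') * b
          + β / a' / (α / a + β / a') * b') • θ₃ := by
    have e₃ : (1 / (α / a + β / a')) • θ₃
        = (1 / (α / a + β / a') * α) • θ₁ + (1 / (α / a + β / a') * β) • θ₂ := by
      rw [hαβ, smul_add, smul_smul, smul_smul]
    rw [add_smul, add_smul, e₃, hx', hy']
    have e₁ : α / a / (α / a + β / a') * a = 1 / (α / a + β / a') * α := by field_simp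
    have e₂ : β / a' / (α / a + β / a') * a' = 1 / (α / a + β / a') * β := by field_simp
    rw [smul_add, smul_add, smul_smul, smul_smul, smul_smul, smul_smul, e₁, e₂]
    abel
  rw [← S.eq_of_mem_face_ray h₃ (openSegment_subset_face hx hy hmem) (by positivity) heq]
  exact hmem

/-- The same for an edge that contains the endpoint of the ray, where no angle is needed. -/
theorem crossing_of_mem {θ x y : Plane} {i : ι} (hθ : ‖θ‖ = 1) (hT : T θ ∈ face N c i)
    (hx : x ∈ face N c i) (hy : y ∈ face N c i) (hdx : det₂ θ x < 0) (hdy : 0 < det₂ θ y) :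
    T θ ∈ openSegment ℝ x y := by
  have hθ₀ : θ ≠ 0 := by rintro rfl; simp at hθ
  have hd : 0 < det₂ θ y - det₂ θ x := by linarith
  have hmem : (det₂ θ y / (det₂ θ y - det₂ θ x)) • x + (-det₂ θ x / (det₂ θ y - det₂ θ x)) • y
      ∈ openSegment ℝ x y :=
    ⟨_, _, div_pos hdy hd, div_pos (by linarith) hd, by field_simp; ring, rfl⟩
  have hf := openSegment_subset_face hx hy hmem
  have hdet : det₂ θ ((det₂ θ y / (det₂ θ y - det₂ θ x)) • x
      + (-det₂ θ x / (det₂ θ y - det₂ θ x)) • y) = 0 := by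
    rw [det₂_add_right, det₂_smul_right, det₂_smul_right]
    field_simp
    ring
  obtain ⟨r, hr⟩ := exists_smul_of_det₂_eq_zero hθ₀ hdet
  obtain ⟨t, ht, hTt⟩ := S.ray θ hθ
  -- The segment could meet the line of `θ` behind the origin; this is excluded because `⟪N i, ·⟫`
  -- equals `c i > 0` both there and at `T θ`.
  have hr₀ : 0 < r := by
    have h₁ := hT.2
    have h₂ := hf.2
    rw [hr, inner_smul_right] at h₂
    rw [hTt, inner_smul_right] at h₁
    have hc := S.pos i
    have hp : 0 < inner ℝ (N i) θ := pos_of_mul_pos_right (h₁ ▸ hc) ht.le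
    exact pos_of_mul_pos_left (h₂ ▸ hc) hp.le
  rw [← S.eq_of_mem_face_ray hθ hf hr₀ hr]
  exact hmem

/-- A ray that ends strictly inside an edge leaves no choice of label: the reported inequality is
tight at `T θ`, hence on all of `[x, y]`. -/
theorem label_eq_of_mem_openSegment {θ x y : Plane} {i : ι} (hθ : ‖θ‖ = 1)
    (hx : x ∈ face N c i) (hy : y ∈ face N c i) (hxy : x ≠ y) (hT : T θ ∈ openSegment ℝ x y) :
    l θ = i := by
  have h := ends_mem_face hT hx.1 hy.1 (S.mem θ hθ).2
  exact S.face_unique _ _ ⟨x, ⟨h.1, hx⟩, y, ⟨h.2, hy⟩, hxy⟩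

theorem endpoint_mem_openCone {θ₁ θ₂ θ : Plane} (hθ : ‖θ‖ = 1) (h : θ ∈ openCone θ₁ θ₂) :
    T θ ∈ openCone θ₁ θ₂ := by
  obtain ⟨t, ht, hT⟩ := S.ray θ hθ
  obtain ⟨a, b, ha, hb, hab⟩ := h
  exact ⟨t * a, t * b, by positivity, by positivity, by rw [hT, hab]; module⟩

/-- The midpoint of the endpoints is inside the angle. -/
theorem midpoint_mem_openCone {θ₁ θ₂ : Plane} (h₁ : ‖θ₁‖ = 1) (h₂ : ‖θ₂‖ = 1) :
    (1 / 2 : ℝ) • T θ₁ + (1 / 2 : ℝ) • T θ₂ ∈ openCone θ₁ θ₂ := by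
  obtain ⟨s, hs, e₁⟩ := S.ray θ₁ h₁
  obtain ⟨t, ht, e₂⟩ := S.ray θ₂ h₂
  exact ⟨1 / 2 * s, 1 / 2 * t, by positivity, by positivity, by rw [e₁, e₂]; module⟩

theorem face_inter_openCone_nonempty {θ₁ θ₂ : Plane} {i : ι} (h₁ : ‖θ₁‖ = 1) (h₂ : ‖θ₂‖ = 1)
    (hT₁ : T θ₁ ∈ face N c i) (hT₂ : T θ₂ ∈ face N c i) :
    (face N c i ∩ openCone θ₁ θ₂).Nonempty :=
  ⟨_, convex_face i hT₁ hT₂ (by norm_num) (by norm_num) (by norm_num),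
    S.midpoint_mem_openCone h₁ h₂⟩

/-- The one nontrivial point is that the edge of `θ₂` cannot enter the half next to `θ₁`: it would
cross the ray of `θ₃`, which then ends on it, contrary to `IsSplit.right`. -/
theorem between_subset_of_split {θ₁ θ₂ θ₃ : Plane} (h₂ : ‖θ₂‖ = 1)
    (h : IsSplit N c T l θ₁ θ₂ θ₃) :
    between N c l θ₁ θ₃ ⊆ between N c l θ₁ θ₂ \ {l θ₃} := by
  rintro i ⟨hi, hi₁, hi₃, x, hx, hx'⟩
  refine ⟨⟨hi, hi₁, ?_, x, hx, openCone_subset_left h.mem hx'⟩, hi₃⟩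
  rintro rfl
  obtain ⟨t, ht, hT⟩ := S.ray θ₂ h₂
  obtain ⟨a, b, ha, hb, hab⟩ := hx'
  have := S.crossing h.unit h.mem hx (S.mem θ₂ h₂) ⟨a, b, ha, hb.le, hab⟩
    ⟨t, 0, ht, le_rfl, by rw [hT]; simp⟩
  exact h.right (openSegment_subset_face hx (S.mem θ₂ h₂) this)

theorem label_mem_between {θ₁ θ₂ θ₃ : Plane} (h : IsSplit N c T l θ₁ θ₂ θ₃) :
    l θ₃ ∈ between N c l θ₁ θ₂ := by
  have hm := S.mem θ₃ h.unit
  exact ⟨S.nontrivial θ₃ h.unit, fun h' => h.left (h' ▸ hm), fun h' => h.right (h' ▸ hm),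
    _, hm, S.endpoint_mem_openCone h.unit h.mem⟩

/-- An edge with points in both halves crosses the new ray strictly inside, so it is the edge
labelled by that ray, which `between` excludes. -/
theorem between_disjoint {θ₁ θ₂ θ₃ : Plane} (hdet : det₂ θ₁ θ₂ ≠ 0)
    (h : IsSplit N c T l θ₁ θ₂ θ₃) :
    Disjoint (between N c l θ₁ θ₃) (between N c l θ₂ θ₃) := by
  rw [Set.disjoint_left]
  rintro i ⟨-, -, hi₃, x, hx, hx'⟩ ⟨-, -, -, y, hy, hy'⟩
  have hne : x ≠ y := by
    rintro rfl
    have := det₂_mul_det₂_neg hdet h.mem hx' hy'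
    linarith [mul_self_nonneg (det₂ θ₃ x)]
  obtain ⟨a, b, ha, hb, hab⟩ := hx'
  obtain ⟨a', b', ha', hb', hab'⟩ := hy'
  exact hi₃ (S.label_eq_of_mem_openSegment h.unit hx hy hne
    (S.crossing h.unit h.mem hx hy ⟨a, b, ha, hb.le, hab⟩ ⟨a', b', ha', hb'.le, hab'⟩)).symm

/-- The inequality behind termination and the linear number of passes: the halves get disjoint sets
of edges, and neither gets the newly found edge `l θ₃`. -/
theorem ncard_between_split [Finite ι] {θ₁ θ₂ θ₃ : Plane} (h₁ : ‖θ₁‖ = 1) (h₂ : ‖θ₂‖ = 1)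
    (hdet : det₂ θ₁ θ₂ ≠ 0) (h : IsSplit N c T l θ₁ θ₂ θ₃) :
    (between N c l θ₁ θ₃).ncard + (between N c l θ₂ θ₃).ncard + 1
      ≤ (between N c l θ₁ θ₂).ncard := by
  have hs₁ := S.between_subset_of_split h₂ h
  have hs₂ := S.between_subset_of_split h₁ h.symm
  rw [between_comm θ₂ θ₁] at hs₂
  have hu := Set.ncard_union_eq (S.between_disjoint hdet h) (Set.toFinite _) (Set.toFinite _)
  have hle := Set.ncard_le_ncard (Set.union_subset hs₁ hs₂) (Set.toFinite _)
  have hd := Set.ncard_sdiff_singleton_add_one (S.label_mem_between h) (Set.toFinite _)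
  omega

/-- The edge found by a ray cannot continue on both sides of a vertex. -/
theorem not_mem_extremePoints_of_crossing {θ x y : Plane} (hθ : ‖θ‖ = 1)
    (hx : x ∈ face N c (l θ)) (hy : y ∈ face N c (l θ)) (hxy : det₂ θ x * det₂ θ y < 0) :
    T θ ∉ (polyhedron N c).extremePoints ℝ := by
  intro hext
  have hm := S.mem θ hθ
  have hne : x ≠ y := by
    rintro rfl
    linarith [mul_self_nonneg (det₂ θ x)]
  have hseg : T θ ∈ openSegment ℝ x y := by
    rcases mul_neg_iff.1 hxy with ⟨h₁, h₂⟩ | ⟨h₁, h₂⟩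
    · rw [openSegment_symm]
      exact S.crossing_of_mem hθ hm hy hx h₂ h₁
    · exact S.crossing_of_mem hθ hm hx hy h₁ h₂
  have := (mem_extremePoints.1 hext).2 x hx.1 y hy.1 hseg
  exact hne (this.1.trans this.2.symm)

/-- A vertex on the common side of two angles is found in one of them. -/
theorem pending_of_common_side {θ₁ θ₂ θ₃ v : Plane} (hθ : ‖θ₃‖ = 1) (hv : v = T θ₃)
    (hext : v ∈ (polyhedron N c).extremePoints ℝ)
    (hsep : ∀ x ∈ openCone θ₁ θ₃, ∀ y ∈ openCone θ₂ θ₃, det₂ θ₃ x * det₂ θ₃ y < 0) :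
    Pending N c T l θ₁ θ₃ v ∨ Pending N c T l θ₂ θ₃ v := by
  by_cases h₁ : face N c (l θ₃) ∩ openCone θ₁ θ₃ = ∅
  · exact Or.inl (Or.inr (Or.inr ⟨hv, h₁⟩))
  by_cases h₂ : face N c (l θ₃) ∩ openCone θ₂ θ₃ = ∅
  · exact Or.inr (Or.inr (Or.inr ⟨hv, h₂⟩))
  obtain ⟨x, hx, hx'⟩ := Set.nonempty_iff_ne_empty.2 h₁
  obtain ⟨y, hy, hy'⟩ := Set.nonempty_iff_ne_empty.2 h₂
  exact absurd (hv ▸ hext) (S.not_mem_extremePoints_of_crossing hθ hx hy (hsep x hx' y hy'))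

theorem eq_endpoint_of_extreme [Finite ι] {θ v : Plane} {r : ℝ} (hθ : ‖θ‖ = 1)
    (hext : v ∈ (polyhedron N c).extremePoints ℝ) (hr : 0 < r) (h : v = r • θ) : v = T θ := by
  obtain ⟨i, -, -, hi, -⟩ := exists_tight_pair hext
  exact S.eq_of_mem_face_ray hθ hi hr h

/-- The only delicate vertices are those on the new ray, which belong to neither open half;
`pending_of_common_side` assigns them. A vertex on an old side remains pending because the angle
there has only shrunk. -/
theorem pending_split [Finite ι] {θ₁ θ₂ θ₃ v : Plane} (hdet : det₂ θ₁ θ₂ ≠ 0)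
    (hext : v ∈ (polyhedron N c).extremePoints ℝ) (h : IsSplit N c T l θ₁ θ₂ θ₃)
    (hv : Pending N c T l θ₁ θ₂ v) :
    Pending N c T l θ₁ θ₃ v ∨ Pending N c T l θ₂ θ₃ v := by
  rcases hv with hv | ⟨hv, he⟩ | ⟨hv, he⟩
  · rcases openCone_trichotomy h.mem hv with h' | h' | ⟨r, hr, hr'⟩
    · exact Or.inl (Or.inl h')
    · exact Or.inr (Or.inl h')
    · exact S.pending_of_common_side h.unit (S.eq_endpoint_of_extreme h.unit hext hr hr') hext
        fun x hx y hy => det₂_mul_det₂_neg hdet h.mem hx hy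
  · refine Or.inl (Or.inr (Or.inl ⟨hv, Set.subset_empty_iff.1 ?_⟩))
    rw [← he]
    exact Set.inter_subset_inter_right _ (openCone_subset_left h.mem)
  · refine Or.inr (Or.inr (Or.inl ⟨hv, Set.subset_empty_iff.1 ?_⟩))
    rw [← he]
    exact Set.inter_subset_inter_right _ (openCone_subset_right h.mem)

/-- A vertex in the angle of two points of an edge is one of these points. -/
theorem extreme_eq_of_mem_cone [Finite ι] {i : ι} {x y v : Plane} {a b : ℝ}
    (hx : x ∈ face N c i) (hy : y ∈ face N c i)
    (hext : v ∈ (polyhedron N c).extremePoints ℝ) (ha : 0 ≤ a) (hb : 0 ≤ b)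
    (h : v = a • x + b • y) : v = x ∨ v = y := by
  obtain ⟨j, -, -, hj, -⟩ := exists_tight_pair hext
  have hsum : 0 < a + b := by
    rcases (add_nonneg ha hb).lt_or_eq with h' | h'
    · exact h'
    · have ha₀ : a = 0 := by linarith
      have hb₀ : b = 0 := by linarith
      exact absurd (by rw [h, ha₀, hb₀]; simp) (S.ne_zero_of_mem_face hj)
  have hmem : (a / (a + b)) • x + (b / (a + b)) • y ∈ face N c i :=
    convex_face i hx hy (by positivity) (by positivity) (by field_simp)
  have hv : v = (a + b) • ((a / (a + b)) • x + (b / (a + b)) • y) := by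
    rw [smul_add, smul_smul, smul_smul, mul_div_cancel₀ _ hsum.ne', mul_div_cancel₀ _ hsum.ne', h]
  have hv' := S.eq_of_mem_face hmem hj hsum hv
  rcases ha.lt_or_eq with ha | rfl
  · rcases hb.lt_or_eq with hb | rfl
    · left
      exact (hext.2 hx.1 hy.1
        ⟨_, _, div_pos ha hsum, div_pos hb hsum, by field_simp, hv'.symm⟩).symm
    · left
      rw [hv']
      simp [div_self ha.ne']
  · right
    have hb : b ≠ 0 := by rintro rfl; simp at hsum
    rw [hv']
    simp [div_self hb]

/-- Justifies discarding a subface. Both endpoints are on one edge, so an extreme point in their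
angle would be an endpoint, which is not in the open angle. The midpoint of the endpoints shows that
the edge enters the angle, which rules out the other two alternatives. -/
theorem not_pending_of_common_edge [Finite ι] {θ₁ θ₂ v : Plane} (h₁ : ‖θ₁‖ = 1) (h₂ : ‖θ₂‖ = 1)
    (hdet : det₂ θ₁ θ₂ ≠ 0) (hT₁ : T θ₁ ∈ face N c (l θ₂)) (hT₂ : T θ₂ ∈ face N c (l θ₁))
    (hext : v ∈ (polyhedron N c).extremePoints ℝ) : ¬ Pending N c T l θ₁ θ₂ v := by
  rintro (hv | ⟨-, he⟩ | ⟨-, he⟩)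
  · obtain ⟨a, b, ha, hb, hab⟩ := hv
    obtain ⟨s, hs, e₁⟩ := S.ray θ₁ h₁
    obtain ⟨t, ht, e₂⟩ := S.ray θ₂ h₂
    have hv : v = (a / s) • T θ₁ + (b / t) • T θ₂ := by
      rw [e₁, e₂, smul_smul, smul_smul, div_mul_cancel₀ _ hs.ne', div_mul_cancel₀ _ ht.ne', hab]
    rcases S.extreme_eq_of_mem_cone (S.mem θ₁ h₁) hT₂ hext (by positivity) (by positivity) hv
      with h | h
    · have hd := congrArg (det₂ θ₁) (hab.symm.trans h)
      rw [e₁, det₂_add_right, det₂_smul_right, det₂_smul_right, det₂_smul_right, det₂_self,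
        mul_zero, mul_zero, zero_add] at hd
      exact (mul_ne_zero hb.ne' hdet) hd
    · have hd := congrArg (det₂ θ₂) (hab.symm.trans h)
      rw [e₂, det₂_add_right, det₂_smul_right, det₂_smul_right, det₂_smul_right, det₂_self,
        mul_zero, mul_zero, add_zero, det₂_comm] at hd
      exact (mul_ne_zero ha.ne' (neg_ne_zero.2 hdet)) hd
  · exact (S.face_inter_openCone_nonempty h₁ h₂ (S.mem θ₁ h₁) hT₂).ne_empty he
  · exact (S.face_inter_openCone_nonempty h₁ h₂ hT₁ (S.mem θ₂ h₂)).ne_empty he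

/-- If the lines of the two edges meet in a vertex `u` inside the angle, it is the only one found
there. -/
theorem eq_of_pending [Finite ι] {θ₁ θ₂ v u : Plane} {a b : ℝ} (h₁ : ‖θ₁‖ = 1) (h₂ : ‖θ₂‖ = 1)
    (hdet : det₂ θ₁ θ₂ ≠ 0) (ha : 0 ≤ a) (hb : 0 ≤ b) (hu : u = a • T θ₁ + b • T θ₂)
    (hu₁ : u ∈ face N c (l θ₁)) (hu₂ : u ∈ face N c (l θ₂))
    (hext : v ∈ (polyhedron N c).extremePoints ℝ) (hv : Pending N c T l θ₁ θ₂ v) : v = u := by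
  have hm₁ := S.mem θ₁ h₁
  have hm₂ := S.mem θ₂ h₂
  obtain ⟨s, hs, e₁⟩ := S.ray θ₁ h₁
  obtain ⟨t, ht, e₂⟩ := S.ray θ₂ h₂
  -- The degenerate positions of `u` on a bounding ray; there it must coincide with the endpoint of
  -- that ray.
  have eq₁ : b = 0 → u = T θ₁ := by
    rintro rfl
    rw [zero_smul, add_zero] at hu
    have ha₀ : 0 < a := lt_of_le_of_ne ha fun h => S.ne_zero_of_mem_face hu₁ (by
      rw [hu, ← h, zero_smul])
    exact S.eq_of_mem_face hm₁ hu₁ ha₀ hu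
  have eq₂ : a = 0 → u = T θ₂ := by
    rintro rfl
    rw [zero_smul, zero_add] at hu
    have hb₀ : 0 < b := lt_of_le_of_ne hb fun h => S.ne_zero_of_mem_face hu₁ (by
      rw [hu, ← h, zero_smul])
    exact S.eq_of_mem_face hm₂ hu₁ hb₀ hu
  have hopen : 0 < a → 0 < b → u ∈ openCone θ₁ θ₂ := fun ha hb =>
    ⟨a * s, b * t, by positivity, by positivity, by rw [hu, e₁, e₂, smul_smul, smul_smul]⟩
  rcases hv with hv | ⟨hv, he⟩ | ⟨hv, he⟩
  · by_cases hu' : v = u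
    · exact hu'
    exfalso
    have side : ∀ x, x ∈ openCone θ₁ θ₂ → x ≠ T θ₁ ∧ x ≠ T θ₂ := by
      rintro x ⟨α, β, hα, hβ, rfl⟩
      constructor
      · intro h
        have hd := congrArg (det₂ θ₁) h
        rw [e₁, det₂_add_right, det₂_smul_right, det₂_smul_right, det₂_smul_right, det₂_self,
          mul_zero, mul_zero, zero_add] at hd
        exact (mul_ne_zero hβ.ne' hdet) hd
      · intro h
        have hd := congrArg (det₂ θ₂) h
        rw [e₂, det₂_add_right, det₂_smul_right, det₂_smul_right, det₂_smul_right, det₂_self,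
          mul_zero, mul_zero, add_zero, det₂_comm] at hd
        exact (mul_ne_zero hα.ne' (neg_ne_zero.2 hdet)) hd
    obtain ⟨n₁, n₂⟩ := side v hv
    obtain ⟨α, β, hα, hβ, hv⟩ := hv
    have hv' : v = (α / s) • T θ₁ + (β / t) • T θ₂ := by
      rw [e₁, e₂, smul_smul, smul_smul, div_mul_cancel₀ _ hs.ne', div_mul_cancel₀ _ ht.ne', hv]
    have hα' : 0 < α / s := by positivity
    have hβ' : 0 < β / t := by positivity
    generalize α / s = p at hv' hα'
    generalize β / t = q at hv' hβ'
    -- The vector `u` divides the angle. Depending on the slope, `v` lies in the angle of `T θ₁` and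
    -- `u`, both on the first edge, or in that of `T θ₂` and `u`, both on the second; an extreme
    -- point there is one of the two spanning points.
    rcases le_total (q * a) (p * b) with h | h
    · have hb₀ : b ≠ 0 := by
        rintro rfl
        have ha₀ : a ≠ 0 := fun h => S.ne_zero_of_mem_face hu₁ (by rw [hu, h]; simp)
        have : 0 < q * a := mul_pos hβ' (lt_of_le_of_ne ha ha₀.symm)
        linarith
      have hb₁ : 0 < b := lt_of_le_of_ne hb hb₀.symm
      rcases S.extreme_eq_of_mem_cone hm₁ hu₁ hext (a := p - q / b * a) (b := q / b)
        (by rw [sub_nonneg, div_mul_eq_mul_div, div_le_iff₀ hb₁]; exact h) (by positivity)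
        (by
          rw [hu, smul_add, smul_smul, smul_smul, div_mul_cancel₀ _ hb₀, hv']
          module) with h' | h'
      · exact n₁ h'
      · exact hu' h'
    · have ha₀ : a ≠ 0 := by
        rintro rfl
        have hb₀ : b ≠ 0 := fun h => S.ne_zero_of_mem_face hu₁ (by rw [hu, h]; simp)
        have : 0 < p * b := mul_pos hα' (lt_of_le_of_ne hb hb₀.symm)
        linarith
      have ha₁ : 0 < a := lt_of_le_of_ne ha ha₀.symm
      rcases S.extreme_eq_of_mem_cone hm₂ hu₂ hext (a := q - p / a * b) (b := p / a)
        (by rw [sub_nonneg, div_mul_eq_mul_div, div_le_iff₀ ha₁]; exact h) (by positivity)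
        (by
          rw [hu, smul_add, smul_smul, smul_smul, div_mul_cancel₀ _ ha₀, hv']
          module) with h' | h'
      · exact n₂ h'
      · exact hu' h'
  · rw [hv]
    rcases ha.lt_or_eq with ha | ha
    · rcases hb.lt_or_eq with hb | hb
      · exact absurd he (Set.Nonempty.ne_empty ⟨u, hu₁, hopen ha hb⟩)
      · exact (eq₁ hb.symm).symm
    · refine absurd he (S.face_inter_openCone_nonempty h₁ h₂ hm₁ ?_).ne_empty
      rw [← eq₂ ha.symm]
      exact hu₁
  · rw [hv]
    rcases hb.lt_or_eq with hb | hb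
    · rcases ha.lt_or_eq with ha | ha
      · exact absurd he (Set.Nonempty.ne_empty ⟨u, hu₂, hopen ha hb⟩)
      · exact (eq₂ ha.symm).symm
    · refine absurd he (S.face_inter_openCone_nonempty h₁ h₂ ?_ hm₂).ne_empty
      rw [← eq₁ hb.symm]
      exact hu₂

end IsRayShooting

end Subfaces

end RayVoronoi

namespace RayVoronoi

/-! ### The system of inequalities of a Voronoi cell -/

section CellSystem

variable {m n : ℕ}

/-- A normal to the line with the given label. -/
def normalOf (W : ConvexPolygon m) (p : Fin n → Plane) (k : Fin n) : LineLabel n m → Plane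
  | .bisector j => p j - p k
  | .boundary i => W.normal i

open Classical in
/-- The right-hand side of the inequality with the given label, in coordinates centered at `p k`
(for the trivial inequality of `p k` itself it is `1`). -/
noncomputable def levelOf (W : ConvexPolygon m) (p : Fin n → Plane) (k : Fin n) : LineLabel n m → ℝ
  | .bisector j => if j = k then 1 else inner ℝ (p j - p k) (p j - p k) / 2
  | .boundary i => W.offset i - inner ℝ (W.normal i) (p k)

/-- The cell of `p k` in coordinates centered at `p k`. -/
def centeredCell (W : ConvexPolygon m) (p : Fin n → Plane) (k : Fin n) : Set Plane :=
  polyhedron (normalOf W p k) (levelOf W p k)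

/-- The part of the centered cell on the line with the given label. -/
def cellFace (W : ConvexPolygon m) (p : Fin n → Plane) (k : Fin n) (L : LineLabel n m) :
    Set Plane :=
  face (normalOf W p k) (levelOf W p k) L

instance : Finite (LineLabel n m) := by
  refine Finite.of_injective (β := Fin n ⊕ Fin m)
    (fun L => match L with
      | .bisector j => Sum.inl j
      | .boundary i => Sum.inr i) ?_
  rintro (j | i) (j' | i') h <;> simp_all

variable {W : ConvexPolygon m} {p : Fin n → Plane} {k : Fin n}

theorem levelOf_bisector {j : Fin n} (h : j ≠ k) :
    levelOf W p k (.bisector j) = inner ℝ (p j - p k) (p j - p k) / 2 := by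
  simp [levelOf, h]

theorem dist_sq_sub (p a x : Plane) :
    dist x a ^ 2 - dist x p ^ 2
      = inner ℝ (a - p) (a - p) - 2 * inner ℝ (a - p) (x - p) := by
  rw [dist_eq_norm, dist_eq_norm, ← real_inner_self_eq_norm_sq, ← real_inner_self_eq_norm_sq]
  simp only [inner_coords, PiLp.sub_apply]
  ring

theorem dist_le_iff (p a x : Plane) :
    dist x p ≤ dist x a ↔ inner ℝ (a - p) (x - p) ≤ inner ℝ (a - p) (a - p) / 2 := by
  rw [← abs_of_nonneg (dist_nonneg (x := x) (y := p)),
    ← abs_of_nonneg (dist_nonneg (x := x) (y := a)), ← sq_le_sq]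
  have := dist_sq_sub p a x
  constructor <;> intro h <;> linarith

theorem dist_lt_iff (p a x : Plane) :
    dist x a < dist x p ↔ inner ℝ (a - p) (a - p) / 2 < inner ℝ (a - p) (x - p) := by
  rw [← not_le, dist_le_iff, not_le]

theorem dist_eq_iff (p a x : Plane) :
    dist x a = dist x p ↔ inner ℝ (a - p) (x - p) = inner ℝ (a - p) (a - p) / 2 := by
  have := dist_sq_sub p a x
  constructor
  · intro h
    rw [h] at this
    linarith
  · intro h
    rw [← sq_eq_sq₀ dist_nonneg dist_nonneg]
    linarith

theorem inner_normal_sub (ν x q : Plane) (o : ℝ) :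
    inner ℝ ν (x - q) ≤ o - inner ℝ ν q ↔ inner ℝ ν x ≤ o := by
  rw [inner_sub_right]
  constructor <;> intro h <;> linarith

theorem mem_centeredCell_iff {x : Plane} : x - p k ∈ centeredCell W p k ↔ x ∈ cell W p k := by
  constructor
  · intro h
    refine ⟨fun i => ?_, fun j hj => ?_⟩
    · exact (inner_normal_sub _ _ _ _).1 (h (.boundary i))
    · have := h (.bisector j)
      rw [levelOf_bisector hj] at this
      exact (dist_le_iff _ _ _).2 this
  · rintro ⟨h, h'⟩ (j | i)
    · by_cases hj : j = k
      · subst hj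
        simp [normalOf, levelOf]
      · rw [levelOf_bisector hj]
        exact (dist_le_iff _ _ _).1 (h' j hj)
    · exact (inner_normal_sub _ _ _ _).2 (h i)

theorem add_mem_cell_iff {x : Plane} : p k + x ∈ cell W p k ↔ x ∈ centeredCell W p k := by
  rw [← mem_centeredCell_iff, add_sub_cancel_left]

/-- The reason for the level `1` at the label of `p k` itself: the normal is zero, so the inequality
reads `0 ≤ 1`. It is harmless, never tight, and keeps all levels positive. -/
theorem bisector_self_not_tight (x : Plane) : x ∉ cellFace W p k (.bisector k) := by
  intro h
  have := h.2
  simp [normalOf, levelOf] at this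

/-- The lines of the labels. -/
theorem mem_cellFace_iff {x : Plane} {L : LineLabel n m} (hL : L ≠ .bisector k) :
    x - p k ∈ cellFace W p k L ↔ x ∈ cell W p k ∩ lineSet W p k L := by
  unfold cellFace face
  rw [Set.mem_inter_iff, ← mem_centeredCell_iff]
  refine and_congr Iff.rfl ?_
  cases L with
  | bisector j =>
    have hj : j ≠ k := fun h => hL (by rw [h])
    rw [levelOf_bisector hj]
    exact (dist_eq_iff _ _ _).symm.trans eq_comm
  | boundary i =>
    show inner ℝ (W.normal i) (x - p k) = W.offset i - inner ℝ (W.normal i) (p k) ↔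
      inner ℝ (W.normal i) x = W.offset i
    rw [inner_sub_right]
    constructor <;> intro h <;> linarith

theorem inner_lt_of_mem_interior {x : Plane} (h : x ∈ interior W.carrier) (i : Fin m) :
    inner ℝ (W.normal i) x < W.offset i := by
  rcases (interior_subset h i).lt_or_eq with hlt | heq
  · exact hlt
  exfalso
  have hcont : Continuous fun ε : ℝ => x + ε • W.normal i := by fun_prop
  have h₀ : ∀ᶠ ε in nhds (0 : ℝ), x + ε • W.normal i ∈ W.carrier := by
    apply hcont.continuousAt
    simpa using mem_interior_iff_mem_nhds.1 h
  obtain ⟨ε, hε, hε'⟩ := ((h₀.filter_mono nhdsWithin_le_nhds).and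
    (self_mem_nhdsWithin (s := Set.Ioi (0 : ℝ)))).exists
  have h₂ := hε i
  rw [inner_add_right, inner_smul_right, heq] at h₂
  have h₃ : 0 < ε * inner ℝ (W.normal i) (W.normal i) :=
    mul_pos hε' (real_inner_self_pos.2 (W.normal_ne_zero i))
  linarith

theorem boundary_level_pos (hint : ∀ k, p k ∈ interior W.carrier) (k : Fin n) (i : Fin m) :
    0 < levelOf W p k (.boundary i) :=
  sub_pos.2 (inner_lt_of_mem_interior (hint k) i)

/-- The other sites are interior to the world as well. This is what keeps a bisector from coinciding
with the line of a side, and what allows moves towards the midpoint of two sites. -/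
theorem inner_site_lt_level (hint : ∀ k, p k ∈ interior W.carrier) (k j : Fin n) (i : Fin m) :
    inner ℝ (W.normal i) (p j - p k) < levelOf W p k (.boundary i) := by
  have := inner_lt_of_mem_interior (hint j) i
  rw [inner_sub_right]
  simp only [levelOf]
  linarith

theorem levelOf_pos (hp : Function.Injective p) (hint : ∀ k, p k ∈ interior W.carrier)
    (k : Fin n) (L : LineLabel n m) : 0 < levelOf W p k L := by
  cases L with
  | bisector j =>
    by_cases hj : j = k
    · simp [levelOf, hj]
    · rw [levelOf_bisector hj]
      have : 0 < inner ℝ (p j - p k) (p j - p k) :=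
        real_inner_self_pos.2 (sub_ne_zero.2 fun h => hj (hp h))
      linarith
  | boundary i => exact boundary_level_pos hint k i

theorem isCompact_centeredCell : IsCompact (centeredCell W p k) := by
  have h : IsCompact ((fun x : Plane => x - p k) '' W.carrier) :=
    W.compact.image (by fun_prop)
  refine h.of_isClosed_subset isClosed_polyhedron fun x hx => ⟨p k + x, ?_, by simp⟩
  exact (add_mem_cell_iff.2 hx).1

/-- Two different inequalities do not describe the same line. -/
theorem label_unique (hp : Function.Injective p) (hint : ∀ k, p k ∈ interior W.carrier)
    (k : Fin n) (L L' : LineLabel n m)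
    (h : (cellFace W p k L ∩ cellFace W p k L').Nontrivial) : L = L' := by
  obtain ⟨x, ⟨hx, hx'⟩, y, ⟨hy, hy'⟩, hxy⟩ := h
  have hd : x - y ≠ 0 := sub_ne_zero.2 hxy
  have o₁ : inner ℝ (x - y) (normalOf W p k L) = 0 := by
    rw [real_inner_comm, inner_sub_right, hx.2, hy.2, sub_self]
  have o₂ : inner ℝ (x - y) (normalOf W p k L') = 0 := by
    rw [real_inner_comm, inner_sub_right, hx'.2, hy'.2, sub_self]
  have c₁ := levelOf_pos hp hint k L
  have c₂ := levelOf_pos hp hint k L'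
  have hd₁ : det₂ (x - y) (normalOf W p k L) ≠ 0 := by
    intro h0
    have hz : normalOf W p k L = 0 :=
      eq_of_inner_det₂ hd (by rw [o₁, inner_zero_right]) (by rw [h0]; simp [det₂])
    have := hx.2
    rw [hz, inner_zero_left] at this
    exact c₁.ne this
  -- Both normals are orthogonal to `x - y`, hence parallel; positive levels make the factor
  -- positive.
  obtain ⟨a, ha⟩ : ∃ a : ℝ, normalOf W p k L' = a • normalOf W p k L := by
    refine ⟨det₂ (x - y) (normalOf W p k L') / det₂ (x - y) (normalOf W p k L),
      eq_of_inner_det₂ hd ?_ ?_⟩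
    · rw [inner_smul_right, o₁, o₂, mul_zero]
    · rw [det₂_smul_right, div_mul_cancel₀ _ hd₁]
  have hlev : levelOf W p k L' = a * levelOf W p k L := by
    rw [← hx.2, ← hx'.2, ha, real_inner_smul_left]
  have ha₀ : 0 < a := pos_of_mul_pos_left (hlev ▸ c₂) c₁.le
  -- If the line of a side were the bisector of `p k` and `p j`, then `p j` would be at twice the
  -- level of that side, hence outside the world.
  have mixed : ∀ (j : Fin n) (i : Fin m) (a : ℝ), 0 < a → j ≠ k →
      normalOf W p k (.boundary i) = a • normalOf W p k (.bisector j) →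
      levelOf W p k (.boundary i) = a * levelOf W p k (.bisector j) → False := by
    intro j i a ha hj h₁ h₂
    have h₃ := inner_site_lt_level hint k j i
    have h₁' : W.normal i = a • (p j - p k) := h₁
    rw [h₂, levelOf_bisector hj, h₁', real_inner_smul_left] at h₃
    have h₄ : 0 < a * inner ℝ (p j - p k) (p j - p k) :=
      mul_pos ha (real_inner_self_pos.2 (sub_ne_zero.2 fun h => hj (hp h)))
    linarith
  have ne_self : ∀ {z : Plane} {j : Fin n}, z ∈ cellFace W p k (.bisector j) → j ≠ k := by
    rintro z j hz rfl
    exact bisector_self_not_tight z hz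
  cases L with
  | bisector j =>
    have hj := ne_self hx
    cases L' with
    | bisector j' =>
      have hj' := ne_self hx'
      rw [levelOf_bisector hj, levelOf_bisector hj'] at hlev
      have ha' : p j' - p k = a • (p j - p k) := ha
      rw [ha', real_inner_smul_left, real_inner_smul_right] at hlev
      have hpos : 0 < inner ℝ (p j - p k) (p j - p k) :=
        real_inner_self_pos.2 (sub_ne_zero.2 fun h => hj (hp h))
      have ha₁ : a = 1 := by
        have : a * inner ℝ (p j - p k) (p j - p k) * (a - 1) = 0 := by linarith
        have := (mul_eq_zero.1 this).resolve_left (by positivity)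
        linarith
      rw [ha₁, one_smul, sub_left_inj] at ha'
      rw [hp ha']
    | boundary i => exact (mixed j i a ha₀ hj ha hlev).elim
  | boundary i =>
    cases L' with
    | bisector j =>
      refine (mixed j i a⁻¹ (inv_pos.2 ha₀) (ne_self hx') ?_ ?_).elim
      · rw [ha, smul_smul, inv_mul_cancel₀ ha₀.ne', one_smul]
      · rw [hlev, ← mul_assoc, inv_mul_cancel₀ ha₀.ne', one_mul]
    | boundary i' =>
      congr 1
      apply W.side_injective
      have ha' : W.normal i' = a • W.normal i := ha
      have hoff : W.offset i' = a * W.offset i := by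
        have : W.offset i' - inner ℝ (W.normal i') (p k)
          = a * (W.offset i - inner ℝ (W.normal i) (p k)) := hlev
        rw [ha', real_inner_smul_left] at this
        linarith
      ext z
      simp only [Set.mem_inter_iff]
      refine and_congr Iff.rfl ?_
      show inner ℝ (W.normal i) z = W.offset i ↔ inner ℝ (W.normal i') z = W.offset i'
      rw [ha', hoff, real_inner_smul_left, mul_right_inj' ha₀.ne']

theorem isPolygonSystem (hp : Function.Injective p) (hint : ∀ k, p k ∈ interior W.carrier)
    (k : Fin n) : IsPolygonSystem (normalOf W p k) (levelOf W p k) where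
  pos := levelOf_pos hp hint k
  compact := isCompact_centeredCell
  face_unique := label_unique hp hint k

theorem mem_extremePoints_iff {v : Plane} :
    v ∈ (cell W p k).extremePoints ℝ ↔ v - p k ∈ (centeredCell W p k).extremePoints ℝ := by
  have htrans : ∀ x y z : Plane,
      x - p k ∈ openSegment ℝ (y - p k) (z - p k) ↔ x ∈ openSegment ℝ y z := by
    intro x y z
    rw [← mem_openSegment_translate ℝ (p k)]
    simp
  constructor
  · rintro ⟨h, h'⟩
    refine ⟨mem_centeredCell_iff.2 h, fun x hx y hy hv => ?_⟩
    have := h' (add_mem_cell_iff.2 hx) (add_mem_cell_iff.2 hy)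
      ((htrans _ _ _).1 (by simpa using hv))
    rw [← this, add_sub_cancel_left]
  · rintro ⟨h, h'⟩
    refine ⟨mem_centeredCell_iff.1 h, fun x hx y hy hv => ?_⟩
    exact sub_left_injective (h' (mem_centeredCell_iff.2 hx) (mem_centeredCell_iff.2 hy)
      ((htrans _ _ _).2 hv))

/-! ### Edges -/

/-- The labels of the edges of a cell. -/
def edgeLabels (W : ConvexPolygon m) (p : Fin n → Plane) (k : Fin n) : Set (LineLabel n m) :=
  {L | (cellFace W p k L).Nontrivial}

theorem ne_bisector_self {L : LineLabel n m} {x : Plane} (h : x ∈ cellFace W p k L) :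
    L ≠ .bisector k := by
  rintro rfl
  exact bisector_self_not_tight _ h

/-- The normal of the label is an exposing functional; the segment comes from
`exists_face_eq_segment`. -/
theorem isEdge_of_mem_edgeLabels (hp : Function.Injective p)
    (hint : ∀ k, p k ∈ interior W.carrier) {L : LineLabel n m} (hL : L ∈ edgeLabels W p k) :
    IsEdge (cell W p k) (cell W p k ∩ lineSet W p k L) := by
  have hne : L ≠ .bisector k := ne_bisector_self hL.nonempty.some_mem
  have heq : cell W p k ∩ lineSet W p k L = {x | x - p k ∈ cellFace W p k L} :=
    Set.ext fun x => (mem_cellFace_iff hne).symm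
  constructor
  · intro _
    refine ⟨innerSL ℝ (normalOf W p k L), ?_⟩
    rw [heq]
    obtain ⟨y, hy⟩ := hL.nonempty
    ext x
    simp only [Set.mem_ofPred_eq, innerSL_apply_apply]
    constructor
    · intro hx
      refine ⟨mem_centeredCell_iff.1 hx.1, fun z hz => ?_⟩
      have h₁ := hx.2
      have h₂ := mem_centeredCell_iff.2 hz L
      rw [inner_sub_right] at h₁ h₂
      linarith
    · rintro ⟨hx, hmax⟩
      refine ⟨mem_centeredCell_iff.2 hx, le_antisymm (mem_centeredCell_iff.2 hx L) ?_⟩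
      have h₁ := hmax (p k + y) (add_mem_cell_iff.2 hy.1)
      rw [← hy.2, inner_sub_right]
      rw [inner_add_right] at h₁
      linarith
  · obtain ⟨a, b, hab, hseg⟩ := (isPolygonSystem hp hint k).exists_face_eq_segment hL
    refine ⟨p k + a, p k + b, fun h => hab (add_left_cancel h), ?_⟩
    rw [heq]
    ext x
    show x - p k ∈ cellFace W p k L ↔ _
    rw [show cellFace W p k L = segment ℝ a b from hseg,
      ← mem_segment_translate ℝ (p k), add_sub_cancel]

theorem left_mem_extremePoints_segment {a b : Plane} (hab : a ≠ b) :
    a ∈ (segment ℝ a b).extremePoints ℝ := by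
  refine ⟨left_mem_segment ℝ a b, ?_⟩
  rw [segment_eq_image']
  rintro _ ⟨s, ⟨hs, -⟩, rfl⟩ _ ⟨t, ⟨ht, -⟩, rfl⟩ ⟨α, β, hα, hβ, hαβ, h⟩
  have h₁ : (α * s + β * t) • (b - a) = 0 := by
    have : α • (a + s • (b - a)) + β • (a + t • (b - a))
        = (α + β) • a + (α * s + β * t) • (b - a) := by module
    simp only [this, hαβ, one_smul, add_eq_left] at h
    exact h
  have h₂ := (smul_eq_zero.1 h₁).resolve_right (sub_ne_zero.2 hab.symm)
  have h₃ : α * s = 0 := by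
    have := mul_nonneg hα.le hs
    have := mul_nonneg hβ.le ht
    linarith
  simp [(mul_eq_zero.1 h₃).resolve_left hα.ne']

/-- Every edge is on the line of a label. -/
theorem exists_label_of_isEdge (hp : Function.Injective p)
    (hint : ∀ k, p k ∈ interior W.carrier) {a b : Plane}
    (h : IsEdge (cell W p k) (segment ℝ a b)) :
    ∃ L ∈ edgeLabels W p k, segment ℝ a b = cell W p k ∩ lineSet W p k L ∧
      a - p k ∈ cellFace W p k L ∧ b - p k ∈ cellFace W p k L ∧
      a ∈ (cell W p k).extremePoints ℝ ∧ b ∈ (cell W p k).extremePoints ℝ := by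
  obtain ⟨hexp, a', b', hab', hseg⟩ := h
  have S := isPolygonSystem hp hint k
  have hab : a ≠ b := by
    rintro rfl
    rw [segment_same] at hseg
    have h₁ : a' ∈ ({a} : Set Plane) := hseg ▸ left_mem_segment ℝ a' b'
    have h₂ : b' ∈ ({a} : Set Plane) := hseg ▸ right_mem_segment ℝ a' b'
    exact hab' (h₁.trans h₂.symm)
  have ha : a ∈ segment ℝ a b := left_mem_segment ℝ a b
  have hb : b ∈ segment ℝ a b := right_mem_segment ℝ a b
  have hsub : segment ℝ a b ⊆ cell W p k := hexp.subset
  obtain ⟨f, hf⟩ := hexp ⟨a, ha⟩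
  have hmax : ∀ x ∈ segment ℝ a b, ∀ y ∈ cell W p k, f y ≤ f x := by
    intro x hx
    rw [hf] at hx
    exact hx.2
  have hfab : f a = f b := le_antisymm (hmax b hb a (hsub ha)) (hmax a ha b (hsub hb))
  have hmid : midpoint ℝ a b ∈ openSegment ℝ a b :=
    ⟨1 / 2, 1 / 2, by norm_num, by norm_num, by norm_num, by
      rw [midpoint_eq_smul_add, ← smul_add]; norm_num⟩
  have hmid' := openSegment_subset_segment ℝ a b hmid
  -- A segment can be an exposed face of itself, so it must be excluded that the edge is the whole
  -- cell. All levels are positive, hence from `p k` one can move in every direction.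
  have hnot : ∃ x ∈ cell W p k, x ∉ segment ℝ a b := by
    by_contra! hall
    have hall' : ∀ x, x - p k ∈ centeredCell W p k → x ∈ segment ℝ a b :=
      fun x hx => hall x (mem_centeredCell_iff.1 hx)
    have hline : ∀ x ∈ segment ℝ a b, det₂ (b - a) (x - a) = 0 := by
      rintro x ⟨s, t, -, -, hst, rfl⟩
      have : s • a + t • b - a = t • (b - a) := by
        obtain rfl : s = 1 - t := by linarith
        module
      rw [this, det₂_smul_right, det₂_self, mul_zero]
    have hstep : ∀ d : Plane, det₂ (b - a) d = 0 := by
      intro d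
      obtain ⟨ε, hε, hmem⟩ := exists_add_smul_mem_polyhedron (d := d)
        (zero_mem_polyhedron (N := normalOf W p k) S.pos) (fun i hi => by
          rw [inner_zero_right] at hi
          exact absurd hi (S.pos i).ne)
      have h₁ := hline _ (hall' (p k + ε • d) (by
        rw [add_sub_cancel_left]; exact zero_add (ε • d) ▸ hmem))
      have h₂ := hline _ (hall' (p k) (by
        rw [sub_self]; exact zero_mem_polyhedron (N := normalOf W p k) S.pos))
      have : p k + ε • d - a = (p k - a) + ε • d := by abel
      rw [this, det₂_add_right, h₂, det₂_smul_right, zero_add] at h₁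
      exact (mul_eq_zero.1 h₁).resolve_left hε.ne'
    have hba : b - a ≠ 0 := sub_ne_zero.2 hab.symm
    have hz := hstep (rot (b - a))
    have := coords_ne_zero hba
    simp [det₂] at hz this
    linarith
  -- If nothing were tight at the midpoint, one could move beyond it, away from a cell point `x`
  -- with a smaller value of `f`, and increase `f`.
  obtain ⟨L, hL⟩ : ∃ L, midpoint ℝ a b - p k ∈ cellFace W p k L := by
    by_contra! hcon
    obtain ⟨x, hx, hx'⟩ := hnot
    have hlt : f x < f (midpoint ℝ a b) := by
      refine lt_of_le_of_ne (hmax _ hmid' x hx) fun heq => hx' ?_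
      rw [hf]
      exact ⟨hx, fun y hy => by rw [heq]; exact hmax _ hmid' y hy⟩
    obtain ⟨ε, hε, hmem⟩ := exists_add_smul_mem_polyhedron (d := midpoint ℝ a b - x)
      (mem_centeredCell_iff.2 (hsub hmid')) (fun i hi =>
        absurd ⟨mem_centeredCell_iff.2 (hsub hmid'), hi⟩ (hcon i))
    have hmem' := add_mem_cell_iff.2 hmem
    have h₁ := hmax _ hmid' _ hmem'
    rw [show p k + (midpoint ℝ a b - p k + ε • (midpoint ℝ a b - x))
      = midpoint ℝ a b + ε • (midpoint ℝ a b - x) by abel, map_add, map_smul, map_sub] at h₁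
    have h₂ : 0 < ε * (f (midpoint ℝ a b) - f x) := mul_pos hε (sub_pos.2 hlt)
    rw [smul_eq_mul] at h₁
    linarith
  have hmidc : midpoint ℝ a b - p k ∈ openSegment ℝ (a - p k) (b - p k) := by
    rw [← mem_openSegment_translate ℝ (p k)]
    simpa using hmid
  obtain ⟨hLa, hLb⟩ := ends_mem_face hmidc (mem_centeredCell_iff.2 (hsub ha))
    (mem_centeredCell_iff.2 (hsub hb)) hL.2
  have hne : L ≠ .bisector k := ne_bisector_self hL
  refine ⟨L, ⟨_, hLa, _, hLb, fun h => hab (sub_left_injective h)⟩, ?_, hLa, hLb, ?_, ?_⟩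
  · apply Set.Subset.antisymm
    · intro x hx
      rw [← mem_cellFace_iff hne]
      have : x - p k ∈ segment ℝ (a - p k) (b - p k) := by
        rw [← mem_segment_translate ℝ (p k)]
        simpa using hx
      exact (convex_face L).segment_subset hLa hLb this
    · intro x hx
      have hx' := (mem_cellFace_iff hne).2 hx
      rw [hf]
      refine ⟨hx.1, fun y hy => ?_⟩
      -- The points of the face of `L` are on the line through `a` and `b`, along which `f` is
      -- constant.
      suffices f x = f a by
        rw [this]; exact hmax a ha y hy
      have hN := S.normal_ne_zero hLa
      have hdir : b - a ≠ 0 := sub_ne_zero.2 hab.symm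
      have o₁ : inner ℝ (normalOf W p k L) (b - a) = 0 := by
        have h₁ := hLa.2
        have h₂ := hLb.2
        rw [inner_sub_right] at h₁ h₂ ⊢
        linarith
      have o₂ : inner ℝ (normalOf W p k L) (x - a) = 0 := by
        have h₁ := hLa.2
        have h₂ := hx'.2
        rw [inner_sub_right] at h₁ h₂ ⊢
        linarith
      have hdet : det₂ (b - a) (x - a) = 0 := by
        by_contra hd
        apply hN
        refine eq_of_inner_inner (y := 0) hd ?_ ?_
        · rw [real_inner_comm, o₁, inner_zero_right]
        · rw [real_inner_comm, o₂, inner_zero_right]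
      obtain ⟨r, hr⟩ := exists_smul_of_det₂_eq_zero hdir hdet
      have := congrArg f hr
      rw [map_sub, map_smul, map_sub, hfab, sub_self, smul_zero, sub_eq_zero] at this
      exact this.trans hfab.symm
  · refine hexp.isExtreme.extremePoints_subset_extremePoints ?_
    exact left_mem_extremePoints_segment hab
  · refine hexp.isExtreme.extremePoints_subset_extremePoints ?_
    rw [segment_symm]
    exact left_mem_extremePoints_segment hab.symm

/-- Counting edges becomes counting labels: `L ↦ cell ∩ line of L` is onto the edges, and injective
on edge labels because two labels never share two boundary points. -/
theorem edgeCount_eq (hp : Function.Injective p) (hint : ∀ k, p k ∈ interior W.carrier)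
    (k : Fin n) : edgeCount W p k = (edgeLabels W p k).ncard := by
  have himage : {S | IsEdge (cell W p k) S}
      = (fun L => cell W p k ∩ lineSet W p k L) '' edgeLabels W p k := by
    ext S
    constructor
    · intro hS
      obtain ⟨a, b, -, rfl⟩ := hS.2
      obtain ⟨L, hL, heq, -⟩ := exists_label_of_isEdge hp hint hS
      exact ⟨L, hL, heq.symm⟩
    · rintro ⟨L, hL, rfl⟩
      exact isEdge_of_mem_edgeLabels hp hint hL
  unfold edgeCount
  rw [himage, Set.InjOn.ncard_image]
  intro L hL L' hL' heq
  have hne : L ≠ .bisector k := ne_bisector_self hL.nonempty.some_mem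
  have hne' : L' ≠ .bisector k := ne_bisector_self hL'.nonempty.some_mem
  obtain ⟨x, hx, y, hy, hxy⟩ := hL
  have key : ∀ z ∈ cellFace W p k L, z ∈ cellFace W p k L' := by
    intro z hz
    have h₁ : p k + z ∈ cell W p k ∩ lineSet W p k L :=
      (mem_cellFace_iff hne).1 (by rwa [add_sub_cancel_left])
    have h₂ := (mem_cellFace_iff hne').2 ((Set.ext_iff.1 heq _).1 h₁)
    rwa [add_sub_cancel_left] at h₂
  exact label_unique hp hint k L L' ⟨x, ⟨hx, key x hx⟩, y, ⟨hy, key y hy⟩, hxy⟩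

end CellSystem

end RayVoronoi

namespace RayVoronoi

/-! ### Values of programs -/

section Values

variable {α β : Type}

@[simp] theorem Timed.pure_val (a : α) : (pure a : Timed α).val = a := rfl

@[simp] theorem Timed.bind_val (x : Timed α) (f : α → Timed β) :
    (x >>= f).val = (f x.val).val := rfl

@[simp] theorem op_val (a : α) : (op a).val = a := rfl

@[simp] theorem test_val (P : Prop) [Decidable P] : (test P).val = decide P := rfl

@[simp] theorem alongRay_val (x : Timed α) : (alongRay x).val = x.val := rfl

@[simp] theorem compareDist_val (y a b : Plane) :
    (compareDist y a b).val = cmp (dist y a) (dist y b) := rfl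

@[simp] theorem unitVector_val (v : Plane) : (unitVector v).val = ‖v‖⁻¹ • v := rfl

end Values

/-! ### Shooting a ray -/

section Shoot

variable {m n : ℕ} {W : ConvexPolygon m} {p : Fin n → Plane} {k : Fin n}

/-- The edge on the bisector with a nearest site among those equidistant from a boundary point. -/
theorem bisector_mem_edgeLabels (hp : Function.Injective p)
    (hint : ∀ k, p k ∈ interior W.carrier) {j : Fin n} {o : Plane}
    (ho : o ∈ cellFace W p k (.bisector j))
    (hmin : ∀ i, i ≠ k → o ∈ cellFace W p k (.bisector i) →
      dist (p j) (p k) ≤ dist (p i) (p k)) :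
    .bisector j ∈ edgeLabels W p k := by
  have hjk : j ≠ k := fun h => ne_bisector_self ho (by rw [h])
  have tight : ∀ {i}, i ≠ k → o ∈ cellFace W p k (.bisector i) →
      inner ℝ (p i - p k) o = inner ℝ (p i - p k) (p i - p k) / 2 := fun hi h =>
    h.2.trans (levelOf_bisector hi)
  have hmin' : ∀ i, i ≠ k → o ∈ cellFace W p k (.bisector i) →
      ‖p j - p k‖ ≤ ‖p i - p k‖ := fun i hi h => by
    rw [← dist_eq_norm, ← dist_eq_norm]; exact hmin i hi h
  have hjt := tight hjk ho
  have hbd : ∀ i, inner ℝ (W.normal i) (p j - p k) < levelOf W p k (.boundary i) :=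
    inner_site_lt_level hint k j
  -- It is enough to find a direction along the bisector that violates none of the inequalities
  -- tight at `o`.
  suffices ∃ d : Plane, d ≠ 0 ∧ inner ℝ (p j - p k) d = 0 ∧
      ∀ L, inner ℝ (normalOf W p k L) o = levelOf W p k L →
        inner ℝ (normalOf W p k L) d ≤ 0 by
    obtain ⟨d, hd, hjd, hL⟩ := this
    obtain ⟨ε, hε, hmem⟩ := exists_add_smul_mem_polyhedron ho.1 hL
    refine ⟨o, ho, o + ε • d, ⟨hmem, ?_⟩, fun h => ?_⟩
    · rw [inner_add_right, inner_smul_right, ho.2]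
      show _ + ε * inner ℝ (p j - p k) d = _
      rw [hjd, mul_zero, add_zero]
    · rw [left_eq_add, smul_eq_zero] at h
      exact h.elim hε.ne' hd
  -- The direction points from `o` to the midpoint of the two sites. For another equidistant site,
  -- Cauchy-Schwarz and the minimality of `‖p j - p k‖` give the sign. If `o` is the midpoint
  -- itself, minimality shows that `j` is the only equidistant site besides `k`, and no side of the
  -- world passes through `o`; then either direction along the bisector works.
  by_cases hd : (1 / 2 : ℝ) • (p j - p k) - o = 0
  · have ho' : o = (1 / 2 : ℝ) • (p j - p k) := (sub_eq_zero.1 hd).symm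
    refine ⟨rot (p j - p k), rot_ne_zero (sub_ne_zero.2 fun h => hjk (hp h)),
      inner_rot_self _, ?_⟩
    rintro (i | i) hi
    · have hik : i ≠ k := by
        rintro rfl
        exact bisector_self_not_tight o ⟨ho.1, hi⟩
      have h₁ := tight hik ⟨ho.1, hi⟩
      have h₂ := hmin' i hik ⟨ho.1, hi⟩
      have h₃ : ‖p i - p j‖ ^ 2 ≤ 0 := by
        rw [show p i - p j = (p i - p k) - (p j - p k) by abel, norm_sub_sq_real]
        rw [ho', inner_smul_right, real_inner_self_eq_norm_sq] at h₁
        have := mul_self_le_mul_self (norm_nonneg _) h₂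
        nlinarith
      have h₄ : p i - p j = 0 := by
        rw [← norm_eq_zero]
        exact pow_eq_zero_iff two_ne_zero |>.1 (le_antisymm h₃ (sq_nonneg _))
      rw [hp (sub_eq_zero.1 h₄)]
      exact (inner_rot_self _).le
    · exfalso
      have h₁ := hbd i
      have h₂ := boundary_level_pos hint k i
      have h₃ : inner ℝ (W.normal i) o = levelOf W p k (.boundary i) := hi
      rw [ho', inner_smul_right] at h₃
      linarith
  · refine ⟨_, hd, ?_, ?_⟩
    · rw [inner_sub_right, inner_smul_right, hjt]
      ring
    rintro (i | i) hi
    · have hik : i ≠ k := by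
        rintro rfl
        exact bisector_self_not_tight o ⟨ho.1, hi⟩
      have h₁ := tight hik ⟨ho.1, hi⟩
      have h₂ := hmin' i hik ⟨ho.1, hi⟩
      have h₃ := real_inner_le_norm (p i - p k) (p j - p k)
      show inner ℝ (p i - p k) _ ≤ 0
      rw [inner_sub_right, inner_smul_right, h₁, real_inner_self_eq_norm_sq]
      have := mul_le_mul_of_nonneg_left h₂ (norm_nonneg (p i - p k))
      nlinarith
    · have h₁ := hbd i
      have h₂ := boundary_level_pos hint k i
      have h₃ : inner ℝ (W.normal i) o = levelOf W p k (.boundary i) := hi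
      show inner ℝ (W.normal i) _ ≤ 0
      rw [inner_sub_right, inner_smul_right, h₃]
      linarith

/-- With no bisector through `o`, only sides of the world are tight. Moving towards another point
`z` of side `i` stays on its line and violates none of them, as `z` is in the world. -/
theorem boundary_mem_edgeLabels {i : Fin m} {o : Plane}
    (ho : o ∈ cellFace W p k (.boundary i)) (hno : ∀ j, o ∉ cellFace W p k (.bisector j)) :
    .boundary i ∈ edgeLabels W p k := by
  obtain ⟨z, hz, hzo⟩ := (W.side_nontrivial i).exists_ne (p k + o)
  have key : ∀ i' (x : Plane), inner ℝ (W.normal i') (x - p k)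
      = inner ℝ (W.normal i') x - inner ℝ (W.normal i') (p k) := fun _ _ => inner_sub_right _ _ _
  obtain ⟨ε, hε, hmem⟩ := exists_add_smul_mem_polyhedron (d := z - p k - o) ho.1 (by
    rintro (j | i') hL
    · exact absurd ⟨ho.1, hL⟩ (hno j)
    · have h₁ : inner ℝ (W.normal i') o = W.offset i' - inner ℝ (W.normal i') (p k) := hL
      have h₂ : inner ℝ (W.normal i') z ≤ W.offset i' := hz.1 i'
      show inner ℝ (W.normal i') (z - p k - o) ≤ 0
      rw [inner_sub_right, inner_sub_right, h₁]
      linarith)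
  refine ⟨o, ho, o + ε • (z - p k - o), ⟨hmem, ?_⟩, fun h => ?_⟩
  · rw [inner_add_right, inner_smul_right, ho.2]
    have h₁ : inner ℝ (W.normal i) o = W.offset i - inner ℝ (W.normal i) (p k) := ho.2
    have h₂ : inner ℝ (W.normal i) z = W.offset i := hz.2
    show _ + ε * inner ℝ (W.normal i) (z - p k - o) = _
    rw [inner_sub_right, inner_sub_right, h₁, h₂]
    ring
  · rw [left_eq_add, smul_eq_zero] at h
    refine hzo ?_
    have := h.resolve_left hε.ne'
    rw [sub_sub, sub_eq_zero] at this
    exact this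

/-- The parameter at which a ray meets the line of a side. -/
noncomputable def hitParam (W : ConvexPolygon m) (q θ : Plane) (i : Fin m) : ℝ :=
  (W.offset i - inner ℝ (W.normal i) q) / inner ℝ (W.normal i) θ

/-- `best` is the first hit among the sides that have been seen. -/
def IsFirstHit (W : ConvexPolygon m) (q θ : Plane) (seen : List (Fin m)) :
    Option (ℝ × Fin m) → Prop
  | none => ∀ i ∈ seen, inner ℝ (W.normal i) θ ≤ 0
  | some (t, i) => 0 < inner ℝ (W.normal i) θ ∧ t = hitParam W q θ i ∧
      ∀ i' ∈ seen, 0 < inner ℝ (W.normal i') θ → t ≤ hitParam W q θ i'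

theorem boundaryHit_spec (q θ : Plane) (is : List (Fin m)) :
    ∀ (seen : List (Fin m)) (best : Option (ℝ × Fin m)), IsFirstHit W q θ seen best →
      IsFirstHit W q θ (seen ++ is) (boundaryHit W q θ is best).val := by
  induction is with
  | nil => intro seen best h; simpa [boundaryHit] using h
  | cons i is ih =>
    intro seen best h
    have happ : seen ++ i :: is = (seen ++ [i]) ++ is := by simp
    rw [happ]
    by_cases hd : 0 < inner ℝ (W.normal i) θ
    · cases best with
      | none =>
        have hval : (boundaryHit W q θ (i :: is) none).val
            = (boundaryHit W q θ is (some (hitParam W q θ i, i))).val := by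
          simp [boundaryHit, hd, hitParam]
        rw [hval]
        refine ih _ _ ⟨hd, rfl, fun i' hi' hpos => ?_⟩
        rcases List.mem_append.1 hi' with h' | h'
        · exact absurd hpos (not_lt.2 (h i' h'))
        · rw [List.mem_singleton.1 h']
      | some b =>
        obtain ⟨t₀, i₀⟩ := b
        by_cases ht : hitParam W q θ i < t₀
        · have hval : (boundaryHit W q θ (i :: is) (some (t₀, i₀))).val
              = (boundaryHit W q θ is (some (hitParam W q θ i, i))).val := by
            rw [hitParam] at ht
            simp [boundaryHit, hd, hitParam, ht]
          rw [hval]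
          refine ih _ _ ⟨hd, rfl, fun i' hi' hpos => ?_⟩
          rcases List.mem_append.1 hi' with h' | h'
          · exact ht.le.trans (h.2.2 i' h' hpos)
          · rw [List.mem_singleton.1 h']
        · have hval : (boundaryHit W q θ (i :: is) (some (t₀, i₀))).val
              = (boundaryHit W q θ is (some (t₀, i₀))).val := by
            rw [hitParam] at ht
            simp [boundaryHit, hd, ht]
          rw [hval]
          refine ih _ _ ⟨h.1, h.2.1, fun i' hi' hpos => ?_⟩
          rcases List.mem_append.1 hi' with h' | h'
          · exact h.2.2 i' h' hpos
          · rw [List.mem_singleton.1 h']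
            exact not_lt.1 ht
    · have hval : (boundaryHit W q θ (i :: is) best).val = (boundaryHit W q θ is best).val := by
        simp [boundaryHit, hd]
      rw [hval]
      refine ih _ _ ?_
      cases best with
      | none =>
        intro i' hi'
        rcases List.mem_append.1 hi' with h' | h'
        · exact h i' h'
        · rw [List.mem_singleton.1 h']
          exact not_lt.1 hd
      | some b =>
        refine ⟨h.1, h.2.1, fun i' hi' hpos => ?_⟩
        rcases List.mem_append.1 hi' with h' | h'
        · exact h.2.2 i' h' hpos
        · rw [List.mem_singleton.1 h'] at hpos
          exact absurd hpos hd

theorem exists_boundaryHit (hint : ∀ k, p k ∈ interior W.carrier) (k : Fin n) {θ : Plane}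
    (hθ : θ ≠ 0) : ∃ t i, (boundaryHit W (p k) θ (List.finRange m) none).val = some (t, i) ∧
      0 < t ∧ inner ℝ (W.normal i) (t • θ) = levelOf W p k (.boundary i) ∧
      ∀ i', inner ℝ (W.normal i') (t • θ) ≤ levelOf W p k (.boundary i') := by
  have hspec := boundaryHit_spec (W := W) (p k) θ (List.finRange m) [] none (by simp [IsFirstHit])
  have hpos := boundary_level_pos hint k
  have hcomp : IsCompact (polyhedron W.normal fun i => levelOf W p k (.boundary i)) := by
    have h : IsCompact ((fun x : Plane => x - p k) '' W.carrier) := W.compact.image (by fun_prop)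
    refine h.of_isClosed_subset isClosed_polyhedron fun x hx => ⟨p k + x, fun i => ?_, by simp⟩
    have := hx i
    rw [← inner_normal_sub _ _ (p k), add_sub_cancel_left]
    exact this
  obtain ⟨i₁, hi₁⟩ := exists_inner_pos_of_isCompact hpos hcomp hθ
  cases hb : (boundaryHit W (p k) θ (List.finRange m) none).val with
  | none =>
    rw [hb] at hspec
    exact absurd hi₁ (not_lt.2 (hspec i₁ (by simp)))
  | some b =>
    obtain ⟨t, i⟩ := b
    rw [hb] at hspec
    obtain ⟨hi, ht, hmin⟩ := hspec
    have ht' : t * inner ℝ (W.normal i) θ = levelOf W p k (.boundary i) := by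
      rw [ht, hitParam, div_mul_cancel₀ _ hi.ne']
      rfl
    have ht₀ : 0 < t := pos_of_mul_pos_left (ht' ▸ hpos i) hi.le
    refine ⟨t, i, rfl, ht₀, by rw [inner_smul_right, ht'], fun i' => ?_⟩
    rw [inner_smul_right]
    by_cases hi' : 0 < inner ℝ (W.normal i') θ
    · exact (le_div_iff₀ hi').1 (hmin i' (by simp) hi')
    · exact (mul_nonpos_of_nonneg_of_nonpos ht₀.le (not_lt.1 hi')).trans (hpos i').le

/-- The state of the ray after the sites in `seen`: starting from `t₀`, its current parameter is
`t`, and `nb` is a nearest one of the equidistant sites. -/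
structure IsShortened (p : Fin n → Plane) (k : Fin n) (θ : Plane) (t₀ : ℝ) (seen : List (Fin n))
    (t : ℝ) (nb : Option (Fin n)) : Prop where
  pos : 0 < t
  le : t ≤ t₀
  feasible : ∀ j ∈ seen, inner ℝ (p j - p k) (t • θ) ≤ inner ℝ (p j - p k) (p j - p k) / 2
  of_none : nb = none → t = t₀ ∧ ∀ j ∈ seen, j ≠ k →
    inner ℝ (p j - p k) (t • θ) ≠ inner ℝ (p j - p k) (p j - p k) / 2
  of_some : ∀ i, nb = some i → i ≠ k ∧
    inner ℝ (p i - p k) (t • θ) = inner ℝ (p i - p k) (p i - p k) / 2 ∧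
    ∀ j ∈ seen, j ≠ k → inner ℝ (p j - p k) (t • θ) = inner ℝ (p j - p k) (p j - p k) / 2 →
      dist (p i) (p k) ≤ dist (p j) (p k)

theorem shorten_spec (hp : Function.Injective p) (θ : Plane) (t₀ : ℝ) (js : List (Fin n)) :
    ∀ (seen : List (Fin n)) (t : ℝ) (nb : Option (Fin n)), IsShortened p k θ t₀ seen t nb →
      IsShortened p k θ t₀ (seen ++ js) (shorten p k θ js t nb).val.1
        (shorten p k θ js t nb).val.2 := by
  induction js with
  | nil => intro seen t nb h; simpa [shorten] using h
  | cons j js ih =>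
    intro seen t nb h
    have happ : seen ++ j :: js = (seen ++ [j]) ++ js := by simp
    rw [happ]
    have hpos : ∀ {i}, i ≠ k → 0 < inner ℝ (p i - p k) (p i - p k) := fun hi =>
      real_inner_self_pos.2 (sub_ne_zero.2 fun h => hi (hp h))
    have hsub : p k + t • θ - p k = t • θ := add_sub_cancel_left _ _
    rcases hc : cmp (dist (p k + t • θ) (p j)) (dist (p k + t • θ) (p k)) with _ | _ | _
    · have hlt := (dist_lt_iff _ _ _).1 ((cmp_eq_lt_iff _ _).1 hc)
      rw [hsub] at hlt
      have hjk : j ≠ k := by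
        rintro rfl
        simp at hlt
      have hval : (shorten p k θ (j :: js) t nb).val
          = (shorten p k θ js (inner ℝ (p j - p k) (p j - p k) / (2 * inner ℝ (p j - p k) θ))
            (some j)).val := by
        simp only [shorten, Timed.bind_val, op_val, compareDist_val, hc]
      rw [hval]
      have hA := hpos hjk
      rw [inner_smul_right] at hlt
      have hb : 0 < inner ℝ (p j - p k) θ := by
        refine pos_of_mul_pos_right (lt_trans ?_ hlt) h.pos.le
        linarith
      set t' := inner ℝ (p j - p k) (p j - p k) / (2 * inner ℝ (p j - p k) θ) with ht'
      have htt : t' < t := by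
        rw [ht', div_lt_iff₀ (by positivity)]
        linarith
      have ht'₀ : 0 < t' := by positivity
      have htight : inner ℝ (p j - p k) (t' • θ) = inner ℝ (p j - p k) (p j - p k) / 2 := by
        rw [inner_smul_right, ht']
        field_simp
      -- Once the ray is shortened, every site seen before satisfies its inequality strictly. So the
      -- search for a nearest equidistant site may restart with `j` alone, forgetting the old
      -- neighbor.
      have hstrict : ∀ i ∈ seen, i ≠ k →
          inner ℝ (p i - p k) (t' • θ) < inner ℝ (p i - p k) (p i - p k) / 2 := by
        intro i hi hik
        have h₁ := h.feasible i hi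
        rw [inner_smul_right] at h₁ ⊢
        rcases lt_or_ge 0 (inner ℝ (p i - p k) θ) with h₂ | h₂
        · exact (mul_lt_mul_of_pos_right htt h₂).trans_le h₁
        · have := mul_nonpos_of_nonneg_of_nonpos ht'₀.le h₂
          linarith [hpos hik]
      refine ih _ _ _ ⟨ht'₀, htt.le.trans h.le, fun i hi => ?_, by simp, ?_⟩
      · rcases List.mem_append.1 hi with hi | hi
        · by_cases hik : i = k
          · rw [hik]; simp
          · exact (hstrict i hi hik).le
        · rw [List.mem_singleton.1 hi, htight]
      · rintro i hi
        obtain rfl : j = i := by simpa using hi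
        refine ⟨hjk, htight, fun i hi hik heq => ?_⟩
        rcases List.mem_append.1 hi with hi | hi
        · exact absurd heq (hstrict i hi hik).ne
        · rw [List.mem_singleton.1 hi]
    · have heq := (dist_eq_iff _ _ _).1 ((cmp_eq_eq_iff _ _).1 hc)
      rw [hsub] at heq
      have hval : (shorten p k θ (j :: js) t nb).val
          = (shorten p k θ js t (nearer p k j nb).val).val := by
        simp only [shorten, Timed.bind_val, op_val, compareDist_val, hc]
      rw [hval]
      refine ih _ _ _ ?_
      have hfeas : ∀ i ∈ seen ++ [j],
          inner ℝ (p i - p k) (t • θ) ≤ inner ℝ (p i - p k) (p i - p k) / 2 := by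
        intro i hi
        rcases List.mem_append.1 hi with hi | hi
        · exact h.feasible i hi
        · rw [List.mem_singleton.1 hi, heq]
      by_cases hjk : j = k
      · have hnb : (nearer p k j nb).val = nb := by simp [nearer, hjk]
        rw [hnb]
        refine ⟨h.pos, h.le, hfeas, fun hn => ⟨(h.of_none hn).1, fun i hi hik => ?_⟩,
          fun i hi => ⟨(h.of_some i hi).1, (h.of_some i hi).2.1, fun i' hi' hik' => ?_⟩⟩
        · rcases List.mem_append.1 hi with hi | hi
          · exact (h.of_none hn).2 i hi hik
          · exact absurd ((List.mem_singleton.1 hi).trans hjk) hik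
        · rcases List.mem_append.1 hi' with hi' | hi'
          · exact (h.of_some i hi).2.2 i' hi' hik'
          · exact absurd ((List.mem_singleton.1 hi').trans hjk) hik'
      · cases nb with
        | none =>
          have hnb : (nearer p k j none).val = some j := by simp [nearer, hjk]
          rw [hnb]
          refine ⟨h.pos, h.le, hfeas, by simp, ?_⟩
          rintro i hi
          obtain rfl : j = i := by simpa using hi
          refine ⟨hjk, heq, fun i hi hik hti => ?_⟩
          rcases List.mem_append.1 hi with hi | hi
          · exact absurd hti ((h.of_none rfl).2 i hi hik)
          · rw [List.mem_singleton.1 hi]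
        | some i₀ =>
          have hi₀ := h.of_some i₀ rfl
          by_cases hlt : dist (p j) (p k) < dist (p i₀) (p k)
          · have hnb : (nearer p k j (some i₀)).val = some j := by simp [nearer, hjk, hlt]
            rw [hnb]
            refine ⟨h.pos, h.le, hfeas, by simp, ?_⟩
            rintro i hi
            obtain rfl : j = i := by simpa using hi
            refine ⟨hjk, heq, fun i hi hik hti => ?_⟩
            rcases List.mem_append.1 hi with hi | hi
            · exact hlt.le.trans (hi₀.2.2 i hi hik hti)
            · rw [List.mem_singleton.1 hi]
          · have hnb : (nearer p k j (some i₀)).val = some i₀ := by simp [nearer, hjk, hlt]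
            rw [hnb]
            refine ⟨h.pos, h.le, hfeas, by simp, ?_⟩
            rintro i hi
            obtain rfl : i₀ = i := by simpa using hi
            refine ⟨hi₀.1, hi₀.2.1, fun i hi hik hti => ?_⟩
            rcases List.mem_append.1 hi with hi | hi
            · exact hi₀.2.2 i hi hik hti
            · rw [List.mem_singleton.1 hi]
              exact not_lt.1 hlt
    · have hgt := (cmp_eq_gt_iff _ _).1 hc
      have hlt : inner ℝ (p j - p k) (t • θ) < inner ℝ (p j - p k) (p j - p k) / 2 := by
        refine lt_of_le_of_ne ?_ fun h => ?_
        · have := (dist_le_iff (p k) (p j) (p k + t • θ)).1 hgt.le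
          rwa [hsub] at this
        · have := (dist_eq_iff (p k) (p j) (p k + t • θ)).2 (by rwa [hsub])
          exact hgt.ne this.symm
      have hval : (shorten p k θ (j :: js) t nb).val = (shorten p k θ js t nb).val := by
        simp only [shorten, Timed.bind_val, op_val, compareDist_val, hc]
      rw [hval]
      refine ih _ _ _ ⟨h.pos, h.le, fun i hi => ?_,
        fun hn => ⟨(h.of_none hn).1, fun i hi hik => ?_⟩,
        fun i hi => ⟨(h.of_some i hi).1, (h.of_some i hi).2.1, fun i' hi' hik' hti => ?_⟩⟩
      · rcases List.mem_append.1 hi with hi | hi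
        · exact h.feasible i hi
        · rw [List.mem_singleton.1 hi]
          exact hlt.le
      · rcases List.mem_append.1 hi with hi | hi
        · exact (h.of_none hn).2 i hi hik
        · rw [List.mem_singleton.1 hi]
          exact hlt.ne
      · rcases List.mem_append.1 hi' with hi' | hi'
        · exact (h.of_some i hi).2.2 i' hi' hik' hti
        · rw [List.mem_singleton.1 hi'] at hti
          exact absurd hti hlt.ne

theorem endpoint_eq (hp : Function.Injective p) (hint : ∀ k, p k ∈ interior W.carrier)
    {θ : Plane} {t : ℝ} (ht : 0 < t) {L : LineLabel n m} (hL : t • θ ∈ cellFace W p k L) :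
    endpoint W p k θ = p k + t • θ := by
  have S := isPolygonSystem hp hint k
  have hset : {s : ℝ | 0 ≤ s ∧ p k + s • θ ∈ cell W p k} = Set.Icc 0 t := by
    ext s
    simp only [Set.mem_ofPred_eq, Set.mem_Icc, add_mem_cell_iff]
    refine and_congr_right fun hs => ⟨fun h => S.le_of_mem_face hL ht h, fun h => ?_⟩
    have := smul_mem_polyhedron S.pos hL.1 (a := s / t) (by positivity) ((div_le_one ht).2 h)
    rwa [smul_smul, div_mul_cancel₀ _ ht.ne'] at this
  rw [endpoint, hset, csSup_Icc ht.le]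

/-- A bisector on which the endpoint of a ray is located belongs to a listed site. -/
theorem mem_scan_of_tight {scan : Scan n} (hp : Function.Injective p)
    (hint : ∀ k, p k ∈ interior W.carrier) (hscan : scan.Admissible W p) {θ : Plane}
    (hθ : ‖θ‖ = 1) {t : ℝ} (ht : 0 < t) {j : Fin n}
    (hj : t • θ ∈ cellFace W p k (.bisector j)) : j ∈ scan k θ := by
  have hjk : j ≠ k := fun h => ne_bisector_self hj (by rw [h])
  apply hscan k θ hθ j
  rw [endpoint_eq hp hint ht hj, dist_eq_iff, add_sub_cancel_left]
  exact hj.2.trans (levelOf_bisector hjk)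

/-- The true exit parameter `te` of the cell is compared with the computed `t`. Once they agree, the
invariant of `shorten` and admissibility show that the reported line is chosen correctly among all
lines through the endpoint. -/
theorem exists_shoot_val {scan : Scan n} (hp : Function.Injective p)
    (hint : ∀ k, p k ∈ interior W.carrier) (hscan : scan.Admissible W p) (k : Fin n) {θ : Plane}
    (hθ : ‖θ‖ = 1) :
    ∃ (T : Plane) (L : LineLabel n m), (shoot W p scan k θ).val = some ⟨T, L⟩ ∧
      (∃ t : ℝ, 0 < t ∧ T = t • θ) ∧ T ∈ cellFace W p k L ∧ L ∈ edgeLabels W p k := by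
  have hθ₀ : θ ≠ 0 := by rintro rfl; simp at hθ
  have S := isPolygonSystem hp hint k
  obtain ⟨t₀, i₀, hhit, ht₀, htight₀, hfeas₀⟩ := exists_boundaryHit hint k hθ₀
  obtain ⟨te, hte, Le, hLe⟩ := S.exists_smul_mem_face hθ₀
  have hLe' : te • θ ∈ cellFace W p k Le := hLe
  have hsh := shorten_spec (k := k) hp θ t₀ (scan k θ) [] t₀ none
    ⟨ht₀, le_rfl, by simp, by simp, by simp⟩
  rw [List.nil_append] at hsh
  obtain ⟨t, nb, hres⟩ : ∃ t nb, (shorten p k θ (scan k θ) t₀ none).val = (t, nb) := ⟨_, _, rfl⟩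
  rw [hres] at hsh
  simp only at hsh
  have hbound : ∀ {s : ℝ} {L : LineLabel n m}, inner ℝ (normalOf W p k L) (s • θ)
      ≤ levelOf W p k L → te • θ ∈ cellFace W p k L → s ≤ te := by
    intro s L hs hL
    have h₁ := hL.2
    have h₂ := S.pos L
    rw [inner_smul_right] at h₁ hs
    have hpos : 0 < inner ℝ (normalOf W p k L) θ := pos_of_mul_pos_right (h₁ ▸ h₂) hte.le
    rw [← h₁] at hs
    exact le_of_mul_le_mul_right hs hpos
  -- A line that stops the true ray is a side of the world, respected by the starting point, or the
  -- bisector of a listed site, by admissibility.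
  have hle : t ≤ te := by
    cases Le with
    | bisector j =>
      have hjk : j ≠ k := fun h => ne_bisector_self hLe' (by rw [h])
      refine hbound ?_ hLe'
      rw [levelOf_bisector hjk]
      exact hsh.feasible j (mem_scan_of_tight hp hint hscan hθ hte hLe')
    | boundary i => exact hsh.le.trans (hbound (L := .boundary i) (hfeas₀ i) hLe')
  -- The computed point is on a genuine line of the system, beyond which the cell cannot extend.
  have hge : te ≤ t := by
    cases nb with
    | none =>
      rw [(hsh.of_none rfl).1]
      have h₁ : inner ℝ (W.normal i₀) (te • θ) ≤ levelOf W p k (.boundary i₀) :=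
        hLe.1 (.boundary i₀)
      have h₂ := boundary_level_pos hint k i₀
      rw [← htight₀, inner_smul_right] at h₂
      rw [← htight₀, inner_smul_right, inner_smul_right] at h₁
      have hpos : 0 < inner ℝ (W.normal i₀) θ := pos_of_mul_pos_right h₂ ht₀.le
      exact le_of_mul_le_mul_right h₁ hpos
    | some i =>
      obtain ⟨hik, hti, -⟩ := hsh.of_some i rfl
      have h₁ := hLe.1 (.bisector i)
      rw [levelOf_bisector hik, ← hti, inner_smul_right, inner_smul_right] at h₁
      have hA : 0 < inner ℝ (p i - p k) (p i - p k) :=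
        real_inner_self_pos.2 (sub_ne_zero.2 fun h => hik (hp h))
      rw [inner_smul_right] at hti
      have hpos : 0 < inner ℝ (p i - p k) θ :=
        pos_of_mul_pos_right (by rw [hti]; linarith) hsh.pos.le
      exact le_of_mul_le_mul_right h₁ hpos
  obtain rfl : t = te := le_antisymm hle hge
  cases nb with
  | none =>
    have hmem : t • θ ∈ cellFace W p k (.boundary i₀) := by
      refine ⟨hLe.1, ?_⟩
      rw [(hsh.of_none rfl).1]
      exact htight₀
    refine ⟨t • θ, .boundary i₀, ?_, ⟨t, hte, rfl⟩, hmem, boundary_mem_edgeLabels hmem ?_⟩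
    · simp [shoot, hhit, hres]
    · intro j hj
      have hjk : j ≠ k := fun h => ne_bisector_self hj (by rw [h])
      exact (hsh.of_none rfl).2 j (mem_scan_of_tight hp hint hscan hθ hte hj) hjk
        (hj.2.trans (levelOf_bisector hjk))
  | some i =>
    obtain ⟨hik, hti, hmin⟩ := hsh.of_some i rfl
    have hmem : t • θ ∈ cellFace W p k (.bisector i) :=
      ⟨hLe.1, hti.trans (levelOf_bisector hik).symm⟩
    refine ⟨t • θ, .bisector i, ?_, ⟨t, hte, rfl⟩, hmem,
      bisector_mem_edgeLabels hp hint hmem ?_⟩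
    · simp [shoot, hhit, hres]
    · intro j hjk hj
      exact hmin j (mem_scan_of_tight hp hint hscan hθ hte hj) hjk
        (hj.2.trans (levelOf_bisector hjk))

/-! ### Testing a point -/

theorem insideWorld_val (u : Plane) (is : List (Fin m)) :
    (insideWorld W u is).val = true ↔ ∀ i ∈ is, inner ℝ (W.normal i) u ≤ W.offset i := by
  induction is with
  | nil => simp [insideWorld]
  | cons i is ih =>
    by_cases h : inner ℝ (W.normal i) u ≤ W.offset i
    · have hval : (insideWorld W u (i :: is)).val = (insideWorld W u is).val := by
        simp [insideWorld, h]
      rw [hval, ih]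
      simp [h]
    · have hval : (insideWorld W u (i :: is)).val = false := by simp [insideWorld, h]
      rw [hval]
      simp [h]

theorem closestSite_val (u : Plane) (js : List (Fin n)) :
    (closestSite p k u js).val = true ↔ ∀ j ∈ js, dist u (p k) ≤ dist u (p j) := by
  induction js with
  | nil => simp [closestSite]
  | cons j js ih =>
    rcases hc : cmp (dist u (p j)) (dist u (p k)) with _ | _ | _
    · have hval : (closestSite p k u (j :: js)).val = false := by simp [closestSite, hc]
      rw [hval]
      simp [(cmp_eq_lt_iff _ _).1 hc]
    · have hval : (closestSite p k u (j :: js)).val = (closestSite p k u js).val := by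
        simp [closestSite, hc]
      rw [hval, ih]
      simp [((cmp_eq_eq_iff _ _).1 hc).ge]
    · have hval : (closestSite p k u (j :: js)).val = (closestSite p k u js).val := by
        simp [closestSite, hc]
      rw [hval, ih]
      simp [((cmp_eq_gt_iff _ _).1 hc).le]

/-- The list of the ray through `u` suffices even though `u` need not be its endpoint: if `u` is
outside, the ray leaves the cell before `u`, and the line crossed there is violated at `u`.
Admissibility puts the corresponding site, if any, on the list. -/
theorem insideCell_val {scan : Scan n} (hp : Function.Injective p)
    (hint : ∀ k, p k ∈ interior W.carrier) (hscan : scan.Admissible W p) {u : Plane}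
    (hu : u ≠ 0) :
    (insideCell W p scan k (p k + u) (‖u‖⁻¹ • u)).val = true ↔ u ∈ centeredCell W p k := by
  have S := isPolygonSystem hp hint k
  have hnorm : 0 < ‖u‖ := norm_pos_iff.2 hu
  have hunit : ‖‖u‖⁻¹ • u‖ = 1 := by
    rw [norm_smul, norm_inv, norm_norm, inv_mul_cancel₀ hnorm.ne']
  have hval : (insideCell W p scan k (p k + u) (‖u‖⁻¹ • u)).val = true ↔
      p k + u ∈ W.carrier ∧ ∀ j ∈ scan k (‖u‖⁻¹ • u), dist (p k + u) (p k) ≤ dist (p k + u) (p j) := by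
    rw [← closestSite_val]
    by_cases h : (insideWorld W (p k + u) (List.finRange m)).val = true
    · have h' : p k + u ∈ W.carrier := fun i => (insideWorld_val _ _).1 h i (by simp)
      simp [insideCell, h, h']
    · have h' : p k + u ∉ W.carrier := fun h' => h ((insideWorld_val _ _).2 fun i _ => h' i)
      simp [insideCell, h, h']
  rw [hval, ← add_mem_cell_iff]
  refine ⟨fun ⟨h₁, h₂⟩ => ?_, fun h => ⟨h.1, fun j _ => ?_⟩⟩
  · by_contra hcon
    rw [add_mem_cell_iff] at hcon
    obtain ⟨t, ht, L, hL⟩ := S.exists_smul_mem_face (θ := ‖u‖⁻¹ • u) (by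
      intro h; rw [h, norm_zero] at hunit; exact zero_ne_one hunit)
    have hL' : t • ‖u‖⁻¹ • u ∈ cellFace W p k L := hL
    have hu' : u = ‖u‖ • ‖u‖⁻¹ • u := by rw [smul_smul, mul_inv_cancel₀ hnorm.ne', one_smul]
    have hlt : t < ‖u‖ := by
      by_contra hge
      apply hcon
      have := smul_mem_polyhedron S.pos hL.1 (a := ‖u‖ / t) (by positivity)
        ((div_le_one ht).2 (not_lt.1 hge))
      rw [smul_smul, div_mul_cancel₀ _ ht.ne', ← hu'] at this
      exact this
    have hgt : levelOf W p k L < inner ℝ (normalOf W p k L) u := by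
      have h₃ := hL.2
      have h₄ := S.pos L
      rw [hu', inner_smul_right]
      rw [inner_smul_right] at h₃
      have hpos : 0 < inner ℝ (normalOf W p k L) (‖u‖⁻¹ • u) :=
        pos_of_mul_pos_right (h₃ ▸ h₄) ht.le
      rw [← h₃]
      exact mul_lt_mul_of_pos_right hlt hpos
    cases L with
    | bisector j =>
      have hjk : j ≠ k := fun h => ne_bisector_self hL' (by rw [h])
      have := h₂ j (mem_scan_of_tight hp hint hscan hunit ht hL')
      rw [dist_le_iff, add_sub_cancel_left] at this
      rw [levelOf_bisector hjk] at hgt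
      exact absurd hgt (not_lt.2 this)
    | boundary i =>
      have := (inner_normal_sub _ _ (p k) _).2 (h₁ i)
      rw [add_sub_cancel_left] at this
      exact absurd hgt (not_lt.2 this)
  · by_cases hjk : j = k
    · rw [hjk]
    · exact h.2 j hjk

end Shoot

end RayVoronoi

namespace RayVoronoi

/-! ### The treatment of a subface -/

section Treat

variable {m n : ℕ} {W : ConvexPolygon m} {p : Fin n → Plane} {k : Fin n} {scan : Scan n}
  {T : Plane → Plane} {l : Plane → LineLabel n m}

theorem op_bind_val {α β : Type} (a : α) (f : α → Timed β) : (op a >>= f).val = (f a).val := rfl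

theorem test_bind_val {β : Type} (P : Prop) [Decidable P] (f : Bool → Timed β) :
    (test P >>= f).val = (f (decide P)).val := rfl

theorem alongRay_bind_val {α β : Type} (x : Timed α) (f : α → Timed β) :
    (alongRay x >>= f).val = (f x.val).val := rfl

theorem unitVector_bind_val {β : Type} (v : Plane) (f : Plane → Timed β) :
    (unitVector v >>= f).val = (f (‖v‖⁻¹ • v)).val := rfl

theorem insideCone_bind_val {β : Type} (θ₁ θ₂ φ : Plane) (f : Bool → Timed β) :
    (insideCone θ₁ θ₂ φ >>= f).val = (f (insideCone θ₁ θ₂ φ).val).val := rfl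

theorem lineNormal_bind_val {β : Type} (L : LineLabel n m) (f : Plane → Timed β) :
    (lineNormal W p k L >>= f).val = (f (normalOf W p k L)).val := by
  cases L <;> rfl

theorem insideCone_val (θ₁ θ₂ φ : Plane) :
    (insideCone θ₁ θ₂ φ).val = (decide (0 ≤ det₂ φ θ₂ / det₂ θ₁ θ₂)
      && decide (0 ≤ det₂ θ₁ φ / det₂ θ₁ θ₂)) := rfl

theorem cramer {θ₁ θ₂ : Plane} (h : det₂ θ₁ θ₂ ≠ 0) (φ : Plane) :
    φ = (det₂ φ θ₂ / det₂ θ₁ θ₂) • θ₁ + (det₂ θ₁ φ / det₂ θ₁ θ₂) • θ₂ := by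
  have e : ∀ i, φ i * det₂ θ₁ θ₂ = det₂ φ θ₂ * θ₁ i + det₂ θ₁ φ * θ₂ i := by
    intro i
    fin_cases i <;> simp [det₂] <;> ring
  apply plane_ext
  · have := e 0
    simp only [PiLp.add_apply, PiLp.smul_apply, smul_eq_mul]
    field_simp
    linarith
  · have := e 1
    simp only [PiLp.add_apply, PiLp.smul_apply, smul_eq_mul]
    field_simp
    linarith

theorem norm_unit {v : Plane} (hv : v ≠ 0) : ‖‖v‖⁻¹ • v‖ = 1 := by
  rw [norm_smul, norm_inv, norm_norm, inv_mul_cancel₀ (norm_ne_zero_iff.2 hv)]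

/-- What can happen when a subface is treated. -/
inductive TreatResult (W : ConvexPolygon m) (p : Fin n → Plane) (k : Fin n) (T : Plane → Plane)
    (l : Plane → LineLabel n m) (θ₁ θ₂ : Plane) : Action n m → Prop
  | done (h₁ : T θ₁ ∈ cellFace W p k (l θ₂)) (h₂ : T θ₂ ∈ cellFace W p k (l θ₁)) :
      TreatResult W p k T l θ₁ θ₂ .done
  | split {θ₃ : Plane} (h : IsSplit (normalOf W p k) (levelOf W p k) T l θ₁ θ₂ θ₃) :
      TreatResult W p k T l θ₁ θ₂ (.split θ₃)
  | store {u : Plane} {a b : ℝ} (ha : 0 ≤ a) (hb : 0 ≤ b) (hu : u = a • T θ₁ + b • T θ₂)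
      (h₁ : u ∈ cellFace W p k (l θ₁)) (h₂ : u ∈ cellFace W p k (l θ₂)) (hne : l θ₁ ≠ l θ₂) :
      TreatResult W p k T l θ₁ θ₂ (.store ⟨p k + u, l θ₁, l θ₂⟩)

/-- Reduces each splitting case to two checks: `v` is strictly inside the angle, and no positive
multiple of `v` is on either known edge. -/
theorem isSplit_of_not_tight {ι : Type*} {N : ι → Plane} {c : ι → ℝ} {l : Plane → ι}
    {θ₁ θ₂ v : Plane} (S : IsRayShooting N c T l) (hv : v ≠ 0) (hmem : v ∈ openCone θ₁ θ₂)
    (h₁ : ∀ t : ℝ, 0 < t → t • v ∉ face N c (l θ₁))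
    (h₂ : ∀ t : ℝ, 0 < t → t • v ∉ face N c (l θ₂)) :
    IsSplit N c T l θ₁ θ₂ (‖v‖⁻¹ • v) := by
  have hn : 0 < ‖v‖⁻¹ := inv_pos.2 (norm_pos_iff.2 hv)
  obtain ⟨t, ht, hT⟩ := S.ray _ (norm_unit hv)
  rw [smul_smul] at hT
  refine ⟨norm_unit hv, ?_, ?_, ?_⟩
  · obtain ⟨a, b, ha, hb, h⟩ := hmem
    exact ⟨‖v‖⁻¹ * a, ‖v‖⁻¹ * b, by positivity, by positivity, by
      rw [← smul_smul, ← smul_smul, ← smul_add, ← h]⟩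
  · rw [hT]; exact h₁ _ (by positivity)
  · rw [hT]; exact h₂ _ (by positivity)

/-- By `det₂_mul_det₂` the matrix has determinant `det₂ N₁ N₂ * det₂ T₁ T₂`, so a zero determinant
means parallel normals. Distinct parallel lines are on opposite sides of the origin, and exactly one
of the two directions parallel to them is inside the angle; its ray never meets them. -/
theorem treat_parallel {ι : Type*} {N : ι → Plane} {c : ι → ℝ} {l : Plane → ι} {θ₁ θ₂ : Plane}
    (S : IsRayShooting N c T l) (u₁ : ‖θ₁‖ = 1) (u₂ : ‖θ₂‖ = 1) (hdet : det₂ θ₁ θ₂ ≠ 0)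
    (hD : inner ℝ (N (l θ₁)) (T θ₁) * inner ℝ (N (l θ₂)) (T θ₂)
      - inner ℝ (N (l θ₁)) (T θ₂) * inner ℝ (N (l θ₂)) (T θ₁) = 0) :
    (inner ℝ (N (l θ₁)) (T θ₂) = inner ℝ (N (l θ₁)) (T θ₁) →
      T θ₁ ∈ face N c (l θ₂) ∧ T θ₂ ∈ face N c (l θ₁)) ∧
    (inner ℝ (N (l θ₁)) (T θ₂) ≠ inner ℝ (N (l θ₁)) (T θ₁) → ∀ w, w = rot (N (l θ₁)) →
      ((insideCone θ₁ θ₂ (‖w‖⁻¹ • w)).val = true → IsSplit N c T l θ₁ θ₂ (‖w‖⁻¹ • w)) ∧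
      ((insideCone θ₁ θ₂ (‖w‖⁻¹ • w)).val ≠ true → IsSplit N c T l θ₁ θ₂ (-(‖w‖⁻¹ • w)))) := by
  have m₁ := S.mem θ₁ u₁
  have m₂ := S.mem θ₂ u₂
  obtain ⟨s, hs, e₁⟩ := S.ray θ₁ u₁
  obtain ⟨t, ht, e₂⟩ := S.ray θ₂ u₂
  have c₁ := S.pos (l θ₁)
  have c₂ := S.pos (l θ₂)
  have n₁ := S.normal_ne_zero m₁
  obtain ⟨r, hr⟩ : ∃ r : ℝ, N (l θ₂) = r • N (l θ₁) := by
    apply exists_smul_of_det₂_eq_zero n₁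
    rw [← det₂_mul_det₂, e₁, e₂, det₂_smul_right, det₂_smul_left] at hD
    have : t * (s * det₂ θ₁ θ₂) ≠ 0 := by
      have := mul_ne_zero hs.ne' hdet
      exact mul_ne_zero ht.ne' this
    exact (mul_eq_zero.1 hD).resolve_right this
  have h₂₂ : r * inner ℝ (N (l θ₁)) (T θ₂) = c (l θ₂) := by
    rw [← real_inner_smul_left, ← hr, m₂.2]
  have h₂₁ : inner ℝ (N (l θ₂)) (T θ₁) = r * c (l θ₁) := by
    rw [hr, real_inner_smul_left, m₁.2]
  constructor
  · intro h
    rw [m₁.2] at h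
    refine ⟨⟨m₁.1, ?_⟩, m₂.1, h⟩
    rw [h₂₁, ← h₂₂, h]
  · rintro h w rfl
    rw [m₁.2] at h
    have hlt : inner ℝ (N (l θ₁)) (T θ₂) < c (l θ₁) := lt_of_le_of_ne (m₂.1 _) h
    have hle : r * c (l θ₁) ≤ c (l θ₂) := h₂₁ ▸ m₁.1 (l θ₂)
    -- Parallel lines on the same side of the origin would have to coincide, since each endpoint
    -- satisfies the inequality of the other line.
    have hr₀ : r ≤ 0 := by
      by_contra hcon
      have := mul_lt_mul_of_pos_left hlt (not_le.1 hcon)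
      linarith
    have hneg : inner ℝ (N (l θ₁)) (T θ₂) < 0 := by
      by_contra hcon
      have := mul_nonpos_of_nonpos_of_nonneg hr₀ (not_lt.1 hcon)
      linarith
    have p₁ : 0 < inner ℝ (N (l θ₁)) θ₁ := by
      have := m₁.2
      rw [e₁, inner_smul_right] at this
      exact pos_of_mul_pos_right (this ▸ c₁) hs.le
    have p₂ : inner ℝ (N (l θ₁)) θ₂ < 0 := by
      rw [e₂, inner_smul_right] at hneg
      by_contra hcon
      have := mul_nonneg ht.le (not_lt.1 hcon)
      linarith
    have hw₀ : rot (N (l θ₁)) ≠ 0 := rot_ne_zero n₁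
    have hwu : ‖‖rot (N (l θ₁))‖⁻¹ • rot (N (l θ₁))‖ = 1 := norm_unit hw₀
    have hperp : inner ℝ (N (l θ₁)) (‖rot (N (l θ₁))‖⁻¹ • rot (N (l θ₁))) = 0 := by
      rw [inner_smul_right, inner_rot_self, mul_zero]
    generalize ‖rot (N (l θ₁))‖⁻¹ • rot (N (l θ₁)) = φ at hwu hperp
    have hφ₀ : φ ≠ 0 := by rintro rfl; simp at hwu
    have hcr := cramer hdet φ
    rw [insideCone_val]
    generalize det₂ φ θ₂ / det₂ θ₁ θ₂ = α₁ at hcr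
    generalize det₂ θ₁ φ / det₂ θ₁ θ₂ = α₂ at hcr
    have hrel : α₁ * inner ℝ (N (l θ₁)) θ₁ + α₂ * inner ℝ (N (l θ₁)) θ₂ = 0 := by
      rw [hcr, inner_add_right, inner_smul_right, inner_smul_right] at hperp
      exact hperp
    have nottight : ∀ (ψ : Plane), inner ℝ (N (l θ₁)) ψ = 0 → ∀ i, i = l θ₁ ∨ i = l θ₂ →
        ∀ t : ℝ, 0 < t → t • ψ ∉ face N c i := by
      intro ψ hψ i hi t _ hmem
      have h₁ := hmem.2
      have h₂ := S.pos i
      rw [inner_smul_right] at h₁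
      rcases hi with rfl | rfl
      · rw [hψ, mul_zero] at h₁
        exact h₂.ne h₁
      · rw [hr, real_inner_smul_left, hψ, mul_zero, mul_zero] at h₁
        exact h₂.ne h₁
    have unit_eq : ∀ ψ : Plane, ‖ψ‖ = 1 → ‖ψ‖⁻¹ • ψ = ψ := fun ψ h => by rw [h]; simp
    -- `⟪N₁, θ₁⟫ > 0 > ⟪N₁, θ₂⟫` and `⟪N₁, φ⟫ = 0` force the coefficients of `φ` to have the same
    -- strict sign, so testing them with `≤` is enough.
    have signs : (0 < α₁ ∧ 0 < α₂) ∨ (α₁ < 0 ∧ α₂ < 0) := by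
      rcases lt_trichotomy α₁ 0 with h₁ | h₁ | h₁
      · refine Or.inr ⟨h₁, ?_⟩
        by_contra hcon
        have := mul_neg_of_neg_of_pos h₁ p₁
        have := mul_nonpos_of_nonneg_of_nonpos (not_lt.1 hcon) p₂.le
        linarith
      · rw [h₁, zero_mul, zero_add] at hrel
        have h₂ := (mul_eq_zero.1 hrel).resolve_right p₂.ne
        rw [h₁, h₂, zero_smul, zero_smul, add_zero] at hcr
        exact absurd hcr hφ₀
      · refine Or.inl ⟨h₁, ?_⟩
        by_contra hcon
        have := mul_pos h₁ p₁
        have := mul_nonneg_of_nonpos_of_nonpos (not_lt.1 hcon) p₂.le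
        linarith
    rcases signs with ⟨s₁, s₂⟩ | ⟨s₁, s₂⟩
    · refine ⟨fun _ => ?_, fun hf => absurd (by simp [s₁.le, s₂.le]) hf⟩
      rw [← unit_eq φ hwu]
      exact isSplit_of_not_tight S hφ₀ ⟨α₁, α₂, s₁, s₂, hcr⟩
        (nottight φ hperp _ (Or.inl rfl)) (nottight φ hperp _ (Or.inr rfl))
    · refine ⟨fun hf => ?_, fun _ => ?_⟩
      · simp [not_le.2 s₁] at hf
      · have hperp' : inner ℝ (N (l θ₁)) (-φ) = 0 := by rw [inner_neg_right, hperp, neg_zero]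
        rw [← unit_eq (-φ) (by rw [norm_neg, hwu])]
        exact isSplit_of_not_tight S (neg_ne_zero.2 hφ₀)
          ⟨-α₁, -α₂, neg_pos.2 s₁, neg_pos.2 s₂, by
            rw [hcr, neg_smul, neg_smul, neg_add]⟩
          (nottight _ hperp' _ (Or.inl rfl)) (nottight _ hperp' _ (Or.inr rfl))

/-- `a` and `b` are the solution by Cramer's rule, so `u` is the intersection of the two lines. If
it is outside the polygon, the ray towards it meets both lines only at `u`. If the signs are wrong,
both coefficients are negative and the opposite ray meets neither line. -/
theorem treat_crossing {ι : Type*} {N : ι → Plane} {c : ι → ℝ} {l : Plane → ι} {θ₁ θ₂ : Plane}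
    (S : IsRayShooting N c T l) (u₁ : ‖θ₁‖ = 1) (u₂ : ‖θ₂‖ = 1)
    {D a b : ℝ} {u : Plane}
    (hD : D = inner ℝ (N (l θ₁)) (T θ₁) * inner ℝ (N (l θ₂)) (T θ₂)
      - inner ℝ (N (l θ₁)) (T θ₂) * inner ℝ (N (l θ₂)) (T θ₁))
    (hD₀ : D ≠ 0)
    (ha : a = (inner ℝ (N (l θ₁)) (T θ₁) * inner ℝ (N (l θ₂)) (T θ₂)
      - inner ℝ (N (l θ₁)) (T θ₂) * inner ℝ (N (l θ₂)) (T θ₂)) / D)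
    (hb : b = (inner ℝ (N (l θ₁)) (T θ₁) * inner ℝ (N (l θ₂)) (T θ₂)
      - inner ℝ (N (l θ₂)) (T θ₁) * inner ℝ (N (l θ₁)) (T θ₁)) / D)
    (hu : u = a • T θ₁ + b • T θ₂) :
    u ≠ 0 ∧ l θ₁ ≠ l θ₂ ∧
    inner ℝ (N (l θ₁)) u = c (l θ₁) ∧ inner ℝ (N (l θ₂)) u = c (l θ₂) ∧
    (0 ≤ a → 0 ≤ b → u ∉ polyhedron N c → IsSplit N c T l θ₁ θ₂ (‖u‖⁻¹ • u)) ∧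
    (¬ (0 ≤ a ∧ 0 ≤ b) → IsSplit N c T l θ₁ θ₂ (‖-u‖⁻¹ • -u)) := by
  have m₁ := S.mem θ₁ u₁
  have m₂ := S.mem θ₂ u₂
  obtain ⟨s, hs, e₁⟩ := S.ray θ₁ u₁
  obtain ⟨t, ht, e₂⟩ := S.ray θ₂ u₂
  have c₁ := S.pos (l θ₁)
  have c₂ := S.pos (l θ₂)
  have le₁ := m₂.1 (l θ₁)
  have le₂ := m₁.1 (l θ₂)
  have hu₁ : inner ℝ (N (l θ₁)) u = a * inner ℝ (N (l θ₁)) (T θ₁)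
      + b * inner ℝ (N (l θ₁)) (T θ₂) := by
    rw [hu, inner_add_right, inner_smul_right, inner_smul_right]
  have hu₂ : inner ℝ (N (l θ₂)) u = a * inner ℝ (N (l θ₂)) (T θ₁)
      + b * inner ℝ (N (l θ₂)) (T θ₂) := by
    rw [hu, inner_add_right, inner_smul_right, inner_smul_right]
  have hne : l θ₁ ≠ l θ₂ := by
    intro h
    rw [h] at hD
    exact hD₀ (by rw [hD]; ring)
  rw [m₁.2, m₂.2] at hD ha hb
  rw [m₁.2] at hu₁
  rw [m₂.2] at hu₂
  have t₁ : inner ℝ (N (l θ₁)) u = c (l θ₁) := by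
    rw [hu₁, ha, hb]
    field_simp
    rw [hD]
    ring
  have t₂ : inner ℝ (N (l θ₂)) u = c (l θ₂) := by
    rw [hu₂, ha, hb]
    field_simp
    rw [hD]
    ring
  have hu₀ : u ≠ 0 := by
    rintro rfl
    rw [inner_zero_right] at t₁
    exact c₁.ne t₁
  have hb_zero : b = 0 → a = 1 := by
    intro h
    rw [t₁, h, zero_mul, add_zero] at hu₁
    have : (a - 1) * c (l θ₁) = 0 := by linarith
    linarith [(mul_eq_zero.1 this).resolve_right c₁.ne']
  have ha_zero : a = 0 → b = 1 := by
    intro h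
    rw [t₂, h, zero_mul, zero_add] at hu₂
    have : (b - 1) * c (l θ₂) = 0 := by linarith
    linarith [(mul_eq_zero.1 this).resolve_right c₂.ne']
  refine ⟨hu₀, hne, t₁, t₂, fun ha₀ hb₀ hout => ?_, fun hneg => ?_⟩
  · have ha₁ : 0 < a := lt_of_le_of_ne ha₀ fun h => hout (by
      rw [hu, ← h, ha_zero h.symm]; simpa using m₂.1)
    have hb₁ : 0 < b := lt_of_le_of_ne hb₀ fun h => hout (by
      rw [hu, ← h, hb_zero h.symm]; simpa using m₁.1)
    have nottight : ∀ i, inner ℝ (N i) u = c i → ∀ r : ℝ, 0 < r → r • u ∉ face N c i := by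
      intro i hi r _ hmem
      have h₁ := hmem.2
      rw [inner_smul_right, hi] at h₁
      have hr : r = 1 := by
        have : (r - 1) * c i = 0 := by linarith
        linarith [(mul_eq_zero.1 this).resolve_right (S.pos i).ne']
      rw [hr, one_smul] at hmem
      exact hout hmem.1
    exact isSplit_of_not_tight S hu₀ ⟨a * s, b * t, by positivity, by positivity, by
      rw [hu, e₁, e₂, smul_smul, smul_smul]⟩ (nottight _ t₁) (nottight _ t₂)
  -- Both numerators are nonnegative because each endpoint satisfies the inequality of the other
  -- line. Hence the sign of `D` governs both coefficients, and mixed strict signs cannot occur.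
  · have ha_num : a = c (l θ₂) * (c (l θ₁) - inner ℝ (N (l θ₁)) (T θ₂)) / D := by
      rw [ha]; ring
    have hb_num : b = c (l θ₁) * (c (l θ₂) - inner ℝ (N (l θ₂)) (T θ₁)) / D := by
      rw [hb]; ring
    have hna : 0 ≤ c (l θ₂) * (c (l θ₁) - inner ℝ (N (l θ₁)) (T θ₂)) :=
      mul_nonneg c₂.le (sub_nonneg.2 le₁)
    have hnb : 0 ≤ c (l θ₁) * (c (l θ₂) - inner ℝ (N (l θ₂)) (T θ₁)) :=
      mul_nonneg c₁.le (sub_nonneg.2 le₂)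
    have hDneg : D < 0 := by
      by_contra hcon
      exact hneg ⟨ha_num ▸ div_nonneg hna (not_lt.1 hcon), hb_num ▸ div_nonneg hnb (not_lt.1 hcon)⟩
    have ha_le : a ≤ 0 := ha_num ▸ div_nonpos_of_nonneg_of_nonpos hna hDneg.le
    have hb_le : b ≤ 0 := hb_num ▸ div_nonpos_of_nonneg_of_nonpos hnb hDneg.le
    have ha₁ : a < 0 := lt_of_le_of_ne ha_le fun h => by linarith [ha_zero h]
    have hb₁ : b < 0 := lt_of_le_of_ne hb_le fun h => by linarith [hb_zero h]
    have nottight : ∀ i, inner ℝ (N i) u = c i → ∀ r : ℝ, 0 < r → r • -u ∉ face N c i := by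
      intro i hi r hr hmem
      have h₁ := hmem.2
      rw [inner_smul_right, inner_neg_right, hi] at h₁
      have := mul_pos hr (S.pos i)
      linarith [S.pos i]
    refine isSplit_of_not_tight S (neg_ne_zero.2 hu₀) ⟨-a * s, -b * t,
      mul_pos (neg_pos.2 ha₁) hs, mul_pos (neg_pos.2 hb₁) ht, ?_⟩ (nottight _ t₁) (nottight _ t₂)
    rw [hu, e₁, e₂]
    module

theorem treatResult (S : IsRayShooting (normalOf W p k) (levelOf W p k) T l)
    (hT : ∀ θ, ‖θ‖ = 1 → (shoot W p scan k θ).val = some ⟨T θ, l θ⟩)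
    (hin : ∀ u : Plane, u ≠ 0 →
      ((insideCell W p scan k (p k + u) (‖u‖⁻¹ • u)).val = true ↔ u ∈ centeredCell W p k))
    {θ₁ θ₂ : Plane} (u₁ : ‖θ₁‖ = 1) (u₂ : ‖θ₂‖ = 1) (hdet : det₂ θ₁ θ₂ ≠ 0) :
    TreatResult W p k T l θ₁ θ₂ (treat W p scan k θ₁ θ₂).val := by
  have h₁ := hT θ₁ u₁
  have h₂ := hT θ₂ u₂
  have m₁ := S.mem θ₁ u₁
  have m₂ := S.mem θ₂ u₂
  by_cases hD : inner ℝ (normalOf W p k (l θ₁)) (T θ₁) * inner ℝ (normalOf W p k (l θ₂)) (T θ₂)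
      - inner ℝ (normalOf W p k (l θ₁)) (T θ₂) * inner ℝ (normalOf W p k (l θ₂)) (T θ₁) = 0
  · obtain ⟨hsame, hdiff⟩ := treat_parallel S u₁ u₂ hdet hD
    by_cases hB : inner ℝ (normalOf W p k (l θ₁)) (T θ₂)
        = inner ℝ (normalOf W p k (l θ₁)) (T θ₁)
    · have hval : (treat W p scan k θ₁ θ₂).val = .done := by
        simp only [treat, alongRay_bind_val, h₁, h₂, op_bind_val, lineNormal_bind_val,
            test_bind_val, decide_eq_true_eq, Bool.and_eq_true, apply_ite Timed.val,
            insideCone_bind_val, unitVector_bind_val, Timed.pure_val, add_sub_cancel_left,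
            sub_add_cancel_left]
        rw [if_pos hD, if_pos hB]
      rw [hval]
      exact .done (hsame hB).1 (hsame hB).2
    · obtain ⟨hyes, hno⟩ := hdiff hB _ rfl
      by_cases hc : (insideCone θ₁ θ₂ (‖rot (normalOf W p k (l θ₁))‖⁻¹
          • rot (normalOf W p k (l θ₁)))).val = true
      · have hval : (treat W p scan k θ₁ θ₂).val
            = .split (‖rot (normalOf W p k (l θ₁))‖⁻¹ • rot (normalOf W p k (l θ₁))) := by
          rw [rot] at hc ⊢
          simp only [treat, alongRay_bind_val, h₁, h₂, op_bind_val, lineNormal_bind_val,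
            test_bind_val, decide_eq_true_eq, Bool.and_eq_true, apply_ite Timed.val,
            insideCone_bind_val, unitVector_bind_val, Timed.pure_val, add_sub_cancel_left,
            sub_add_cancel_left]
          rw [if_pos hD, if_neg hB, if_pos hc]
        rw [hval]
        exact .split (hyes hc)
      · have hval : (treat W p scan k θ₁ θ₂).val
            = .split (-(‖rot (normalOf W p k (l θ₁))‖⁻¹ • rot (normalOf W p k (l θ₁)))) := by
          rw [rot] at hc ⊢
          simp only [treat, alongRay_bind_val, h₁, h₂, op_bind_val, lineNormal_bind_val,
            test_bind_val, decide_eq_true_eq, Bool.and_eq_true, apply_ite Timed.val,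
            insideCone_bind_val, unitVector_bind_val, Timed.pure_val, add_sub_cancel_left,
            sub_add_cancel_left]
          rw [if_pos hD, if_neg hB, if_neg hc]
        rw [hval]
        exact .split (hno hc)
  · obtain ⟨hu₀, hne, t₁, t₂, hout, hneg⟩ := treat_crossing S u₁ u₂ rfl hD rfl rfl rfl
    generalize ha : (inner ℝ (normalOf W p k (l θ₁)) (T θ₁)
          * inner ℝ (normalOf W p k (l θ₂)) (T θ₂)
        - inner ℝ (normalOf W p k (l θ₁)) (T θ₂) * inner ℝ (normalOf W p k (l θ₂)) (T θ₂))
        / (inner ℝ (normalOf W p k (l θ₁)) (T θ₁) * inner ℝ (normalOf W p k (l θ₂)) (T θ₂)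
        - inner ℝ (normalOf W p k (l θ₁)) (T θ₂) * inner ℝ (normalOf W p k (l θ₂)) (T θ₁)) = a
      at hu₀ hne t₁ t₂ hout hneg
    generalize hb : (inner ℝ (normalOf W p k (l θ₁)) (T θ₁)
          * inner ℝ (normalOf W p k (l θ₂)) (T θ₂)
        - inner ℝ (normalOf W p k (l θ₂)) (T θ₁) * inner ℝ (normalOf W p k (l θ₁)) (T θ₁))
        / (inner ℝ (normalOf W p k (l θ₁)) (T θ₁) * inner ℝ (normalOf W p k (l θ₂)) (T θ₂)
        - inner ℝ (normalOf W p k (l θ₁)) (T θ₂) * inner ℝ (normalOf W p k (l θ₂)) (T θ₁)) = b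
      at hu₀ hne t₁ t₂ hout hneg
    by_cases hs : 0 ≤ a ∧ 0 ≤ b
    · by_cases hi : (insideCell W p scan k (p k + (a • T θ₁ + b • T θ₂))
          (‖a • T θ₁ + b • T θ₂‖⁻¹ • (a • T θ₁ + b • T θ₂))).val = true
      · have hval : (treat W p scan k θ₁ θ₂).val
            = .store ⟨p k + (a • T θ₁ + b • T θ₂), l θ₁, l θ₂⟩ := by
          simp only [treat, alongRay_bind_val, h₁, h₂, op_bind_val, lineNormal_bind_val,
            test_bind_val, decide_eq_true_eq, Bool.and_eq_true, apply_ite Timed.val,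
            insideCone_bind_val, unitVector_bind_val, Timed.pure_val, add_sub_cancel_left,
            sub_add_cancel_left]
          rw [if_neg hD, ha, hb, if_pos hs, if_pos hi]
        rw [hval]
        have hmem := (hin _ hu₀).1 hi
        exact .store hs.1 hs.2 rfl ⟨hmem, t₁⟩ ⟨hmem, t₂⟩ hne
      · have hval : (treat W p scan k θ₁ θ₂).val
            = .split (‖a • T θ₁ + b • T θ₂‖⁻¹ • (a • T θ₁ + b • T θ₂)) := by
          simp only [treat, alongRay_bind_val, h₁, h₂, op_bind_val, lineNormal_bind_val,
            test_bind_val, decide_eq_true_eq, Bool.and_eq_true, apply_ite Timed.val,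
            insideCone_bind_val, unitVector_bind_val, Timed.pure_val, add_sub_cancel_left,
            sub_add_cancel_left]
          rw [if_neg hD, ha, hb, if_pos hs, if_neg hi]
        rw [hval]
        exact .split (hout hs.1 hs.2 fun h => hi ((hin _ hu₀).2 h))
    · have hval : (treat W p scan k θ₁ θ₂).val
          = .split (‖-(a • T θ₁ + b • T θ₂)‖⁻¹ • -(a • T θ₁ + b • T θ₂)) := by
        simp only [treat, alongRay_bind_val, h₁, h₂, op_bind_val, lineNormal_bind_val,
            test_bind_val, decide_eq_true_eq, Bool.and_eq_true, apply_ite Timed.val,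
            insideCone_bind_val, unitVector_bind_val, Timed.pure_val, add_sub_cancel_left,
            sub_add_cancel_left]
        rw [if_neg hD, ha, hb, if_neg hs]
      rw [hval]
      exact .split (hneg hs)

end Treat

end RayVoronoi

namespace RayVoronoi

/-! ### Correctness of the main loop -/

section Loop

/-- Three vectors with sum zero span the plane in three angles. -/
theorem three_cones {x y z v : Plane} {D : ℝ} (hD : 0 < D) (hxy : det₂ x y = D)
    (hyz : det₂ y z = D) (hzx : det₂ z x = D) (hv : v ≠ 0) :
    (v ∈ openCone x y ∨ v ∈ openCone y z ∨ v ∈ openCone z x) ∨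
    (∃ r : ℝ, 0 < r ∧ v = r • x) ∨ (∃ r : ℝ, 0 < r ∧ v = r • y) ∨
    (∃ r : ℝ, 0 < r ∧ v = r • z) := by
  have cone : ∀ {x y : Plane}, det₂ x y = D → 0 < det₂ x v → det₂ y v < 0 →
      v ∈ openCone x y := by
    intro x y h h₁ h₂
    refine ⟨_, _, ?_, ?_, cramer (θ₁ := x) (θ₂ := y) (by rw [h]; exact hD.ne') v⟩
    · rw [h, det₂_comm]
      exact div_pos (neg_pos.2 h₂) hD
    · rw [h]
      exact div_pos h₁ hD
  have ray : ∀ {x y : Plane}, det₂ x y = D → det₂ x v = 0 → det₂ y v < 0 →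
      ∃ r : ℝ, 0 < r ∧ v = r • x := by
    intro x y h h₁ h₂
    have := cramer (θ₁ := x) (θ₂ := y) (by rw [h]; exact hD.ne') v
    rw [h₁, zero_div, zero_smul, add_zero] at this
    refine ⟨_, ?_, this⟩
    rw [h, det₂_comm]
    exact div_pos (neg_pos.2 h₂) hD
  -- Equal determinants force `x + y + z = 0`. So the three determinants with `v` sum to zero, and
  -- their signs locate `v`.
  have hsum : det₂ x v + det₂ y v + det₂ z v = 0 := by
    have hz : x + y + z = 0 := by
      have h₁ : det₂ x (x + y + z) = 0 := by
        rw [det₂_add_right, det₂_add_right, det₂_self, hxy, det₂_comm x z, hzx]; ring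
      have h₂ : det₂ y (x + y + z) = 0 := by
        rw [det₂_add_right, det₂_add_right, det₂_self, hyz, det₂_comm y x, hxy]; ring
      have := cramer (θ₁ := x) (θ₂ := y) (by rw [hxy]; exact hD.ne') (x + y + z)
      rw [det₂_comm _ y, h₁, h₂] at this
      simpa using this
    have h₃ : det₂ x v + det₂ y v + det₂ z v = -det₂ v (x + y + z) := by
      rw [det₂_add_right, det₂_add_right, det₂_comm x v, det₂_comm y v, det₂_comm z v]; ring
    rw [h₃, hz]
    simp [det₂]
  have hnz : det₂ x v = 0 → det₂ y v = 0 → False := by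
    intro h₁ h₂
    have := cramer (θ₁ := x) (θ₂ := y) (by rw [hxy]; exact hD.ne') v
    rw [det₂_comm v y, h₁, h₂] at this
    exact hv (by simpa using this)
  rcases lt_trichotomy (det₂ x v) 0 with a | a | a
  · rcases lt_or_ge 0 (det₂ z v) with c | c
    · exact Or.inl (Or.inr (Or.inr (cone hzx c a)))
    · rcases c.lt_or_eq with c | c
      · exact Or.inl (Or.inr (Or.inl (cone hyz (by linarith) c)))
      · exact Or.inr (Or.inr (Or.inr (ray hzx c a)))
  · rcases lt_trichotomy (det₂ y v) 0 with b | b | b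
    · exact Or.inr (Or.inl (ray hxy a b))
    · exact (hnz a b).elim
    · exact Or.inl (Or.inr (Or.inl (cone hyz b (by linarith))))
  · rcases lt_trichotomy (det₂ y v) 0 with b | b | b
    · exact Or.inl (Or.inl (cone hxy a b))
    · exact Or.inr (Or.inr (Or.inl (ray hyz b (by linarith))))
    · exact Or.inl (Or.inr (Or.inl (cone hyz b (by linarith))))

/-- The three initial angles cover all directions except the three rays themselves; a vertex on such
a ray is assigned to one of the two adjacent angles by `pending_of_common_side`. -/
theorem IsRayShooting.pending_initial {ι : Type*} [Finite ι] {N : ι → Plane} {c : ι → ℝ}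
    {T : Plane → Plane} {l : Plane → ι} (S : IsRayShooting N c T l) {x y z v : Plane} {D : ℝ}
    (hD : 0 < D) (hxy : det₂ x y = D) (hyz : det₂ y z = D) (hzx : det₂ z x = D)
    (hx : ‖x‖ = 1) (hy : ‖y‖ = 1) (hz : ‖z‖ = 1)
    (hext : v ∈ (polyhedron N c).extremePoints ℝ) :
    Pending N c T l x y v ∨ Pending N c T l y z v ∨ Pending N c T l x z v := by
  have hv : v ≠ 0 := by
    obtain ⟨i, -, -, hi, -⟩ := exists_tight_pair hext
    exact S.ne_zero_of_mem_face hi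
  have common : ∀ {x y z : Plane}, ‖x‖ = 1 → det₂ x y = D → det₂ z x = D →
      (∃ r : ℝ, 0 < r ∧ v = r • x) → Pending N c T l y x v ∨ Pending N c T l z x v := by
    rintro x y z hx hxy hzx ⟨r, hr, hvr⟩
    refine S.pending_of_common_side hx (S.eq_endpoint_of_extreme hx hext hr hvr) hext ?_
    rintro _ ⟨a, b, ha, -, rfl⟩ _ ⟨a', b', ha', -, rfl⟩
    rw [det₂_add_right, det₂_add_right, det₂_smul_right, det₂_smul_right, det₂_smul_right,
      det₂_smul_right, det₂_self, hxy, det₂_comm x z, hzx]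
    have : 0 < a * a' * (D * D) := by positivity
    linarith
  rcases three_cones hD hxy hyz hzx hv with (h | h | h) | h | h | h
  · exact Or.inl (Or.inl h)
  · exact Or.inr (Or.inl (Or.inl h))
  · exact Or.inr (Or.inr (Or.inl (openCone_comm z x ▸ h)))
  · rcases common hx hxy hzx h with h' | h'
    · exact Or.inl (pending_comm.1 h')
    · exact Or.inr (Or.inr (pending_comm.1 h'))
  · rcases common hy hyz hxy h with h' | h'
    · exact Or.inr (Or.inl (pending_comm.1 h'))
    · exact Or.inl h'
  · rcases common hz hzx hyz h with h' | h'
    · exact Or.inr (Or.inr h')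
    · exact Or.inr (Or.inl h')

variable {m n : ℕ} {W : ConvexPolygon m} {p : Fin n → Plane} {k : Fin n} {scan : Scan n}
  {T : Plane → Plane} {l : Plane → LineLabel n m}

/-- The invariant of the main loop: every vertex is stored or is still to be found, and only
vertices are stored, with the lines of their two edges. -/
structure LoopInvariant (W : ConvexPolygon m) (p : Fin n → Plane) (k : Fin n)
    (T : Plane → Plane) (l : Plane → LineLabel n m) (s : State n m) : Prop where
  subfaces : ∀ x ∈ s.queue, ‖x.1‖ = 1 ∧ ‖x.2‖ = 1 ∧ det₂ x.1 x.2 ≠ 0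
  covered : ∀ v ∈ (centeredCell W p k).extremePoints ℝ, (∃ E ∈ s.output, E.point = p k + v) ∨
    ∃ x ∈ s.queue, Pending (normalOf W p k) (levelOf W p k) T l x.1 x.2 v
  sound : ∀ E ∈ s.output, E.point - p k ∈ cellFace W p k E.line₁ ∧
    E.point - p k ∈ cellFace W p k E.line₂ ∧ E.line₁ ≠ E.line₂ ∧
    E.line₁ ∈ edgeLabels W p k ∧ E.line₂ ∈ edgeLabels W p k

/-- A bound for the number of passes that the treatment of the queue takes. -/
noncomputable def potential (W : ConvexPolygon m) (p : Fin n → Plane) (k : Fin n)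
    (l : Plane → LineLabel n m) (q : List (Plane × Plane)) : ℕ :=
  (q.map fun x => 2 * (between (normalOf W p k) (levelOf W p k) l x.1 x.2).ncard + 1).sum

theorem step_val_done {θ₁ θ₂ : Plane} {rest : List (Plane × Plane)} {out : List (Entry n m)}
    (h : (treat W p scan k θ₁ θ₂).val = .done) :
    (step W p scan k ⟨(θ₁, θ₂) :: rest, out⟩).val = ⟨rest, out⟩ := by
  simp [step, h]

theorem step_val_store {θ₁ θ₂ : Plane} {rest : List (Plane × Plane)} {out : List (Entry n m)}
    {e : Entry n m} (h : (treat W p scan k θ₁ θ₂).val = .store e) :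
    (step W p scan k ⟨(θ₁, θ₂) :: rest, out⟩).val = ⟨rest, e :: out⟩ := by
  simp [step, h]

theorem step_val_split {θ₁ θ₂ θ₃ : Plane} {rest : List (Plane × Plane)}
    {out : List (Entry n m)} (h : (treat W p scan k θ₁ θ₂).val = .split θ₃) :
    (step W p scan k ⟨(θ₁, θ₂) :: rest, out⟩).val
      = ⟨rest ++ [(θ₁, θ₃)] ++ [(θ₂, θ₃)], out⟩ := by
  simp [step, h]

/-- The truncated subtraction lets the same bound cover an empty queue, where the step does nothing.
-/
theorem LoopInvariant.step (S : IsRayShooting (normalOf W p k) (levelOf W p k) T l)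
    (htreat : ∀ θ₁ θ₂, ‖θ₁‖ = 1 → ‖θ₂‖ = 1 → det₂ θ₁ θ₂ ≠ 0 →
      TreatResult W p k T l θ₁ θ₂ (treat W p scan k θ₁ θ₂).val)
    {s : State n m} (hs : LoopInvariant W p k T l s) :
    LoopInvariant W p k T l (step W p scan k s).val ∧
    potential W p k l (RayVoronoi.step W p scan k s).val.queue ≤ potential W p k l s.queue - 1 := by
  obtain ⟨queue, out⟩ := s
  cases queue with
  | nil => exact ⟨hs, by simp [RayVoronoi.step, potential]⟩
  | cons x rest =>
    obtain ⟨θ₁, θ₂⟩ := x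
    obtain ⟨u₁, u₂, hdet⟩ := hs.subfaces (θ₁, θ₂) (by simp)
    have hrest : ∀ x ∈ rest, ‖x.1‖ = 1 ∧ ‖x.2‖ = 1 ∧ det₂ x.1 x.2 ≠ 0 :=
      fun x hx => hs.subfaces x (List.mem_cons_of_mem _ hx)
    have hres := htreat θ₁ θ₂ u₁ u₂ hdet
    generalize hact : (treat W p scan k θ₁ θ₂).val = act at hres
    cases hres with
    | done h₁ h₂ =>
      rw [step_val_done hact]
      refine ⟨⟨hrest, fun v hv => ?_, hs.sound⟩, by simp [potential]⟩
      rcases hs.covered v hv with h | ⟨x, hx, hp⟩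
      · exact Or.inl h
      rcases List.mem_cons.1 hx with rfl | hx
      · exact absurd hp (S.not_pending_of_common_edge u₁ u₂ hdet h₁ h₂ hv)
      · exact Or.inr ⟨x, hx, hp⟩
    | @store u a b ha hb hu h₁ h₂ hne =>
      rw [step_val_store hact]
      refine ⟨⟨hrest, fun v hv => ?_, fun E hE => ?_⟩, by simp [potential]⟩
      · rcases hs.covered v hv with ⟨E, hE, hEv⟩ | ⟨x, hx, hp⟩
        · exact Or.inl ⟨E, List.mem_cons_of_mem _ hE, hEv⟩
        rcases List.mem_cons.1 hx with rfl | hx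
        · have := S.eq_of_pending u₁ u₂ hdet ha hb hu h₁ h₂ hv hp
          exact Or.inl ⟨_, List.mem_cons_self, by rw [this]⟩
        · exact Or.inr ⟨x, hx, hp⟩
      · rcases List.mem_cons.1 hE with rfl | hE
        · refine ⟨?_, ?_, hne, S.nontrivial _ u₁, S.nontrivial _ u₂⟩
          · rw [add_sub_cancel_left]; exact h₁
          · rw [add_sub_cancel_left]; exact h₂
        · exact hs.sound E hE
    | @split θ₃ h =>
      rw [step_val_split hact]
      refine ⟨⟨fun x hx => ?_, fun v hv => ?_, hs.sound⟩, ?_⟩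
      · simp only [List.mem_append, List.mem_singleton] at hx
        rcases hx with (hx | rfl) | rfl
        · exact hrest x hx
        · obtain ⟨b, hb, hb'⟩ := det₂_pos_of_mem_openCone h.mem
          exact ⟨u₁, h.unit, by rw [hb']; exact mul_ne_zero hb.ne' hdet⟩
        · obtain ⟨b, hb, hb'⟩ := det₂_pos_of_mem_openCone h.symm.mem
          refine ⟨u₂, h.unit, ?_⟩
          show det₂ θ₂ θ₃ ≠ 0
          rw [hb', det₂_comm]
          exact mul_ne_zero hb.ne' (neg_ne_zero.2 hdet)
      · rcases hs.covered v hv with h' | ⟨x, hx, hp⟩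
        · exact Or.inl h'
        rcases List.mem_cons.1 hx with rfl | hx
        · rcases S.pending_split hdet hv h hp with hp | hp
          · exact Or.inr ⟨(θ₁, θ₃), by simp, hp⟩
          · exact Or.inr ⟨(θ₂, θ₃), by simp, hp⟩
        · exact Or.inr ⟨x, by simp [hx], hp⟩
      -- The weight is `2 * b + 1` so that a split pays for the extra queue entry: `(2 * b₁ + 1) +
      -- (2 * b₂ + 1) ≤ 2 * b`.
      · have := S.ncard_between_split u₁ u₂ hdet h
        simp only [potential, List.map_append, List.map_cons, List.map_nil, List.sum_append,
          List.sum_cons, List.sum_nil]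
        dsimp only at this
        omega

theorem initial_queue : (initial n m).val = ⟨[(!₂[√3 / 2, -(1 / 2)], !₂[0, 1]),
    (!₂[0, 1], !₂[-(√3 / 2), -(1 / 2)]),
    (!₂[√3 / 2, -(1 / 2)], !₂[-(√3 / 2), -(1 / 2)])], []⟩ := rfl

theorem LoopInvariant.initial (S : IsRayShooting (normalOf W p k) (levelOf W p k) T l) :
    LoopInvariant W p k T l (initial n m).val := by
  have h3 : 0 < √(3 : ℝ) := by positivity
  have hsq : √(3 : ℝ) * √3 = 3 := Real.mul_self_sqrt (by norm_num)
  have norm_one : ∀ a b : ℝ, a * a + b * b = 1 → ‖(!₂[a, b] : Plane)‖ = 1 := by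
    intro a b h
    have : ‖(!₂[a, b] : Plane)‖ * ‖(!₂[a, b] : Plane)‖ = 1 := by
      rw [← real_inner_self_eq_norm_mul_norm, inner_coords]
      simpa using h
    nlinarith [norm_nonneg (!₂[a, b] : Plane)]
  have n₁ := norm_one (√3 / 2) (-(1 / 2)) (by linarith)
  have n₂ := norm_one 0 1 (by norm_num)
  have n₃ := norm_one (-(√3 / 2)) (-(1 / 2)) (by linarith)
  have d₁ : det₂ (!₂[√3 / 2, -(1 / 2)]) (!₂[0, 1]) = √3 / 2 := by simp [det₂]
  have d₂ : det₂ (!₂[0, 1]) (!₂[-(√3 / 2), -(1 / 2)]) = √3 / 2 := by simp [det₂]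
  have d₃ : det₂ (!₂[-(√3 / 2), -(1 / 2)]) (!₂[√3 / 2, -(1 / 2)]) = √3 / 2 := by
    simp [det₂]; ring
  have hD : 0 < √(3 : ℝ) / 2 := by positivity
  rw [initial_queue]
  refine ⟨fun x hx => ?_, fun v hv => Or.inr ?_, by simp⟩
  · simp only [List.mem_cons, List.not_mem_nil, or_false] at hx
    rcases hx with rfl | rfl | rfl
    · exact ⟨n₁, n₂, by rw [d₁]; exact hD.ne'⟩
    · exact ⟨n₂, n₃, by rw [d₂]; exact hD.ne'⟩
    · refine ⟨n₁, n₃, ?_⟩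
      show det₂ (!₂[√3 / 2, -(1 / 2)]) (!₂[-(√3 / 2), -(1 / 2)]) ≠ 0
      rw [det₂_comm, d₃]
      exact neg_ne_zero.2 hD.ne'
  · rcases S.pending_initial hD d₁ d₂ d₃ n₁ n₂ n₃ hv with h | h | h
    · exact ⟨_, List.mem_cons_self, h⟩
    · exact ⟨_, List.mem_cons_of_mem _ List.mem_cons_self, h⟩
    · exact ⟨_, List.mem_cons_of_mem _ (List.mem_cons_of_mem _ List.mem_cons_self), h⟩

theorem potential_initial_le :
    potential W p k l (initial n m).val.queue ≤ 6 * (edgeLabels W p k).ncard + 3 := by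
  have hle : ∀ θ₁ θ₂, (between (normalOf W p k) (levelOf W p k) l θ₁ θ₂).ncard
      ≤ (edgeLabels W p k).ncard := fun θ₁ θ₂ =>
    Set.ncard_le_ncard (fun _ h => h.1) (Set.toFinite _)
  rw [initial_queue]
  simp only [potential, List.map_cons, List.map_nil, List.sum_cons, List.sum_nil]
  have h₁ := hle !₂[√3 / 2, -(1 / 2)] !₂[0, 1]
  have h₂ := hle !₂[0, 1] !₂[-(√3 / 2), -(1 / 2)]
  have h₃ := hle !₂[√3 / 2, -(1 / 2)] !₂[-(√3 / 2), -(1 / 2)]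
  omega

theorem LoopInvariant.run (S : IsRayShooting (normalOf W p k) (levelOf W p k) T l)
    (htreat : ∀ θ₁ θ₂, ‖θ₁‖ = 1 → ‖θ₂‖ = 1 → det₂ θ₁ θ₂ ≠ 0 →
      TreatResult W p k T l θ₁ θ₂ (treat W p scan k θ₁ θ₂).val) (M : ℕ) :
    LoopInvariant W p k T l (run W p scan k M).val ∧
    potential W p k l (RayVoronoi.run W p scan k M).val.queue
      ≤ 6 * (edgeLabels W p k).ncard + 3 - M := by
  induction M with
  | zero => exact ⟨.initial S, potential_initial_le⟩
  | succ M ih =>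
    obtain ⟨h₁, h₂⟩ := ih.1.step (scan := scan) S htreat
    refine ⟨h₁, ?_⟩
    have h₃ : (RayVoronoi.run W p scan k (M + 1)).val
        = (RayVoronoi.step W p scan k (RayVoronoi.run W p scan k M).val).val := rfl
    rw [h₃]
    have := ih.2
    omega

theorem eq_nil_of_potential {q : List (Plane × Plane)} (h : potential W p k l q = 0) : q = [] := by
  cases q with
  | nil => rfl
  | cons x q => simp [potential] at h

theorem exists_rayShooting (hp : Function.Injective p) (hint : ∀ k, p k ∈ interior W.carrier)
    (hscan : scan.Admissible W p) (k : Fin n) : ∃ T l,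
      IsRayShooting (normalOf W p k) (levelOf W p k) T l ∧
      ∀ θ, ‖θ‖ = 1 → (shoot W p scan k θ).val = some ⟨T θ, l θ⟩ := by
  have hex : ∀ θ : Plane, ∃ (T : Plane) (L : LineLabel n m), ‖θ‖ = 1 →
      (shoot W p scan k θ).val = some ⟨T, L⟩ ∧
      (∃ t : ℝ, 0 < t ∧ T = t • θ) ∧ T ∈ cellFace W p k L ∧ L ∈ edgeLabels W p k := by
    intro θ
    by_cases hθ : ‖θ‖ = 1
    · obtain ⟨T, L, h⟩ := exists_shoot_val hp hint hscan k hθ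
      exact ⟨T, L, fun _ => h⟩
    · exact ⟨0, .bisector k, fun h => absurd h hθ⟩
  choose T l h using hex
  exact ⟨T, l, ⟨isPolygonSystem hp hint k, fun θ hθ => (h θ hθ).2.1,
    fun θ hθ => (h θ hθ).2.2.1, fun θ hθ => (h θ hθ).2.2.2⟩, fun θ hθ => (h θ hθ).1⟩

/-- What is known of a cell after sufficiently many passes of the main loop. -/
theorem run_correct (hp : Function.Injective p) (hint : ∀ k, p k ∈ interior W.carrier)
    (hscan : scan.Admissible W p) (k : Fin n) {M : ℕ}
    (hM : 6 * (edgeLabels W p k).ncard + 3 ≤ M) :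
    (run W p scan k M).val.queue = [] ∧
    (∀ v ∈ (cell W p k).extremePoints ℝ, VertexStored (run W p scan k M).val.output v) ∧
    (∀ a b, IsEdge (cell W p k) (segment ℝ a b) →
      EdgeStored W p k (run W p scan k M).val.output a b) ∧
    (∀ E ∈ (run W p scan k M).val.output, E.point ∈ (cell W p k).extremePoints ℝ) ∧
    0 < (edgeLabels W p k).ncard := by
  obtain ⟨T, l, S, hT⟩ := exists_rayShooting hp hint hscan k
  have hinv := LoopInvariant.run (scan := scan) S (fun θ₁ θ₂ u₁ u₂ hdet =>
    treatResult S hT (fun u hu => insideCell_val hp hint hscan hu) u₁ u₂ hdet) M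
  obtain ⟨hinv, hpot⟩ := hinv
  have hq : (run W p scan k M).val.queue = [] := eq_nil_of_potential (W := W) (p := p) (k := k)
    (l := l) (by omega)
  have hstored : ∀ v ∈ (cell W p k).extremePoints ℝ,
      VertexStored (run W p scan k M).val.output v := by
    intro v hv
    rcases hinv.covered _ (mem_extremePoints_iff.1 hv) with ⟨E, hE, hEv⟩ | ⟨x, hx, -⟩
    · exact ⟨E, hE, by rw [hEv, add_sub_cancel]⟩
    · rw [hq] at hx
      exact absurd hx List.not_mem_nil
  -- The vertex is stored with two different edge labels. If `L` were a third one, three edges would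
  -- pass through it.
  have hline : ∀ {a L}, L ∈ edgeLabels W p k → a - p k ∈ cellFace W p k L →
      a ∈ (cell W p k).extremePoints ℝ →
      ∃ E ∈ (run W p scan k M).val.output, E.point = a ∧ (E.line₁ = L ∨ E.line₂ = L) := by
    intro a L hL ha hext
    obtain ⟨E, hE, rfl⟩ := hstored a hext
    obtain ⟨h₁, h₂, hne, e₁, e₂⟩ := hinv.sound E hE
    refine ⟨E, hE, rfl, ?_⟩
    by_contra hcon
    push Not at hcon
    exact S.not_three_faces hne hcon.1 hcon.2 h₁ h₂ ha e₁ e₂ hL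
  refine ⟨hq, hstored, fun a b hab => ?_, fun E hE => ?_, ?_⟩
  · obtain ⟨L, hL, heq, ha, hb, hae, hbe⟩ := exists_label_of_isEdge hp hint hab
    exact ⟨L, heq, hline hL ha hae, hline hL hb hbe⟩
  · obtain ⟨h₁, h₂, hne, -, -⟩ := hinv.sound E hE
    exact mem_extremePoints_iff.2 (S.mem_extremePoints_of_two_faces hne h₁ h₂)
  · have hunit : ‖‖(!₂[1, 0] : Plane)‖⁻¹ • (!₂[1, 0] : Plane)‖ = 1 := norm_unit fun h => by
      have := congrArg (fun z : Plane => z 0) h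
      simp at this
    exact (Set.ncard_pos (Set.toFinite _)).2 ⟨_, S.nontrivial _ hunit⟩

end Loop

end RayVoronoi

namespace RayVoronoi

/-! ### Cost of programs -/

section CostRules

variable {α β : Type} {P : ℕ → Prop} {q a r : ℤ}

/-- Bounds for the cost of a program: apart from `a` operations its time is covered by the distance
comparisons, it does at most `q` comparisons on the current ray and processes at most `r` further
rays, each of them with a number of comparisons that satisfies `P`. -/
structure HasCost (P : ℕ → Prop) (q a r : ℤ) (x : Timed α) : Prop where
  time : (x.time : ℤ) ≤ a + 10 * (x.comps + x.rays.sum)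
  comps : (x.comps : ℤ) ≤ q
  length : (x.rays.length : ℤ) ≤ r
  rays : ∀ c ∈ x.rays, P c

namespace HasCost

theorem mono {q' a' r' : ℤ} {x : Timed α} (h : HasCost P q a r x) (hq : q ≤ q') (ha : a ≤ a')
    (hr : r ≤ r') : HasCost P q' a' r' x :=
  ⟨by linarith [h.time], by linarith [h.comps], by linarith [h.length], h.rays⟩

theorem pure (v : α) (hq : 0 ≤ q) (ha : 0 ≤ a) (hr : 0 ≤ r) :
    HasCost P q a r (Pure.pure v : Timed α) :=
  ⟨by simpa [Pure.pure] using ha, by simpa [Pure.pure] using hq, by simpa [Pure.pure] using hr,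
    by simp [Pure.pure]⟩

theorem op (v : α) (hq : 0 ≤ q) (ha : 1 ≤ a) (hr : 0 ≤ r) : HasCost P q a r (op v) :=
  ⟨by simpa [RayVoronoi.op] using ha, by simpa [RayVoronoi.op] using hq,
    by simpa [RayVoronoi.op] using hr, by simp [RayVoronoi.op]⟩

theorem bind {q' a' r' : ℤ} {x : Timed α} {f : α → Timed β} (h : HasCost P q' a' r' x)
    (hf : HasCost P (q - q') (a - a') (r - r') (f x.val)) : HasCost P q a r (x >>= f) := by
  have e₁ : (x >>= f).time = x.time + (f x.val).time := rfl
  have e₂ : (x >>= f).comps = x.comps + (f x.val).comps := rfl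
  have e₃ : (x >>= f).rays = x.rays ++ (f x.val).rays := rfl
  constructor
  · rw [e₁, e₂, e₃, List.sum_append, Nat.cast_add, Nat.cast_add, Nat.cast_add]
    linarith [h.time, hf.time]
  · rw [e₂]
    push_cast
    linarith [h.comps, hf.comps]
  · rw [e₃, List.length_append]
    push_cast
    linarith [h.length, hf.length]
  · rw [e₃]
    intro c hc
    rcases List.mem_append.1 hc with hc | hc
    · exact h.rays c hc
    · exact hf.rays c hc

theorem op_bind {v : α} {f : α → Timed β} (hf : HasCost P q (a - 1) r (f v)) :
    HasCost P q a r (RayVoronoi.op v >>= f) :=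
  bind (op v le_rfl le_rfl le_rfl) (by simpa using hf)

theorem test_bind {C : Prop} [Decidable C] {f : Bool → Timed β}
    (hf : ∀ b, HasCost P q (a - 1) r (f b)) : HasCost P q a r (test C >>= f) :=
  op_bind (hf _)

/-- Each comparison carries a credit of ten operations and uses three itself; the remaining seven
pay for the work around it. This is why the budgets are integers and may become negative. -/
theorem compareDist_bind {y s t : Plane} {f : Ordering → Timed β}
    (hf : ∀ o, HasCost P (q - 1) (a + 7) r (f o)) :
    HasCost P q a r (compareDist y s t >>= f) := by
  have h : HasCost P 1 (-7) 0 (compareDist y s t) :=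
    ⟨by simp [compareDist], by simp [compareDist], by simp [compareDist], by simp [compareDist]⟩
  exact bind h ((hf _).mono le_rfl (by linarith) (by linarith))

theorem ite {C : Prop} [Decidable C] {x y : Timed α} (hx : HasCost P q a r x)
    (hy : HasCost P q a r y) : HasCost P q a r (if C then x else y) := by
  split <;> assumption

/-- Closing a ray moves its comparisons from `comps` to `rays`. Their total, and with it the credit
in `HasCost.time`, does not change. -/
theorem alongRay_bind {q' a' : ℤ} {x : Timed α} {f : α → Timed β} (h : HasCost P q' a' 0 x)
    (hP : P x.comps) (hf : HasCost P q (a - a') (r - 1) (f x.val)) :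
    HasCost P q a r (alongRay x >>= f) := by
  have h' : HasCost P 0 a' 1 (alongRay x) := by
    refine ⟨?_, by simp [alongRay], ?_, ?_⟩
    · have := h.time
      simp only [alongRay, List.sum_cons, Nat.cast_add, Nat.cast_zero]
      linarith
    · have := h.length
      simp only [alongRay, List.length_cons]
      push_cast
      linarith
    · intro c hc
      rcases List.mem_cons.1 hc with rfl | hc
      · exact hP
      · exact h.rays c hc
  exact bind h' (by simpa using hf)

end HasCost

theorem hasCost_unitVector_bind {v : Plane} {f : Plane → Timed β}
    (hf : HasCost P q (a - 3) r (f (‖v‖⁻¹ • v))) : HasCost P q a r (unitVector v >>= f) := by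
  refine HasCost.bind (q' := 0) (a' := 3) (r' := 0) ?_ (by simpa using hf)
  unfold unitVector
  exact .op_bind (.op_bind (.op _ (by norm_num) (by norm_num) (by norm_num)))

end CostRules

/-! ### Cost of the routines and of the main loop -/

section Cost

variable {m n : ℕ} {W : ConvexPolygon m} {p : Fin n → Plane} {k : Fin n} {scan : Scan n}
  {P : ℕ → Prop}

theorem hasCost_boundaryHit (q θ : Plane) (is : List (Fin m)) (best : Option (ℝ × Fin m)) :
    HasCost P 0 (6 * is.length) 0 (boundaryHit W q θ is best) := by
  induction is generalizing best with
  | nil => exact .pure _ (by simp) (by simp) (by simp)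
  | cons i is ih =>
    have hlen : ((i :: is).length : ℤ) = is.length + 1 := by simp
    rw [hlen]
    unfold boundaryHit
    refine .op_bind (.test_bind fun _ => .ite (.op_bind (.op_bind (.op_bind ?_))) ?_)
    · cases best with
      | none => exact (ih _).mono (by linarith) (by linarith) (by linarith)
      | some b =>
        exact .test_bind fun _ => .ite ((ih _).mono (by linarith) (by linarith) (by linarith))
          ((ih _).mono (by linarith) (by linarith) (by linarith))
    · exact (ih _).mono (by linarith) (by linarith) (by linarith)

theorem hasCost_nearer (j : Fin n) (nb : Option (Fin n)) :
    HasCost P 0 4 0 (nearer p k j nb) := by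
  unfold nearer
  refine .test_bind fun _ => .ite (.pure _ (by norm_num) (by norm_num) (by norm_num)) ?_
  cases nb with
  | none => exact .pure _ (by norm_num) (by norm_num) (by norm_num)
  | some i =>
    exact .op_bind (.op_bind (.test_bind fun _ => .ite
      (.pure _ (by norm_num) (by norm_num) (by norm_num))
      (.pure _ (by norm_num) (by norm_num) (by norm_num))))

/-- The worst case determines the credit of ten: two operations for the point, three for the
comparison, five for the new parameter. Hence no operations remain uncovered. -/
theorem hasCost_shorten (θ : Plane) (js : List (Fin n)) (t : ℝ) (nb : Option (Fin n)) :
    HasCost P js.length 0 0 (shorten p k θ js t nb) := by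
  induction js generalizing t nb with
  | nil => exact .pure _ (by simp) (by simp) (by simp)
  | cons j js ih =>
    have hlen : ((j :: js).length : ℤ) = js.length + 1 := by simp
    rw [hlen]
    unfold shorten
    refine .op_bind (.op_bind (.compareDist_bind fun o => ?_))
    cases o with
    | lt =>
      exact .op_bind (.op_bind (.op_bind (.op_bind (.op_bind
        ((ih _ _).mono (by linarith) (by linarith) (by linarith))))))
    | eq =>
      exact .bind (hasCost_nearer _ _) ((ih _ _).mono (by linarith) (by linarith) (by linarith))
    | gt => exact (ih _ _).mono (by linarith) (by linarith) (by linarith)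

theorem hasCost_shoot (θ : Plane) :
    HasCost P (scan k θ).length (6 * m + 1) 0 (shoot W p scan k θ) := by
  unfold shoot
  refine .bind (hasCost_boundaryHit _ _ _ _) ?_
  rw [List.length_finRange]
  split
  · exact .pure _ (by simp) (by simp) (by simp)
  · refine .bind (hasCost_shorten _ _ _ _) (.op_bind ?_)
    split <;> exact .pure _ (by simp) (by simp) (by simp)

theorem hasCost_insideWorld (u : Plane) (is : List (Fin m)) :
    HasCost P 0 (2 * is.length) 0 (insideWorld W u is) := by
  induction is with
  | nil => exact .pure _ (by simp) (by simp) (by simp)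
  | cons i is ih =>
    have hlen : ((i :: is).length : ℤ) = is.length + 1 := by simp
    rw [hlen]
    unfold insideWorld
    exact .op_bind (.test_bind fun _ => .ite (ih.mono (by linarith) (by linarith) (by linarith))
      (.pure _ (by linarith) (by linarith) (by linarith)))

theorem hasCost_closestSite (u : Plane) (js : List (Fin n)) :
    HasCost P js.length 0 0 (closestSite p k u js) := by
  induction js with
  | nil => exact .pure _ (by simp) (by simp) (by simp)
  | cons j js ih =>
    have hlen : ((j :: js).length : ℤ) = js.length + 1 := by simp
    rw [hlen]
    unfold closestSite
    refine .compareDist_bind fun o => ?_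
    cases o with
    | lt => exact .pure _ (by linarith) (by linarith) (by linarith)
    | eq => exact ih.mono (by linarith) (by linarith) (by linarith)
    | gt => exact ih.mono (by linarith) (by linarith) (by linarith)

theorem hasCost_insideCell (u θ : Plane) :
    HasCost P (scan k θ).length (2 * m) 0 (insideCell W p scan k u θ) := by
  unfold insideCell
  refine .bind (hasCost_insideWorld _ _) ?_
  rw [List.length_finRange]
  exact .ite ((hasCost_closestSite _ _).mono (by simp) (by simp) (by simp))
    (.pure _ (by simp) (by simp) (by simp))

theorem hasCost_lineNormal_bind {β : Type} {q a r : ℤ} {L : LineLabel n m} {f : Plane → Timed β}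
    (hf : HasCost P q (a - 1) r (f (normalOf W p k L))) :
    HasCost P q a r (lineNormal W p k L >>= f) := by
  cases L <;> exact .op_bind hf

theorem hasCost_insideCone_bind {β : Type} {q a r : ℤ} {θ₁ θ₂ φ : Plane} {f : Bool → Timed β}
    (hf : HasCost P q (a - 7) r (f (insideCone θ₁ θ₂ φ).val)) :
    HasCost P q a r (insideCone θ₁ θ₂ φ >>= f) := by
  refine HasCost.bind (q' := 0) (a' := 7) (r' := 0) ?_ (by simpa using hf)
  unfold insideCone
  exact .op_bind (.op_bind (.op_bind (.op_bind (.op_bind (.test_bind fun _ => .test_bind fun _ =>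
    .pure _ (by norm_num) (by norm_num) (by norm_num))))))

/-- Two shots at `6 * m + 1` and one membership test at `2 * m` give `14 * m + 2`; the constant `50`
leaves room for the linear algebra. These are the three rays. -/
theorem hasCost_treat (hP : ∀ θ, ∀ c ≤ (scan k θ).length, P c) (θ₁ θ₂ : Plane) :
    HasCost P 0 (14 * m + 50) 3 (treat W p scan k θ₁ θ₂) := by
  have hshoot : ∀ θ, P (shoot W p scan k θ).comps := fun θ =>
    hP θ _ (by exact_mod_cast (hasCost_shoot (W := W) (p := p) (P := P) θ).comps)
  have hinside : ∀ u θ, P (insideCell W p scan k u θ).comps := fun u θ =>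
    hP θ _ (by exact_mod_cast (hasCost_insideCell (W := W) (p := p) (P := P) u θ).comps)
  unfold treat
  refine .alongRay_bind (hasCost_shoot θ₁) (hshoot _)
    (.alongRay_bind (hasCost_shoot θ₂) (hshoot _) ?_)
  split
  · refine hasCost_lineNormal_bind (hasCost_lineNormal_bind (.op_bind (.op_bind (.op_bind
      (.op_bind (.op_bind (.op_bind (.op_bind (.test_bind fun _ => .ite ?_ ?_)))))))))
    · refine .test_bind fun _ => .ite (.pure _ (by linarith) (by linarith) (by linarith)) ?_
      refine .op_bind (hasCost_unitVector_bind (hasCost_insideCone_bind (.ite ?_ (.op_bind ?_))))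
      · exact .pure _ (by linarith) (by linarith) (by linarith)
      · exact .pure _ (by linarith) (by linarith) (by linarith)
    · refine .op_bind (.op_bind (.op_bind (.op_bind (.op_bind (.op_bind (.op_bind (.op_bind
        (.op_bind (.op_bind (.test_bind fun _ => .test_bind fun _ => .ite ?_ ?_))))))))))
      · refine .op_bind (hasCost_unitVector_bind (.alongRay_bind (hasCost_insideCell _ _)
          (hinside _ _) (.ite ?_ ?_)))
        · exact .pure _ (by linarith) (by linarith) (by linarith)
        · exact .pure _ (by linarith) (by linarith) (by linarith)
      · refine .op_bind (hasCost_unitVector_bind ?_)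
        exact .pure _ (by linarith) (by linarith) (by linarith)
  · exact .pure _ (by linarith) (by linarith) (by linarith)

theorem hasCost_step (hP : ∀ θ, ∀ c ≤ (scan k θ).length, P c) (s : State n m) :
    HasCost P 0 (14 * m + 54) 3 (step W p scan k s) := by
  unfold step
  split
  · exact .pure _ (by linarith) (by linarith) (by linarith)
  · refine .bind (hasCost_treat hP _ _) (.op_bind ?_)
    split
    · exact .op _ (by linarith) (by linarith) (by linarith)
    · exact .op_bind (.op _ (by linarith) (by linarith) (by linarith))
    · exact .op_bind (.op_bind (.op _ (by linarith) (by linarith) (by linarith)))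

theorem hasCost_run (hP : ∀ θ, ∀ c ≤ (scan k θ).length, P c) (M : ℕ) :
    HasCost P 0 (7 + M * (14 * m + 54)) (3 * M) (run W p scan k M) := by
  induction M with
  | zero =>
    unfold run initial
    exact .op_bind (.op_bind (.op_bind (.op_bind (.op_bind (.op_bind
      (.op _ (by simp) (by norm_num) (by simp)))))))
  | succ M ih =>
    unfold run
    refine .bind ih ((hasCost_step hP _).mono (by simp) ?_ ?_)
    · push_cast; linarith
    · push_cast; linarith

/-! ### Comparisons along a ray and the total time -/

theorem le_maxComps {α : Type} {x : Timed α} {c : ℕ} (h : c ∈ x.rays) : c ≤ x.maxComps := by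
  unfold Timed.maxComps
  generalize x.rays = rays at h
  induction rays with
  | nil => exact absurd h List.not_mem_nil
  | cons d ds ih =>
    rw [List.foldr_cons]
    rcases List.mem_cons.1 h with rfl | h
    · exact le_max_left _ _
    · exact (ih h).trans (le_max_right _ _)

theorem maxComps_le {α : Type} {x : Timed α} {B : ℕ} (h : ∀ c ∈ x.rays, c ≤ B) :
    x.maxComps ≤ B := by
  unfold Timed.maxComps
  generalize x.rays = rays at h
  induction rays with
  | nil => simp
  | cons d ds ih =>
    rw [List.foldr_cons]
    exact max_le (h d (by simp)) (ih fun c hc => h c (by simp [hc]))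

theorem sum_rays_le {α : Type} (x : Timed α) : x.rays.sum ≤ x.rays.length * x.maxComps := by
  simpa using List.sum_le_card_nsmul x.rays x.maxComps fun c hc => le_maxComps hc

theorem one_le_comps_shorten (θ : Plane) (js : List (Fin n)) (hjs : js ≠ []) (t : ℝ)
    (nb : Option (Fin n)) : 1 ≤ (shorten p k θ js t nb).comps := by
  cases js with
  | nil => exact absurd rfl hjs
  | cons j js =>
    unfold shorten
    exact Nat.le_add_left_of_le (Nat.le_add_left_of_le (Nat.le_add_right 1 _))

theorem one_le_comps_shoot (hint : ∀ k, p k ∈ interior W.carrier) {θ : Plane} (hθ : θ ≠ 0)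
    (hscan : scan k θ ≠ []) : 1 ≤ (shoot W p scan k θ).comps := by
  obtain ⟨t, i, h, -⟩ := exists_boundaryHit hint k hθ
  unfold shoot
  refine Nat.le_add_left_of_le ?_
  rw [h]
  exact Nat.le_add_right_of_le (one_le_comps_shorten θ _ hscan t none)

theorem rays_run_subset {M : ℕ} {c : ℕ} (h : c ∈ (run W p scan k M).rays) :
    c ∈ (run W p scan k (M + 1)).rays :=
  List.mem_append_left _ h

theorem comps_mem_rays_treat (θ₁ θ₂ : Plane) :
    (shoot W p scan k θ₁).comps ∈ (treat W p scan k θ₁ θ₂).rays :=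
  List.mem_append_left _ List.mem_cons_self

theorem comps_mem_rays_run (M : ℕ) :
    (shoot W p scan k !₂[√3 / 2, -(1 / 2)]).comps ∈ (run W p scan k (M + 1)).rays := by
  induction M with
  | zero =>
    refine List.mem_append_right _ ?_
    exact List.mem_append_left _ (comps_mem_rays_treat _ _)
  | succ M ih => exact rays_run_subset ih

/-- An admissible list contains `k` itself, trivially equidistant. This gives `r ≥ 1`, needed to
absorb the additive terms in `O(r * e)`. -/
theorem scan_ne_nil (hscan : scan.Admissible W p) (k : Fin n) (θ : Plane) (hθ : ‖θ‖ = 1) : scan k θ ≠ [] :=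
  List.ne_nil_of_mem (hscan k θ hθ k rfl)

theorem one_le_maxComps_run (hint : ∀ k, p k ∈ interior W.carrier)
    (hscan : scan.Admissible W p) (k : Fin n) {M : ℕ} (hM : 0 < M) :
    1 ≤ (run W p scan k M).maxComps := by
  obtain ⟨M, rfl⟩ := Nat.exists_eq_succ_of_ne_zero hM.ne'
  refine le_trans ?_ (le_maxComps (comps_mem_rays_run M))
  have hsq : √(3 : ℝ) * √3 = 3 := Real.mul_self_sqrt (by norm_num)
  have hunit : ‖(!₂[√3 / 2, -(1 / 2)] : Plane)‖ = 1 := by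
    have : ‖(!₂[√3 / 2, -(1 / 2)] : Plane)‖ * ‖(!₂[√3 / 2, -(1 / 2)] : Plane)‖ = 1 := by
      rw [← real_inner_self_eq_norm_mul_norm, inner_coords]
      simp
      linarith
    nlinarith [norm_nonneg (!₂[√3 / 2, -(1 / 2)] : Plane)]
  refine one_le_comps_shoot hint (fun h => ?_) (scan_ne_nil hscan k _ hunit)
  rw [h, norm_zero] at hunit
  exact zero_ne_one hunit

/-- The time of the main loop in terms of the comparisons along a ray. -/
theorem time_run_le (M : ℕ) : (run W p scan k M).time
    ≤ 7 + M * (14 * m + 54) + 30 * M * (run W p scan k M).maxComps := by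
  have h := hasCost_run (W := W) (p := p) (scan := scan) (k := k) (P := fun _ => True)
    (fun _ _ _ => trivial) M
  have h₁ := h.time
  have h₂ : (run W p scan k M).comps = 0 := by
    have := h.comps
    omega
  have h₃ : (run W p scan k M).rays.length ≤ 3 * M := by exact_mod_cast h.length
  have h₄ := sum_rays_le (run W p scan k M)
  rw [h₂] at h₁
  have h₅ : (run W p scan k M).time
      ≤ 7 + M * (14 * m + 54) + 10 * (run W p scan k M).rays.sum := by
    zify
    push_cast at h₁
    linarith
  have h₆ := Nat.mul_le_mul_right (run W p scan k M).maxComps h₃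
  nlinarith

/-- The comparisons along a ray number at most the length of its list, and a list of sites without
repetition has length at most `n`. -/
theorem maxComps_run_le (h : ∀ θ, (scan k θ).Nodup) (M : ℕ) :
    (run W p scan k M).maxComps ≤ n := by
  refine maxComps_le (hasCost_run (P := fun c => c ≤ n) (fun θ c hc => hc.trans ?_) M).rays
  have := (h θ).length_le_card
  simpa using this

end Cost

end RayVoronoi

namespace RayVoronoi

/-! ### The number of edges of a Voronoi diagram -/

section EdgeBound

/-- A vector that is not orthogonal to any of finitely many given nonzero vectors. -/
theorem exists_inner_ne_zero (D : Finset Plane) :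
    ∃ q : Plane, q ≠ 0 ∧ ∀ d ∈ D, d ≠ 0 → inner ℝ q d ≠ 0 := by
  classical
  -- The vector is `(1, s)`; each `d` with `d 1 ≠ 0` forbids a single value of `s`.
  obtain ⟨s, hs⟩ := Infinite.exists_notMem_finset (D.image fun d => -(d 0) / d 1)
  refine ⟨!₂[1, s], fun h => ?_, fun d hd hd₀ h => ?_⟩
  · have := congrArg (fun z : Plane => z 0) h
    simp at this
  rw [inner_coords] at h
  simp only [Matrix.cons_val_zero, Matrix.cons_val_one, one_mul] at h
  by_cases h₁ : d 1 = 0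
  · rw [h₁, mul_zero, add_zero] at h
    exact hd₀ (plane_ext (by simpa using h) (by simpa using h₁))
  · refine hs (Finset.mem_image.2 ⟨d, hd, ?_⟩)
    rw [div_eq_iff h₁]
    linarith

variable {ι : Type*} {N : ι → Plane} {c : ι → ℝ}

theorem IsPolygonSystem.exists_extreme_mem_face (S : IsPolygonSystem N c) {i : ι}
    (hi : (face N c i).Nontrivial) :
    ∃ v ∈ face N c i, v ∈ (polyhedron N c).extremePoints ℝ := by
  obtain ⟨a, b, hab, h⟩ := S.exists_face_eq_segment hi
  have ha : a ∈ face N c i := h ▸ left_mem_segment ℝ a b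
  refine ⟨a, ha, ha.1, fun x hx y hy hxy => ?_⟩
  have hends := ends_mem_face hxy hx hy ha.2
  rw [h] at hends
  exact (left_mem_extremePoints_segment hab).2 hends.1 hends.2 hxy

theorem mem_openSegment_midpoint (x y : Plane) :
    (1 / 2 : ℝ) • x + (1 / 2 : ℝ) • y ∈ openSegment ℝ x y :=
  ⟨1 / 2, 1 / 2, by norm_num, by norm_num, by norm_num, rfl⟩

/-- In a direction that is not orthogonal to an edge the maximum is attained only once. -/
theorem eq_of_isMax_det₂ [Finite ι] {q x y : Plane}
    (hq : q ≠ 0) (hgen : ∀ i, (face N c i).Nonempty → inner ℝ q (N i) ≠ 0)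
    (hx : x ∈ polyhedron N c) (hy : y ∈ polyhedron N c)
    (hxm : ∀ z ∈ polyhedron N c, det₂ q z ≤ det₂ q x)
    (hym : ∀ z ∈ polyhedron N c, det₂ q z ≤ det₂ q y) : x = y := by
  by_contra hne
  have hdet : det₂ q x = det₂ q y := le_antisymm (hym x hx) (hxm y hy)
  have hmid := mem_openSegment_midpoint x y
  have hmidP := convex_polyhedron.openSegment_subset hx hy hmid
  have hdmid : det₂ q ((1 / 2 : ℝ) • x + (1 / 2 : ℝ) • y) = det₂ q x := by
    rw [det₂_add_right, det₂_smul_right, det₂_smul_right, ← hdet]; ring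
  -- At a maximum some inequality is tight, otherwise a move along `rot q` would increase `det₂ q`.
  -- Tight at the midpoint, it is tight at `x` and `y`; as `x - y` is parallel to `q`, its normal
  -- would be orthogonal to `q`.
  obtain ⟨i, hi⟩ : ∃ i, inner ℝ (N i) ((1 / 2 : ℝ) • x + (1 / 2 : ℝ) • y) = c i := by
    by_contra! hcon
    obtain ⟨ε, hε, hmem⟩ := exists_add_smul_mem_polyhedron (d := rot q) hmidP
      fun i hi => absurd hi (hcon i)
    have h₁ := hxm _ hmem
    rw [det₂_add_right, hdmid, det₂_smul_right] at h₁
    have h₂ : 0 < det₂ q (rot q) := by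
      have := coords_ne_zero hq
      simp only [det₂, rot_zero_coord, rot_one_coord]
      linarith
    have := mul_pos hε h₂
    linarith
  obtain ⟨hxi, hyi⟩ := ends_mem_face hmid hx hy hi
  obtain ⟨r, hr⟩ : ∃ r : ℝ, x - y = r • q :=
    exists_smul_of_det₂_eq_zero hq (by rw [det₂_sub_right, hdet, sub_self])
  have h₁ : r * inner ℝ q (N i) = 0 := by
    rw [← real_inner_smul_left, ← hr, inner_sub_left, real_inner_comm, hxi.2,
      real_inner_comm, hyi.2, sub_self]
  rcases mul_eq_zero.1 h₁ with h | h
  · rw [h, zero_smul, sub_eq_zero] at hr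
    exact hne hr
  · exact hgen i ⟨x, hxi⟩ h

/-- A vertex that is not extreme in a given direction has a point of the polygon beside it. -/
theorem IsPolygonSystem.exists_beside (S : IsPolygonSystem N c) {q v : Plane} (hq : q ≠ 0)
    {i j : ι} (hij : i ≠ j) (hi : v ∈ face N c i) (hj : v ∈ face N c j)
    (htop : ¬ ∀ z ∈ polyhedron N c, det₂ q z ≤ det₂ q v)
    (hbot : ¬ ∀ z ∈ polyhedron N c, det₂ (-q) z ≤ det₂ (-q) v) :
    ∃ s : ℝ, s ≠ 0 ∧ v + s • q ∈ polyhedron N c := by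
  push Not at htop hbot
  obtain ⟨x, hx, hxv⟩ := htop
  obtain ⟨y, hy, hyv⟩ := hbot
  have hneg : ∀ z, det₂ (-q) z = -det₂ q z := fun z => by simp [det₂]; ring
  rw [hneg, hneg, neg_lt_neg_iff] at hyv
  have hd : 0 < det₂ q x - det₂ q y := by linarith
  -- The point of the segment between a higher and a lower point that is at the height of `v`. It is
  -- not `v`, for otherwise both inequalities tight at `v` would be tight along the segment.
  have hz : ((det₂ q v - det₂ q y) / (det₂ q x - det₂ q y)) • x
      + ((det₂ q x - det₂ q v) / (det₂ q x - det₂ q y)) • y ∈ openSegment ℝ x y :=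
    ⟨_, _, div_pos (by linarith) hd, div_pos (by linarith) hd, by field_simp; ring, rfl⟩
  have hdz : det₂ q (((det₂ q v - det₂ q y) / (det₂ q x - det₂ q y)) • x
      + ((det₂ q x - det₂ q v) / (det₂ q x - det₂ q y)) • y) = det₂ q v := by
    rw [det₂_add_right, det₂_smul_right, det₂_smul_right]
    field_simp
    ring
  generalize ((det₂ q v - det₂ q y) / (det₂ q x - det₂ q y)) • x
      + ((det₂ q x - det₂ q v) / (det₂ q x - det₂ q y)) • y = z at hz hdz
  obtain ⟨s, hs⟩ : ∃ s : ℝ, z - v = s • q :=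
    exists_smul_of_det₂_eq_zero hq (by rw [det₂_sub_right, hdz, sub_self])
  refine ⟨s, ?_, ?_⟩
  · rintro rfl
    rw [zero_smul, sub_eq_zero] at hs
    rw [hs] at hz
    have h₁ := ends_mem_face hz hx hy hi.2
    have h₂ := ends_mem_face hz hx hy hj.2
    refine hij (S.face_unique i j ⟨x, ⟨h₁.1, h₂.1⟩, y, ⟨h₁.2, h₂.2⟩, ?_⟩)
    rintro rfl
    linarith
  · rw [← hs, add_sub_cancel]
    exact convex_polyhedron.openSegment_subset hx hy hz

variable {m n : ℕ} {W : ConvexPolygon m} {p : Fin n → Plane}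

/-- The point `v` is the unique maximum of the cell in the direction orthogonal to `q`. -/
def IsTop (W : ConvexPolygon m) (p : Fin n → Plane) (q v : Plane) (k : Fin n) : Prop :=
  v - p k ∈ centeredCell W p k ∧ ∀ z ∈ centeredCell W p k, det₂ q z ≤ det₂ q (v - p k)

open Classical in
/-- The cells that contain the point `v`. -/
noncomputable def cellsAt (W : ConvexPolygon m) (p : Fin n → Plane) (v : Plane) :
    Finset (Fin n) :=
  Finset.univ.filter fun k => v ∈ cell W p k

theorem mem_cellsAt {v : Plane} {k : Fin n} : k ∈ cellsAt W p v ↔ v ∈ cell W p k := by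
  simp [cellsAt]

theorem mem_cellFace_of_mem_cellsAt {v : Plane} {j k : Fin n} (hj : j ∈ cellsAt W p v)
    (hk : k ∈ cellsAt W p v) (hjk : j ≠ k) : v - p k ∈ cellFace W p k (.bisector j) := by
  have hk' := mem_cellsAt.1 hk
  refine ⟨mem_centeredCell_iff.2 hk', ?_⟩
  rw [levelOf_bisector hjk]
  exact (dist_eq_iff _ _ _).1 (le_antisymm ((mem_cellsAt.1 hj).2 k hjk.symm) (hk'.2 j hjk))

/-- A vertex in the interior of the world belongs to at least three cells. -/
theorem two_lt_card_cellsAt {v : Plane} {k : Fin n} (hv : v ∈ (cell W p k).extremePoints ℝ)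
    (hint : ∀ i, inner ℝ (W.normal i) v ≠ W.offset i) : 2 < (cellsAt W p v).card := by
  obtain ⟨L, L', hne, hL, hL'⟩ := exists_tight_pair (mem_extremePoints_iff.1 hv)
  have key : ∀ {L : LineLabel n m}, v - p k ∈ cellFace W p k L →
      ∃ j, j ≠ k ∧ L = .bisector j ∧ j ∈ cellsAt W p v := by
    intro L hL
    have hL₀ := ne_bisector_self hL
    cases L with
    | bisector j =>
      have hjk : j ≠ k := fun h => hL₀ (by rw [h])
      have heq : dist v (p k) = dist v (p j) := ((mem_cellFace_iff hL₀).1 hL).2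
      refine ⟨j, hjk, rfl, mem_cellsAt.2 ⟨hv.1.1, fun i _ => ?_⟩⟩
      rw [← heq]
      by_cases hik : i = k
      · rw [hik]
      · exact hv.1.2 i hik
    | boundary i => exact absurd ((mem_cellFace_iff hL₀).1 hL).2 (hint i)
  obtain ⟨j, hjk, rfl, hj⟩ := key hL
  obtain ⟨j', hjk', rfl, hj'⟩ := key hL'
  exact Finset.two_lt_card.2 ⟨k, mem_cellsAt.2 hv.1, j, hj, j', hj', hjk.symm, hjk'.symm,
    fun h => hne (by rw [h])⟩

open Classical in
/-- Most of the cells at a vertex have an extreme point there. -/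
theorem card_cellsAt_le (hp : Function.Injective p) (hint : ∀ k, p k ∈ interior W.carrier)
    {q v : Plane} (hq : q ≠ 0) (hgen : ∀ j k, j ≠ k → inner ℝ q (p j - p k) ≠ 0)
    (hcard : 2 < (cellsAt W p v).card) :
    (cellsAt W p v).card ≤ 3 * ((Finset.univ.filter fun k => IsTop W p q v k).card
      + (Finset.univ.filter fun k => IsTop W p (-q) v k).card) := by
  have hbeside : ∀ k ∈ cellsAt W p v, ¬ IsTop W p q v k → ¬ IsTop W p (-q) v k →
      ∃ s : ℝ, s ≠ 0 ∧ v - p k + s • q ∈ centeredCell W p k := by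
    intro k hk h₁ h₂
    have hmem := mem_centeredCell_iff.2 (mem_cellsAt.1 hk)
    have hc : 1 < ((cellsAt W p v).erase k).card := by
      rw [Finset.card_erase_of_mem hk]; omega
    obtain ⟨j, hj, j', hj', hne⟩ := Finset.one_lt_card.1 hc
    rw [Finset.mem_erase] at hj hj'
    exact (isPolygonSystem hp hint k).exists_beside hq (i := .bisector j) (j := .bisector j')
      (fun h => hne (by cases h; rfl)) (mem_cellFace_of_mem_cellsAt hj.2 hk hj.1)
      (mem_cellFace_of_mem_cellsAt hj'.2 hk hj'.1) (fun h => h₁ ⟨hmem, h⟩)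
      (fun h => h₂ ⟨hmem, h⟩)
  -- Every other cell at `v` contributes a bisector through `v`, which restricts the sign of a move
  -- along `q` inside the cell of `p k`.
  have hside : ∀ k ∈ cellsAt W p v, ∀ j ∈ cellsAt W p v, j ≠ k → ∀ s : ℝ,
      v - p k + s • q ∈ centeredCell W p k → s * inner ℝ q (p j - p k) ≤ 0 := by
    intro k hk j hj hjk s hs
    have h₁ := (mem_cellFace_of_mem_cellsAt hj hk hjk).2
    have h₂ := hs (.bisector j)
    rw [inner_add_right, h₁, inner_smul_right, real_inner_comm] at h₂
    have h₃ : s * inner ℝ q (normalOf W p k (.bisector j)) ≤ 0 := by linarith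
    exact h₃
  -- Two cells cannot extend to the same side of `v` along `q`: their common bisector allows
  -- opposite signs only, and genericity of `q` makes this strict.
  have hone : ∀ k ∈ cellsAt W p v, ∀ j ∈ cellsAt W p v, ∀ s t : ℝ, 0 < s * t →
      v - p k + s • q ∈ centeredCell W p k → v - p j + t • q ∈ centeredCell W p j → k = j := by
    intro k hk j hj s t hst hs ht
    by_contra hkj
    have h₁ := hside k hk j hj (Ne.symm hkj) s hs
    have h₂ := hside j hj k hk hkj t ht
    have h₃ : p k - p j = -(p j - p k) := by abel
    rw [h₃, inner_neg_right] at h₂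
    have hg := hgen j k (Ne.symm hkj)
    generalize inner ℝ q (p j - p k) = g at h₁ h₂ hg
    have h₄ : 0 < s * t * (g * g) := mul_pos hst (mul_self_pos.2 hg)
    have h₅ : 0 ≤ (s * g) * (t * -g) := mul_nonneg_of_nonpos_of_nonpos h₁ h₂
    linarith
  let A := (cellsAt W p v).filter fun k =>
    ∃ s : ℝ, 0 < s ∧ v - p k + s • q ∈ centeredCell W p k
  let B := (cellsAt W p v).filter fun k =>
    ∃ s : ℝ, s < 0 ∧ v - p k + s • q ∈ centeredCell W p k
  have hA : A.card ≤ 1 := by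
    refine Finset.card_le_one.2 fun k hk j hj => ?_
    obtain ⟨hk, s, hs, hs'⟩ := Finset.mem_filter.1 hk
    obtain ⟨hj, t, ht, ht'⟩ := Finset.mem_filter.1 hj
    exact hone k hk j hj s t (mul_pos hs ht) hs' ht'
  have hB : B.card ≤ 1 := by
    refine Finset.card_le_one.2 fun k hk j hj => ?_
    obtain ⟨hk, s, hs, hs'⟩ := Finset.mem_filter.1 hk
    obtain ⟨hj, t, ht, ht'⟩ := Finset.mem_filter.1 hj
    exact hone k hk j hj s t (mul_pos_of_neg_of_neg hs ht) hs' ht'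
  have hsub : cellsAt W p v ⊆ ((Finset.univ.filter fun k => IsTop W p q v k)
      ∪ (Finset.univ.filter fun k => IsTop W p (-q) v k)) ∪ (A ∪ B) := by
    intro k hk
    by_cases h₁ : IsTop W p q v k
    · simp [h₁]
    by_cases h₂ : IsTop W p (-q) v k
    · simp [h₂]
    obtain ⟨s, hs, hs'⟩ := hbeside k hk h₁ h₂
    refine Finset.mem_union_right _ ?_
    rcases lt_or_gt_of_ne hs with hs | hs
    · exact Finset.mem_union_right _ (Finset.mem_filter.2 ⟨hk, s, hs, hs'⟩)
    · exact Finset.mem_union_left _ (Finset.mem_filter.2 ⟨hk, s, hs, hs'⟩)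
  have h₁ := Finset.card_le_card hsub
  have h₂ := Finset.card_union_le ((Finset.univ.filter fun k => IsTop W p q v k)
      ∪ (Finset.univ.filter fun k => IsTop W p (-q) v k)) (A ∪ B)
  have h₃ := Finset.card_union_le (Finset.univ.filter fun k => IsTop W p q v k)
    (Finset.univ.filter fun k => IsTop W p (-q) v k)
  have h₄ := Finset.card_union_le A B
  -- With `x` tops and bottoms at `v`, the number of cells is at least `3` and at most `x + 2`; so
  -- `x ≥ 1` and `x + 2 ≤ 3 * x`.
  omega

open Classical in
-- Double counting: for generic `q` each of the `n` cells has its maximum at no more than one point.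
theorem sum_card_isTop_le {q : Plane} (hq : q ≠ 0) (hgen : ∀ j k, j ≠ k → inner ℝ q (p j - p k) ≠ 0)
    (hgen' : ∀ i, inner ℝ q (W.normal i) ≠ 0) (V : Finset Plane) :
    ∑ v ∈ V, (Finset.univ.filter fun k => IsTop W p q v k).card ≤ n := by
  have hswap : ∑ v ∈ V, (Finset.univ.filter fun k => IsTop W p q v k).card
      = ∑ k : Fin n, (V.filter fun v => IsTop W p q v k).card := by
    simp only [Finset.card_filter]
    exact Finset.sum_comm
  rw [hswap]
  have hle : ∀ k ∈ (Finset.univ : Finset (Fin n)),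
      (V.filter fun v => IsTop W p q v k).card ≤ 1 := by
    intro k _
    refine Finset.card_le_one.2 fun v hv v' hv' => ?_
    have h := (Finset.mem_filter.1 hv).2
    have h' := (Finset.mem_filter.1 hv').2
    refine sub_left_injective (eq_of_isMax_det₂ hq ?_ h.1 h'.1 h.2 h'.2)
    rintro (j | i) ⟨x, hx⟩
    · exact hgen j k fun h => ne_bisector_self hx (by rw [h])
    · exact hgen' i
  calc ∑ k : Fin n, (V.filter fun v => IsTop W p q v k).card
      ≤ ∑ _k : Fin n, 1 := Finset.sum_le_sum hle
    _ = n := by simp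

open Classical in
/-- Counted with multiplicity, the cells have at most `6 * n` vertices in the interior of the
world. -/
theorem sum_card_interior_vertices_le (hp : Function.Injective p)
    (hint : ∀ k, p k ∈ interior W.carrier) (V : Fin n → Finset Plane)
    (hV : ∀ k, ∀ v ∈ V k, v ∈ (cell W p k).extremePoints ℝ ∧
      ∀ i, inner ℝ (W.normal i) v ≠ W.offset i) :
    ∑ k, (V k).card ≤ 6 * n := by
  obtain ⟨q, hq, hgen⟩ := exists_inner_ne_zero
    ((Finset.univ.image fun x : Fin n × Fin n => p x.1 - p x.2)
      ∪ Finset.univ.image fun i => W.normal i)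
  have hg : ∀ j k, j ≠ k → inner ℝ q (p j - p k) ≠ 0 := fun j k hjk =>
    hgen _ (Finset.mem_union_left _ (Finset.mem_image.2 ⟨(j, k), Finset.mem_univ _, rfl⟩))
      (sub_ne_zero.2 fun h => hjk (hp h))
  have hg' : ∀ i, inner ℝ q (W.normal i) ≠ 0 := fun i =>
    hgen _ (Finset.mem_union_right _ (Finset.mem_image.2 ⟨i, Finset.mem_univ _, rfl⟩))
      (W.normal_ne_zero i)
  let U := Finset.univ.biUnion V
  have hU : ∀ v ∈ U, 2 < (cellsAt W p v).card := by
    intro v hv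
    obtain ⟨k, -, hk⟩ := Finset.mem_biUnion.1 hv
    exact two_lt_card_cellsAt (hV k v hk).1 (hV k v hk).2
  have hswap : ∑ k, (V k).card = ∑ v ∈ U, (Finset.univ.filter fun k => v ∈ V k).card := by
    have h₁ : ∀ k, (V k).card = (U.filter fun v => v ∈ V k).card := by
      intro k
      congr 1
      ext v
      simp only [Finset.mem_filter]
      exact ⟨fun h => ⟨Finset.mem_biUnion.2 ⟨k, Finset.mem_univ _, h⟩, h⟩, fun h => h.2⟩
    simp only [h₁, Finset.card_filter]
    exact Finset.sum_comm
  have hpt : ∀ v ∈ U, (Finset.univ.filter fun k => v ∈ V k).card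
      ≤ 3 * ((Finset.univ.filter fun k => IsTop W p q v k).card
        + (Finset.univ.filter fun k => IsTop W p (-q) v k).card) := by
    intro v hv
    refine le_trans (Finset.card_le_card fun k hk => ?_) (card_cellsAt_le hp hint hq hg (hU v hv))
    exact mem_cellsAt.2 (hV k v (Finset.mem_filter.1 hk).2).1.1
  have h₁ := sum_card_isTop_le hq hg hg' U
  have h₂ := sum_card_isTop_le (neg_ne_zero.2 hq)
    (fun j k hjk => by rw [inner_neg_left]; exact neg_ne_zero.2 (hg j k hjk))
    (fun i => by rw [inner_neg_left]; exact neg_ne_zero.2 (hg' i)) U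
  rw [hswap]
  refine (Finset.sum_le_sum hpt).trans ?_
  rw [← Finset.mul_sum, Finset.sum_add_distrib]
  omega

open Classical in
/-- A cell has at most two vertices on each side of the world. -/
theorem card_boundary_vertices_le {k : Fin n} (V : Finset Plane)
    (hV : ∀ v ∈ V, v ∈ (cell W p k).extremePoints ℝ ∧
      ∃ i, inner ℝ (W.normal i) v = W.offset i) : V.card ≤ 2 * m := by
  have hsub : V ⊆ (Finset.univ : Finset (Fin m)).biUnion fun i =>
      V.filter fun v => inner ℝ (W.normal i) v = W.offset i := by
    intro v hv
    obtain ⟨i, hi⟩ := (hV v hv).2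
    exact Finset.mem_biUnion.2 ⟨i, Finset.mem_univ _, Finset.mem_filter.2 ⟨hv, hi⟩⟩
  have hcard : ∀ i ∈ (Finset.univ : Finset (Fin m)),
      (V.filter fun v => inner ℝ (W.normal i) v = W.offset i).card ≤ 2 := by
    intro i _
    by_contra hcon
    obtain ⟨a, ha, b, hb, c, hc, hab, hac, hbc⟩ := Finset.two_lt_card.1 (not_le.1 hcon)
    obtain ⟨ha, ha'⟩ := Finset.mem_filter.1 ha
    obtain ⟨hb, hb'⟩ := Finset.mem_filter.1 hb
    obtain ⟨hc, hc'⟩ := Finset.mem_filter.1 hc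
    have ea := (hV a ha).1
    have eb := (hV b hb).1
    have ec := (hV c hc).1
    rcases exists_mem_openSegment_of_line (W.normal_ne_zero i) (ha'.trans hb'.symm)
      (hb'.trans hc'.symm) hab hac hbc with h | h | h
    · exact hab (ea.2 eb.1 ec.1 h).symm
    · exact hab (eb.2 ea.1 ec.1 h)
    · exact hac (ec.2 ea.1 eb.1 h)
  calc V.card ≤ _ := Finset.card_le_card hsub
    _ ≤ Finset.card (Finset.univ : Finset (Fin m)) * 2 := Finset.card_biUnion_le_card_mul _ _ _ hcard
    _ = 2 * m := by simp [mul_comm]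

open Classical in
/-- The total number of edges of the cells is linear in the number of sites. -/
theorem sum_edgeCount_le (hp : Function.Injective p) (hint : ∀ k, p k ∈ interior W.carrier) :
    ∑ k, edgeCount W p k ≤ (5 * m + 12) * n := by
  -- Each bisector edge is charged to an extreme point on it. As at most two edges pass through a
  -- point, there are at most twice as many such edges as points charged.
  have hex : ∀ (k j : Fin n), ∃ v : Plane, .bisector j ∈ edgeLabels W p k →
      v - p k ∈ cellFace W p k (.bisector j) ∧ v ∈ (cell W p k).extremePoints ℝ := by
    intro k j
    by_cases h : .bisector j ∈ edgeLabels W p k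
    · obtain ⟨v, hv, hv'⟩ := (isPolygonSystem hp hint k).exists_extreme_mem_face h
      refine ⟨p k + v, fun _ => ⟨by rw [add_sub_cancel_left]; exact hv, ?_⟩⟩
      rw [mem_extremePoints_iff, add_sub_cancel_left]
      exact hv'
    · exact ⟨0, fun h' => absurd h' h⟩
  choose v hv using hex
  let B : Fin n → Finset (Fin n) := fun k =>
    Finset.univ.filter fun j => .bisector j ∈ edgeLabels W p k
  let V : Fin n → Finset Plane := fun k => (B k).image (v k)
  let Vint : Fin n → Finset Plane := fun k =>
    (V k).filter fun x => ∀ i, inner ℝ (W.normal i) x ≠ W.offset i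
  have hVext : ∀ k, ∀ x ∈ V k, x ∈ (cell W p k).extremePoints ℝ := by
    intro k x hx
    obtain ⟨j, hj, rfl⟩ := Finset.mem_image.1 hx
    exact (hv k j (Finset.mem_filter.1 hj).2).2
  have hBV : ∀ k, (B k).card ≤ 2 * (V k).card := by
    intro k
    refine Finset.card_le_mul_card_image _ _ fun x _ => ?_
    by_contra hcon
    obtain ⟨a, ha, b, hb, c, hc, hab, hac, hbc⟩ := Finset.two_lt_card.1 (not_le.1 hcon)
    obtain ⟨ha, ha'⟩ := Finset.mem_filter.1 ha
    obtain ⟨hb, hb'⟩ := Finset.mem_filter.1 hb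
    obtain ⟨hc, hc'⟩ := Finset.mem_filter.1 hc
    have ea := (Finset.mem_filter.1 ha).2
    have eb := (Finset.mem_filter.1 hb).2
    have ec := (Finset.mem_filter.1 hc).2
    have inj : ∀ {i j : Fin n}, i ≠ j →
        (LineLabel.bisector i : LineLabel n m) ≠ .bisector j := by
      intro i j hij h
      cases h
      exact hij rfl
    exact (isPolygonSystem hp hint k).not_three_faces (inj hab) (inj hac) (inj hbc)
      (ha' ▸ (hv k a ea).1) (hb' ▸ (hv k b eb).1) (hc' ▸ (hv k c ec).1) ea eb ec
  have hVV : ∀ k, (V k).card ≤ (Vint k).card + 2 * m := by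
    intro k
    rw [← Finset.card_filter_add_card_filter_not (s := V k)
      (fun x => ∀ i, inner ℝ (W.normal i) x ≠ W.offset i)]
    refine Nat.add_le_add_left (card_boundary_vertices_le (W := W) (p := p) (k := k) _
      fun x hx => ?_) _
    obtain ⟨hx, hx'⟩ := Finset.mem_filter.1 hx
    push Not at hx'
    exact ⟨hVext k x hx, hx'⟩
  have hE : ∀ k, edgeCount W p k ≤ m + (B k).card := by
    intro k
    rw [edgeCount_eq hp hint]
    have hsub : edgeLabels W p k ⊆ ((Finset.univ.image fun i : Fin m =>
        (LineLabel.boundary i : LineLabel n m)) ∪ (B k).image LineLabel.bisector :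
        Finset (LineLabel n m)) := by
      rintro (j | i) hL
      · refine Finset.mem_coe.2 (Finset.mem_union_right _ (Finset.mem_image.2 ⟨j, ?_, rfl⟩))
        exact Finset.mem_filter.2 ⟨Finset.mem_univ _, hL⟩
      · exact Finset.mem_coe.2 (Finset.mem_union_left _ (Finset.mem_image.2
          ⟨i, Finset.mem_univ _, rfl⟩))
    have h₁ := Set.ncard_le_ncard hsub (Finset.finite_toSet _)
    rw [Set.ncard_coe_finset] at h₁
    refine h₁.trans ((Finset.card_union_le _ _).trans (Nat.add_le_add ?_ Finset.card_image_le))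
    exact Finset.card_image_le.trans (by simp)
  have hint6 := sum_card_interior_vertices_le hp hint Vint fun k x hx =>
    ⟨hVext k x (Finset.mem_filter.1 hx).1, (Finset.mem_filter.1 hx).2⟩
  have hk : ∀ k ∈ (Finset.univ : Finset (Fin n)),
      edgeCount W p k ≤ 5 * m + 2 * (Vint k).card := by
    intro k _
    have h₁ := hE k
    have h₂ := hBV k
    have h₃ := hVV k
    omega
  refine (Finset.sum_le_sum hk).trans ?_
  have hsum : ∑ k, 2 * (Vint k).card = 2 * ∑ k, (Vint k).card := (Finset.mul_sum _ _ _).symm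
  rw [Finset.sum_add_distrib, hsum, Finset.sum_const, Finset.card_univ, Fintype.card_fin,
    smul_eq_mul]
  nlinarith

end EdgeBound

end RayVoronoi

/-! ### Assembly of the bounds -/

/-- `C` depends only on the number `m` of sides of the world. The strategy `scan` prescribes
which sites are compared with `p k` along each ray. -/
theorem theorem2 (m : ℕ) :
    ∃ C : ℕ, ∀ (W : RayVoronoi.ConvexPolygon m) (n : ℕ) (p : Fin n → RayVoronoi.Plane)
      (scan : RayVoronoi.Scan n),
      Function.Injective p → (∀ k, p k ∈ interior W.carrier) → scan.Admissible W p →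
      ∃ result : Fin n → RayVoronoi.Timed (RayVoronoi.State n m),
        -- the computation of each cell terminates
        (∀ k, RayVoronoi.HaltsWith W p scan k (result k)) ∧
        -- the output includes all vertices and all edges of the cell, and only vertices are stored
        (∀ k, ∀ v ∈ (RayVoronoi.cell W p k).extremePoints ℝ,
          RayVoronoi.VertexStored (result k).val.output v) ∧
        (∀ k a b, RayVoronoi.IsEdge (RayVoronoi.cell W p k) (segment ℝ a b) →
          RayVoronoi.EdgeStored W p k (result k).val.output a b) ∧
        (∀ k, ∀ E ∈ (result k).val.output, E.point ∈ (RayVoronoi.cell W p k).extremePoints ℝ) ∧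
        -- the time for one cell
        (∀ k, (result k).time ≤ C * ((result k).maxComps * RayVoronoi.edgeCount W p k)) ∧
        -- the time for the whole diagram, one processor, each site compared at most once per ray
        ((∀ k θ, (scan k θ).Nodup) →
          RayVoronoi.cellsTime result Finset.univ ≤ C * n ^ 2) ∧
        -- the time for the whole diagram, `Q` independent processors
        (∀ (Q : ℕ) (A : Fin Q → Finset (Fin n)),
          (Finset.univ.sup fun i => RayVoronoi.cellsTime result (A i)) ≤
            Finset.univ.sup fun i =>
              ∑ k ∈ A i, C * ((result k).maxComps * RayVoronoi.edgeCount W p k)) := by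
  -- The cell is run for `9 * e` passes, enough since `6 * e + 3 ≤ 9 * e` for `e ≥ 1`. The `8`
  -- covers initialization and the final storing, `9 * (14 * m + 54)` the work of the passes, and
  -- `270 = 30 * 9` the comparisons.
  obtain ⟨A₀, hA₀⟩ : ∃ A₀ : ℕ, A₀ = 8 + 9 * (14 * m + 54) + 270 := ⟨_, rfl⟩
  refine ⟨A₀ * (5 * m + 12), fun W n p scan hp hint hscan => ?_⟩
  have he : ∀ k, 1 ≤ RayVoronoi.edgeCount W p k := fun k => by
    rw [RayVoronoi.edgeCount_eq hp hint k]
    exact (RayVoronoi.run_correct hp hint hscan k le_rfl).2.2.2.2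
  have hcorrect := fun k => RayVoronoi.run_correct hp hint hscan k
    (M := 9 * RayVoronoi.edgeCount W p k) (by
      have := he k
      rw [← RayVoronoi.edgeCount_eq hp hint k]
      omega)
  have htime : ∀ k, (RayVoronoi.run W p scan k (9 * RayVoronoi.edgeCount W p k)).time + 1 ≤
      A₀ * ((RayVoronoi.run W p scan k (9 * RayVoronoi.edgeCount W p k)).maxComps *
        RayVoronoi.edgeCount W p k) := by
    intro k
    have h₁ := RayVoronoi.time_run_le (W := W) (p := p) (scan := scan) (k := k)
      (9 * RayVoronoi.edgeCount W p k)
    have h₂ := RayVoronoi.one_le_maxComps_run hint hscan k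
      (M := 9 * RayVoronoi.edgeCount W p k) (by have := he k; omega)
    have h₃ := he k
    generalize (RayVoronoi.run W p scan k (9 * RayVoronoi.edgeCount W p k)).maxComps = r at *
    generalize RayVoronoi.edgeCount W p k = e at *
    have h₄ : e ≤ r * e := Nat.le_mul_of_pos_left e h₂
    have h₅ : e * (9 * (14 * m + 54) + 8) ≤ r * e * (9 * (14 * m + 54) + 8) :=
      Nat.mul_le_mul_right _ h₄
    rw [hA₀]
    linarith
  -- The factor `5 * m + 12`, from the total number of edges, is needed only for the whole diagram;
  -- it is carried along elsewhere so that one constant serves all bounds.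
  have hle : ∀ x, A₀ * x ≤ A₀ * (5 * m + 12) * x := fun x =>
    Nat.mul_le_mul_right _ (Nat.le_mul_of_pos_right _ (by omega))
  refine ⟨fun k => RayVoronoi.run W p scan k (9 * RayVoronoi.edgeCount W p k),
    fun k => ⟨_, rfl, (hcorrect k).1⟩, fun k => (hcorrect k).2.1, fun k => (hcorrect k).2.2.1,
    fun k => (hcorrect k).2.2.2.1, fun k => ?_, fun hnodup => ?_, fun Q A => ?_⟩
  · exact (Nat.le_succ _).trans ((htime k).trans (hle _))
  · calc RayVoronoi.cellsTime _ Finset.univ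
        ≤ ∑ k, A₀ * n * RayVoronoi.edgeCount W p k := Finset.sum_le_sum fun k _ => by
          refine (htime k).trans ?_
          rw [mul_assoc]
          exact Nat.mul_le_mul_left _ (Nat.mul_le_mul_right _
            (RayVoronoi.maxComps_run_le (hnodup k) _))
      _ = A₀ * n * ∑ k, RayVoronoi.edgeCount W p k := (Finset.mul_sum _ _ _).symm
      _ ≤ A₀ * n * ((5 * m + 12) * n) :=
          Nat.mul_le_mul_left _ (RayVoronoi.sum_edgeCount_le hp hint)
      _ = A₀ * (5 * m + 12) * n ^ 2 := by ring
  · exact Finset.sup_mono_fun fun i _ => Finset.sum_le_sum fun k _ => (htime k).trans (hle _)
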